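/- Let $T$ be a finite tree on $n\ge 1$ vertices with a query cost function $c\colon V(T)\to\mathbb N$ (the cost of querying a vertex does not depend on the target) and a weight function $w\colon V(T)\to\mathbb N$ (with $0\in\mathbb N$). A *decision tree* for a connected graph $G$ consists of a root labelled by a vertex $v\in V(G)$ (the first query) and, for every connected component $H$ of $G-v$, one child subtree that is a decision tree for $H$. For a target $x\in V(G)$ let $Q(D,x)$ be the sequence of vertices queried on the path of $D$ from its root to $x$ (including $x$). The weighted average-case cost of a decision tree $D$ for $T$ is $$c_T(D)=\sum_{x\in V(T)}w(x)\sum_{v\in Q(D,x)}c(v),$$ and $\mathrm{OPT}(T)$ denotes the minimum of $c_T(D)$ over all decision trees $D$ for $T$. The Tree Search Problem asks for a decision tree $D$ minimizing $c_T(D)$. **Theorem.** For every $\epsilon>0$ there is a $(4+\epsilon)$-approximation algorithm for the Tree Search Problem with target-independent costs that runs in time $O(n^4/\epsilon^2)$ (and in time $O(n^4)$ when $\epsilon>1$). More precisely, there are a single word RAM program $P$ and constants $\kappa\in\mathbb N$, $C\in\mathbb R$ such that the following holds for every real $\epsilon>0$, all $p,q\in\mathbb N$ with $q>0$ and $\epsilon/2\le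 p/q\le\epsilon$ (so $p/q=\epsilon$ is allowed when $\epsilon$ is rational), every $n$, every tree $T$ with vertex set $\{0,\dots,n-1\}$, and all $c,w\colon V(T)\to\mathbb N$. Given $n,p,q$, the adjacency matrix of $T$, and the lists of values of $c$ and $w$ as input, on a machine whose words hold the natural numbers smaller than $\bigl(n+\sum_v c(v)+\sum_v w(v)+p+q+2\bigr)^{\kappa}$, with unit cost for register and array access, addition, truncated subtraction, multiplication, integer division and comparison, $P$ halts without overflow after at most $C\,n^4\max(1,1/\epsilon^2)$ elementary steps, and its output is the parent array of a decision tree $D$ for $T$ with $$c_T(D)\le(4+\epsilon)\cdot\mathrm{OPT}(T).$$ -/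

import Mathlib

/-! ### Decision trees for searching in a graph -/

namespace GraphSearch

/-- A decision tree for the candidate set `S` in the graph `G`: its root queries a vertex `v ∈ S`,
and for every possible response different from "`v` is the target", that is, for every connected
component `H` of the candidate subgraph with `v` deleted, it has exactly one subtree, which is
a decision tree for the vertex set of `H`. -/
inductive DecisionTree {V : Type*} (G : SimpleGraph V) : Set V → Type _
  | node {S : Set V} (v : V) (hv : v ∈ S)
      (child : (H : (G.induce (S \ {v})).ConnectedComponent) →
        DecisionTree G (Subtype.val '' H.supp)) : DecisionTree G S

namespace DecisionTree

open scoped Classical in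
/-- The sequence of queries performed on the path from the root to the query of the target `x`
(the query to `x` itself is included). -/
noncomputable def queries {V : Type*} {G : SimpleGraph V} {S : Set V} :
    DecisionTree G S → V → List V
  | @node _ _ S v _ child, x =>
    v :: (if h : x ∈ S \ {v} then
      (child ((G.induce (S \ {v})).connectedComponentMk ⟨x, h⟩)).queries x else [])

/-- The cost of a decision tree when the target is `x`; `c v x` is the cost of querying `v` when
the target is `x`. -/
noncomputable def cost {V : Type*} {G : SimpleGraph V} {S : Set V} (D : DecisionTree G S)
    (c : V → V → ℕ) (x : V) : ℕ :=
  ((D.queries x).map fun v => c v x).sum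

/-- The weighted average-case cost of a decision tree for the whole graph. -/
noncomputable def avgCost {V : Type*} [Fintype V] {G : SimpleGraph V}
    (D : DecisionTree G Set.univ) (c : V → V → ℕ) (w : V → ℕ) : ℕ :=
  ∑ x, w x * D.cost c x

/-- The array `par` stores the decision tree as a parent array: the entry of the root is `r`, and
the entry of every other vertex is one plus the index of its parent in the decision tree. -/
def StoredAs {n : ℕ} {G : SimpleGraph (Fin n)} (par : ℕ → ℕ) {S : Set (Fin n)} :
    DecisionTree G S → (r : ℕ) → Prop
  | node v _ child, r => par (v : ℕ) = r ∧ ∀ H, (child H).StoredAs par ((v : ℕ) + 1)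

end DecisionTree

/-- The minimum weighted average-case cost of a decision tree for `G`. -/
noncomputable def OPT {V : Type*} [Fintype V] (G : SimpleGraph V) (c : V → V → ℕ) (w : V → ℕ) : ℕ :=
  ⨅ D : DecisionTree G Set.univ, D.avgCost c w

end GraphSearch

/-! ### Word RAM programs with a step count -/

namespace WordRAM

/-- The binary machine operations. -/
inductive Op
  | add | sub | mul | div | lt | eq

/-- Subtraction is truncated, division is rounded down (division by zero gives zero), comparisons
return `1` or `0`. -/
def Op.eval : Op → ℕ → ℕ → ℕ
  | add, a, b => a + b
  | sub, a, b => a - b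
  | mul, a, b => a * b
  | div, a, b => a / b
  | lt, a, b => if a < b then 1 else 0
  | eq, a, b => if a = b then 1 else 0

/-- The memory: registers `reg i` and arrays `arr a`, with entries `arr a i`. A program mentions
only finitely many registers and arrays. -/
structure State where
  reg : ℕ → ℕ
  arr : ℕ → ℕ → ℕ

/-- Store a value in a register. -/
def State.setReg (σ : State) (i v : ℕ) : State :=
  { σ with reg := Function.update σ.reg i v }

/-- Store a value in an entry of an array. -/
def State.setArr (σ : State) (a i v : ℕ) : State :=
  { σ with arr := Function.update σ.arr a (Function.update (σ.arr a) i v) }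

/-- Expressions: literals, registers, array entries and machine operations. -/
inductive Expr
  | lit (k : ℕ)
  | reg (i : ℕ)
  | read (a : ℕ) (e : Expr)
  | bin (op : Op) (e₁ e₂ : Expr)

namespace Expr

/-- The value of an expression. -/
def eval (σ : State) : Expr → ℕ
  | lit k => k
  | reg i => σ.reg i
  | read a e => σ.arr a (e.eval σ)
  | bin op e₁ e₂ => op.eval (e₁.eval σ) (e₂.eval σ)

/-- The number of elementary operations needed to evaluate an expression. -/
def size : Expr → ℕ
  | lit _ => 1
  | reg _ => 1
  | read _ e => e.size + 1
  | bin _ e₁ e₂ => e₁.size + e₂.size + 1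

/-- Every value that occurs during the evaluation, addresses and intermediate results included,
is smaller than `B`, that is, fits in a machine word. -/
def Fits (B : ℕ) (σ : State) : Expr → Prop
  | lit k => k < B
  | reg i => σ.reg i < B
  | read a e => e.Fits B σ ∧ σ.arr a (e.eval σ) < B
  | bin op e₁ e₂ => e₁.Fits B σ ∧ e₂.Fits B σ ∧ op.eval (e₁.eval σ) (e₂.eval σ) < B

end Expr

/-- Programs. -/
inductive Program
  | skip
  | assign (i : ℕ) (e : Expr)
  | store (a : ℕ) (idx e : Expr)
  | seq (P Q : Program)
  | ite (e : Expr) (P Q : Program)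
  | while (e : Expr) (P : Program)

/-- `Exec B P σ σ' t`: on a machine whose words hold the numbers smaller than `B`, the program `P`
started in `σ` halts in `σ'` after exactly `t` elementary steps. A run in which some value does not
fit in a word gets stuck, so it has no final state. A condition holds if its value is not `0`. -/
inductive Exec (B : ℕ) : Program → State → State → ℕ → Prop
  | skip (σ : State) : Exec B .skip σ σ 1
  | assign {σ : State} {i : ℕ} {e : Expr} (he : e.Fits B σ) :
      Exec B (.assign i e) σ (σ.setReg i (e.eval σ)) (e.size + 1)
  | store {σ : State} {a : ℕ} {idx e : Expr} (hidx : idx.Fits B σ) (he : e.Fits B σ) :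
      Exec B (.store a idx e) σ (σ.setArr a (idx.eval σ) (e.eval σ)) (idx.size + e.size + 1)
  | seq {P Q : Program} {σ σ' σ'' : State} {s t : ℕ}
      (hP : Exec B P σ σ' s) (hQ : Exec B Q σ' σ'' t) : Exec B (.seq P Q) σ σ'' (s + t)
  | ite_true {e : Expr} {P Q : Program} {σ σ' : State} {t : ℕ} (he : e.Fits B σ)
      (h : e.eval σ ≠ 0) (hP : Exec B P σ σ' t) : Exec B (.ite e P Q) σ σ' (e.size + 1 + t)
  | ite_false {e : Expr} {P Q : Program} {σ σ' : State} {t : ℕ} (he : e.Fits B σ)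
      (h : e.eval σ = 0) (hQ : Exec B Q σ σ' t) : Exec B (.ite e P Q) σ σ' (e.size + 1 + t)
  | while_true {e : Expr} {P : Program} {σ σ' σ'' : State} {s t : ℕ} (he : e.Fits B σ)
      (h : e.eval σ ≠ 0) (hP : Exec B P σ σ' s) (hW : Exec B (.while e P) σ' σ'' t) :
      Exec B (.while e P) σ σ'' (e.size + 1 + s + t)
  | while_false {e : Expr} {P : Program} {σ : State} (he : e.Fits B σ) (h : e.eval σ = 0) :
      Exec B (.while e P) σ σ (e.size + 1)

end WordRAM

/-! ### Inputs -/

namespace GraphSearch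

open scoped Classical in
/-- The initial memory: registers `0, 1, 2` hold the number `n` of vertices and the accuracy
parameter `p / q`, array `0` holds the adjacency matrix row by row, arrays `1` and `2` hold the
costs and the weights, and everything else is `0`. -/
noncomputable def input {n : ℕ} (T : SimpleGraph (Fin n)) (c w : Fin n → ℕ) (p q : ℕ) :
    WordRAM.State where
  reg := fun i => if i = 0 then n else if i = 1 then p else if i = 2 then q else 0
  arr := fun a i =>
    if a = 0 then (if ∃ u v : Fin n, i = (u : ℕ) * n + (v : ℕ) ∧ T.Adj u v then 1 else 0)
    else if a = 1 then (if h : i < n then c ⟨i, h⟩ else 0)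
    else if a = 2 then (if h : i < n then w ⟨i, h⟩ else 0)
    else 0

/-- A machine word holds the numbers smaller than this bound, so it consists of
`O(log (n + ∑ c + ∑ w + p + q))` bits for every fixed `κ`. -/
def wordBound (κ : ℕ) {n : ℕ} (c w : Fin n → ℕ) (p q : ℕ) : ℕ :=
  (n + (∑ v, c v) + (∑ v, w v) + p + q + 2) ^ κ

end GraphSearch

/-! Fix a competing decision tree `D'` and let h v be the weight of the candidate set in which it
queries v. Counting per query instead of per target shows that `D'` costs at least ∑ c v * h v
(`sum_candidateWeight_le`). These numbers provide separators at every scale: deleting {v | k < 2 * h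
v} leaves only components of weight at most k / 2, because the first vertex of such a component that
`D'` queries has the whole component in its candidate set and was not deleted
(`IsRooted.isProfile`).

The algorithm works in phases. If M is the largest weight of a remaining component, it finds by
dynamic programming a cheapest set S whose removal leaves components of weight about M / 2, and
queries S, paying at most M * c v for each vertex. When M = 0, all further queries are free. S
separates the whole tree, not only what remains, so {v | M < 2 * h v} is always an admissible
competitor and S costs no more than it. To keep the tables small, weights are rounded down to units
of M / (2K) with K = n * L: the competitor stays feasible, and the next maximum M' still satisfies 2
* L * M' ≤ (L + 1) * M.

The potential ∑ c v * min (2 * h v) M pays for the phases: every vertex with M < 2 * h v loses at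
least M - M' ≥ (L - 1) / (2L) * M per unit of cost (`potential_step`). Since the potential never
exceeds 2 * ∑ c v * h v, the total cost is at most 4L / (L - 1) times the cost of `D'`. The choice L
= 2 + ⌊4q / p⌋ turns this factor into at most 4 + ε.

Each phase removes a new vertex, so there are at most n phases. A phase merges n rows of length K +
1 in quadratic time each, which gives n² K² = O(n⁴ L²) steps in total. What remains is to read an
elimination sequence as a decision tree (`IsRooted.exists_tree_of_elim`) and to verify the program,
including the absence of overflow, with the time-bounded Hoare calculus `Runs`. -/

namespace WordRAM

/-! ### A total-correctness calculus with step counts -/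

/-- `Runs B P σ T Q`: started in `σ`, the program `P` halts after at most `T` steps in a state
that satisfies `Q`. -/
def Runs (B : ℕ) (P : Program) (σ : State) (T : ℕ) (Q : State → Prop) : Prop :=
  ∃ σ' t, Exec B P σ σ' t ∧ t ≤ T ∧ Q σ'

namespace Program

/-- Does the program contain an assignment to the register `r`? -/
def writesReg : Program → ℕ → Bool
  | skip, _ => false
  | assign i _, r => r == i
  | store _ _ _, _ => false
  | seq P Q, r => P.writesReg r || Q.writesReg r
  | ite _ P Q, r => P.writesReg r || Q.writesReg r
  | .while _ P, r => P.writesReg r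

/-- Does the program contain a store into the array `a`? -/
def writesArr : Program → ℕ → Bool
  | skip, _ => false
  | assign _ _, _ => false
  | store b _ _, a => a == b
  | seq P Q, a => P.writesArr a || Q.writesArr a
  | ite _ P Q, a => P.writesArr a || Q.writesArr a
  | .while _ P, a => P.writesArr a

/-- Is the program free of loops? -/
def loopFree : Program → Bool
  | skip => true
  | assign _ _ => true
  | store _ _ _ => true
  | seq P Q => P.loopFree && Q.loopFree
  | ite _ P Q => P.loopFree && Q.loopFree
  | .while _ _ => false

/-- The effect of a loop-free program. -/
def run : Program → State → State
  | skip, σ => σ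
  | assign i e, σ => σ.setReg i (e.eval σ)
  | store a idx e, σ => σ.setArr a (idx.eval σ) (e.eval σ)
  | seq P Q, σ => Q.run (P.run σ)
  | ite e P Q, σ => if e.eval σ = 0 then Q.run σ else P.run σ
  | .while _ _, σ => σ

/-- No overflow occurs in a loop-free program. -/
def Safe (B : ℕ) : Program → State → Prop
  | skip, _ => True
  | assign _ e, σ => e.Fits B σ
  | store _ idx e, σ => idx.Fits B σ ∧ e.Fits B σ
  | seq P Q, σ => P.Safe B σ ∧ Q.Safe B (P.run σ)
  | ite e P Q, σ => e.Fits B σ ∧ (e.eval σ ≠ 0 → P.Safe B σ) ∧ (e.eval σ = 0 → Q.Safe B σ)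
  | .while _ _, _ => True

/-- A bound for the running time of a loop-free program. -/
def time : Program → ℕ
  | skip => 1
  | assign _ e => e.size + 1
  | store _ idx e => idx.size + e.size + 1
  | seq P Q => P.time + Q.time
  | ite e P Q => e.size + 1 + max P.time Q.time
  | .while _ _ => 0

/-- The loop in which the register `i` runs from `lo` to `hi - 1`. -/
def forLoop (i : ℕ) (lo hi : Expr) (body : Program) : Program :=
  seq (assign i lo)
    (.while (.bin .lt (.reg i) hi) (seq body (assign i (.bin .add (.reg i) (.lit 1)))))

end Program

/-- The states `σ` and `σ'` agree on all registers and arrays that `P` does not write. -/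
structure Frame (P : Program) (σ σ' : State) : Prop where
  reg : ∀ r, P.writesReg r = false → σ'.reg r = σ.reg r
  arr : ∀ a, P.writesArr a = false → σ'.arr a = σ.arr a

theorem Frame.refl (P : Program) (σ : State) : Frame P σ σ := ⟨fun _ _ => rfl, fun _ _ => rfl⟩

theorem Frame.trans {P : Program} {σ σ' σ'' : State} (h : Frame P σ σ') (h' : Frame P σ' σ'') :
    Frame P σ σ'' :=
  ⟨fun r hr => (h'.reg r hr).trans (h.reg r hr), fun a ha => (h'.arr a ha).trans (h.arr a ha)⟩

theorem Frame.mono {P Q : Program} {σ σ' : State} (h : Frame P σ σ')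
    (hr : ∀ r, Q.writesReg r = false → P.writesReg r = false)
    (ha : ∀ a, Q.writesArr a = false → P.writesArr a = false) : Frame Q σ σ' :=
  ⟨fun r h' => h.reg r (hr r h'), fun a h' => h.arr a (ha a h')⟩

/-- Which registers and arrays survive is a syntactic, computable question, so for concrete programs
the side conditions are later closed by `rfl`. -/
theorem Exec.frame {B : ℕ} {P : Program} {σ σ' : State} {t : ℕ} (h : Exec B P σ σ' t) :
    Frame P σ σ' := by
  induction h with
  | skip σ => exact Frame.refl _ _
  | assign he =>
    refine ⟨fun r hr => ?_, fun a _ => rfl⟩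
    simp only [Program.writesReg, beq_eq_false_iff_ne] at hr
    simp [State.setReg, Function.update_of_ne hr]
  | store hidx he =>
    refine ⟨fun r hr => rfl, fun a ha => ?_⟩
    simp only [Program.writesArr, beq_eq_false_iff_ne] at ha
    simp [State.setArr, Function.update_of_ne ha]
  | seq _ _ ihP ihQ =>
    refine (ihP.mono ?_ ?_).trans (ihQ.mono ?_ ?_) <;>
      simp +contextual [Program.writesReg, Program.writesArr]
  | ite_true _ _ _ ih =>
    refine ih.mono ?_ ?_ <;> simp +contextual [Program.writesReg, Program.writesArr]
  | ite_false _ _ _ ih =>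
    refine ih.mono ?_ ?_ <;> simp +contextual [Program.writesReg, Program.writesArr]
  | while_true _ _ _ _ ihP ihW => exact Frame.trans (P := .while _ _) (ihP.mono (fun _ h => h) (fun _ h => h)) ihW
  | while_false _ _ => exact Frame.refl _ _

namespace Runs

variable {B T T₁ T₂ : ℕ} {P P₁ P₂ : Program} {σ : State} {Q Q' : State → Prop}

theorem mono (h : Runs B P σ T₁ Q') (hT : T₁ ≤ T) (hQ : ∀ σ', Frame P σ σ' → Q' σ' → Q σ') :
    Runs B P σ T Q := by
  obtain ⟨σ', t, he, ht, hq⟩ := h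
  exact ⟨σ', t, he, ht.trans hT, hQ σ' he.frame hq⟩

theorem seq (h : Runs B P₁ σ T₁ Q')
    (h' : ∀ σ', Frame P₁ σ σ' → Q' σ' → Runs B P₂ σ' T₂ Q) (hT : T₁ + T₂ ≤ T) :
    Runs B (.seq P₁ P₂) σ T Q := by
  obtain ⟨σ', t, he, ht, hq⟩ := h
  obtain ⟨σ'', t', he', ht', hq'⟩ := h' σ' he.frame hq
  exact ⟨σ'', t + t', .seq he he', by omega, hq'⟩

theorem ite {e : Expr} (he : e.Fits B σ) (h₁ : e.eval σ ≠ 0 → Runs B P₁ σ T₁ Q)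
    (h₂ : e.eval σ = 0 → Runs B P₂ σ T₁ Q) (hT : e.size + 1 + T₁ ≤ T) :
    Runs B (.ite e P₁ P₂) σ T Q := by
  by_cases h : e.eval σ = 0
  · obtain ⟨σ', t, hx, ht, hq⟩ := h₂ h
    exact ⟨σ', _, .ite_false he h hx, by omega, hq⟩
  · obtain ⟨σ', t, hx, ht, hq⟩ := h₁ h
    exact ⟨σ', _, .ite_true he h hx, by omega, hq⟩

theorem run_of_loopFree (P : Program) (σ : State) (h : P.loopFree = true) (hs : P.Safe B σ) :
    ∃ t, Exec B P σ (P.run σ) t ∧ t ≤ P.time := by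
  induction P generalizing σ with
  | skip => exact ⟨1, .skip σ, le_rfl⟩
  | assign i e => exact ⟨_, .assign hs, le_rfl⟩
  | store a idx e => exact ⟨_, .store hs.1 hs.2, le_rfl⟩
  | seq P Q ihP ihQ =>
    simp only [Program.loopFree, Bool.and_eq_true] at h
    obtain ⟨t, he, ht⟩ := ihP σ h.1 hs.1
    obtain ⟨t', he', ht'⟩ := ihQ _ h.2 hs.2
    exact ⟨_, .seq he he', Nat.add_le_add ht ht'⟩
  | ite e P Q ihP ihQ =>
    simp only [Program.loopFree, Bool.and_eq_true] at h
    simp only [Program.time, Program.run]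
    split_ifs with h0
    · obtain ⟨t, he, ht⟩ := ihQ σ h.2 (hs.2.2 h0)
      exact ⟨_, .ite_false hs.1 h0 he, by omega⟩
    · obtain ⟨t, he, ht⟩ := ihP σ h.1 (hs.2.1 h0)
      exact ⟨_, .ite_true hs.1 h0 he, by omega⟩
  | _ => simp [Program.loopFree] at h

/-- Loop-free blocks are executed symbolically: unfolding `run` and `Safe` leaves only arithmetic
about concrete values. -/
theorem straight (h : P.loopFree = true) (hT : P.time ≤ T) (hs : P.Safe B σ) (hQ : Q (P.run σ)) :
    Runs B P σ T Q := by
  obtain ⟨t, he, ht⟩ := run_of_loopFree P σ h hs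
  exact ⟨_, t, he, ht.trans hT, hQ⟩

/-- A loop whose guard decides a property of a measure that the body decreases. -/
theorem whileLoop {e : Expr} {Tb : ℕ} (Inv : ℕ → State → Prop)
    (he : ∀ m σ', Frame P σ σ' → Inv m σ' → e.Fits B σ')
    (hbody : ∀ m σ', Frame P σ σ' → Inv m σ' → e.eval σ' ≠ 0 →
      Runs B P σ' Tb (fun σ'' => ∃ m' < m, Inv m' σ''))
    (hQ : ∀ m σ', Frame P σ σ' → Inv m σ' → e.eval σ' = 0 → Q σ') (m : ℕ) (hinit : Inv m σ)
    (hT : m * (e.size + 1 + Tb) + (e.size + 1) ≤ T) : Runs B (.while e P) σ T Q := by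
  -- Strong induction, since one pass may lower the measure by more than one; each pass is charged
  -- to a single unit.
  have key : ∀ m σ', Frame P σ σ' → Inv m σ' →
      Runs B (.while e P) σ' (m * (e.size + 1 + Tb) + (e.size + 1)) Q := by
    intro m
    induction m using Nat.strong_induction_on with
    | _ m ih =>
      intro σ' hf hi
      by_cases h0 : e.eval σ' = 0
      · exact ⟨σ', _, .while_false (he m σ' hf hi) h0, by omega, hQ m σ' hf hi h0⟩
      · obtain ⟨σ'', t, hx, ht, m', hm, hi'⟩ := hbody m σ' hf hi h0
        obtain ⟨σ₃, t', hx', ht', hq⟩ := ih m' hm σ'' (hf.trans hx.frame) hi'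
        refine ⟨σ₃, _, .while_true (he m σ' hf hi) h0 hx hx', ?_, hq⟩
        have : (m' + 1) * (e.size + 1 + Tb) ≤ m * (e.size + 1 + Tb) := Nat.mul_le_mul_right _ hm
        rw [Nat.add_mul] at this
        omega
  exact (key m σ (Frame.refl _ _) hinit).mono hT fun _ _ h => h

/-- The increment follows the body, so the invariant is re-established for the state with the
advanced counter. The bound `hi` is re-evaluated in every round and must therefore keep its value.
The overhead 7 is 3 for the guard and its test (besides `hi`) plus 4 for the increment. -/
theorem forLoop {i : ℕ} {lo hi : Expr} {body : Program} {Tb : ℕ} (a b : ℕ)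
    (Inv : ℕ → State → Prop) (hw : body.writesReg i = false)
    (hlo : lo.Fits B σ ∧ lo.eval σ = a) (hab : a ≤ b) (hb : b < B)
    (hhi : ∀ σ', Frame (.forLoop i lo hi body) σ σ' → hi.Fits B σ' ∧ hi.eval σ' = b)
    (hinit : Inv a (σ.setReg i a))
    (hbody : ∀ j σ', Frame (.forLoop i lo hi body) σ σ' → a ≤ j → j < b → σ'.reg i = j → Inv j σ' →
      Runs B body σ' Tb (fun σ'' => Inv (j + 1) (σ''.setReg i (j + 1))))
    (hQ : ∀ σ', Frame (.forLoop i lo hi body) σ σ' → Inv b σ' → Q σ')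
    (hT : (b - a) * (hi.size + Tb + 7) + (lo.size + hi.size + 4) ≤ T) :
    Runs B (.forLoop i lo hi body) σ T Q := by
  set W : Program := .while (.bin .lt (.reg i) hi)
    (.seq body (.assign i (.bin .add (.reg i) (.lit 1)))) with hW
  have key : ∀ d j σ', j + d = b → a ≤ j → Frame (.forLoop i lo hi body) σ σ' → σ'.reg i = j →
      Inv j σ' → Runs B W σ' (d * (hi.size + Tb + 7) + (hi.size + 3)) Q := by
    intro d
    induction d with
    | zero =>
      intro j σ' hj ha hf hr hi'
      obtain ⟨h1, h2⟩ := hhi σ' hf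
      have hjb : j = b := by omega
      subst hjb
      have hz : Expr.eval σ' (.bin .lt (.reg i) hi) = 0 := by simp [Expr.eval, Op.eval, hr, h2]
      refine ⟨σ', _, .while_false ⟨?_, h1, ?_⟩ hz, ?_, hQ σ' hf hi'⟩
      · simpa [Expr.Fits, hr] using hb
      · change Expr.eval σ' (.bin .lt (.reg i) hi) < B
        rw [hz]; omega
      · simp only [Expr.size]; omega
    | succ d ih =>
      intro j σ' hj ha hf hr hi'
      obtain ⟨h1, h2⟩ := hhi σ' hf
      have hz : Expr.eval σ' (.bin .lt (.reg i) hi) = 1 := by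
        simp [Expr.eval, Op.eval, hr, h2]; omega
      obtain ⟨σ'', t, hx, ht, hI⟩ := hbody j σ' hf ha (by omega) hr hi'
      have hr' : σ''.reg i = j := (hx.frame.reg i hw).trans hr
      have hx2 : Exec B (.assign i (.bin .add (.reg i) (.lit 1))) σ'' (σ''.setReg i (j + 1)) 4 := by
        have := Exec.assign (B := B) (σ := σ'') (i := i) (e := .bin .add (.reg i) (.lit 1))
          (by simp only [Expr.Fits, Expr.eval, Op.eval, hr']; omega)
        simpa [Expr.eval, Op.eval, hr', Expr.size] using this
      have hseq := Exec.seq hx hx2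
      have hf' : Frame (.forLoop i lo hi body) σ (σ''.setReg i (j + 1)) := by
        refine hf.trans (hseq.frame.mono ?_ ?_) <;>
          simp +contextual [Program.forLoop, Program.writesReg, Program.writesArr]
      obtain ⟨σ₃, t', hx', ht', hq⟩ := ih (j + 1) _ (by omega) (by omega) hf'
        (by simp [State.setReg]) hI
      have hfit : Expr.Fits B σ' (.bin .lt (.reg i) hi) := by
        refine ⟨?_, h1, ?_⟩
        · simp only [Expr.Fits, hr]; omega
        · change Expr.eval σ' (.bin .lt (.reg i) hi) < B
          rw [hz]; omega
      refine ⟨σ₃, _, .while_true hfit (by rw [hz]; exact one_ne_zero) hseq hx', ?_, hq⟩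
      simp only [Expr.size]
      rw [Nat.add_mul]
      omega
  obtain ⟨hl1, hl2⟩ := hlo
  have hx0 : Exec B (.assign i lo) σ (σ.setReg i a) (lo.size + 1) := hl2 ▸ Exec.assign hl1
  have hf0 : Frame (.forLoop i lo hi body) σ (σ.setReg i a) := by
    refine hx0.frame.mono ?_ ?_ <;>
      simp +contextual [Program.forLoop, Program.writesReg, Program.writesArr]
  obtain ⟨σ', t, hx, ht, hq⟩ := key (b - a) a _ (by omega) le_rfl hf0 (by simp [State.setReg]) hinit
  exact ⟨σ', _, .seq hx0 hx, by omega, hq⟩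

end Runs

end WordRAM

namespace TreeSeparator

open Finset

/-! ### Rooted forests on the natural numbers -/

section Top

/-- The topmost vertex that is reached from `i` by following parents outside `R`. -/
def top (par : ℕ → ℕ) (R : Finset ℕ) (i : ℕ) : ℕ :=
  -- The test `par i < i` gives termination for arbitrary `par` and also stops the climb at the
  -- root.
  if par i < i ∧ par i ∉ R then top par R (par i) else i
termination_by i
decreasing_by rename_i h; exact h.1

variable {par : ℕ → ℕ} {R R' : Finset ℕ} {i : ℕ}

theorem top_of_pos (h : par i < i) (hR : par i ∉ R) : top par R i = top par R (par i) := by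
  rw [top, if_pos ⟨h, hR⟩]

theorem top_of_neg (h : ¬ (par i < i ∧ par i ∉ R)) : top par R i = i := by
  rw [top, if_neg h]

theorem top_le (i : ℕ) : top par R i ≤ i := by
  induction i using Nat.strong_induction_on with
  | _ i ih =>
    by_cases h : par i < i ∧ par i ∉ R
    · rw [top_of_pos h.1 h.2]; exact (ih _ h.1).trans h.1.le
    · rw [top_of_neg h]

/-- Removing more vertices refines the components: the climb outside `R'` is an initial segment of
the climb outside `R`. -/
theorem top_top_of_subset (hR : R ⊆ R') : top par R (top par R' i) = top par R i := by
  induction i using Nat.strong_induction_on with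
  | _ i ih =>
    by_cases h : par i < i ∧ par i ∉ R'
    · rw [top_of_pos h.1 h.2, top_of_pos h.1 (fun h' => h.2 (hR h')), ih _ h.1]
    · rw [top_of_neg h]

theorem top_empty (hpar : ∀ i, 0 < i → par i < i) (i : ℕ) : top par ∅ i = 0 := by
  induction i using Nat.strong_induction_on with
  | _ i ih =>
    rcases Nat.eq_zero_or_pos i with rfl | h
    · exact Nat.le_zero.1 (top_le 0)
    · rw [top_of_pos (hpar i h) (notMem_empty _), ih _ (hpar i h)]

/-- The weight of the component with topmost vertex `r` after the removal of `R`. -/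
def classWeight (n : ℕ) (par : ℕ → ℕ) (R : Finset ℕ) (w : ℕ → ℕ) (r : ℕ) : ℕ :=
  ∑ j ∈ range n with j ∉ R ∧ top par R j = r, w j

variable {n : ℕ} {w : ℕ → ℕ}

theorem classWeight_le_of_subset (hR : R ⊆ R') (r : ℕ) :
    classWeight n par R' w r ≤ classWeight n par R w (top par R r) := by
  refine sum_le_sum_of_subset fun j hj => ?_
  simp only [mem_filter] at hj ⊢
  refine ⟨hj.1, fun h => hj.2.1 (hR h), ?_⟩
  rw [← hj.2.2, top_top_of_subset hR]

end Top

/-! ### The dynamic program for separators of minimum cost -/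

/-- The position of the first minimum of `f 0, …, f k`. -/
def argMin (f : ℕ → ℕ) : ℕ → ℕ
  | 0 => 0
  | k + 1 => if f (k + 1) < f (argMin f k) then k + 1 else argMin f k

theorem argMin_le (f : ℕ → ℕ) (k : ℕ) : argMin f k ≤ k := by
  induction k with
  | zero => exact le_rfl
  | succ k ih => rw [argMin]; split_ifs <;> omega

theorem apply_argMin_le (f : ℕ → ℕ) (k : ℕ) {b : ℕ} (hb : b ≤ k) : f (argMin f k) ≤ f b := by
  induction k with
  | zero => rw [Nat.le_zero.1 hb, argMin]
  | succ k ih =>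
    rw [argMin]
    rcases Nat.lt_or_ge k b with h | h
    · obtain rfl : b = k + 1 := by omega
      split_ifs <;> omega
    · have := ih h
      split_ifs <;> omega

section Separator

variable (n : ℕ) (par a c : ℕ → ℕ) (K : ℕ)

/-- The value of merging the subtree of `i` into its parent, with budget `b` for the part of the
topmost component that lies below `i`. -/
def mergeValue (N : ℕ → ℕ → ℕ) (G : ℕ → ℕ) (i k b : ℕ) : ℕ :=
  N (par i) (k - b) + min (N i b) (G i)

/-- The tables of the dynamic program after `d` merging steps, the last vertices first: the first
component is the minimum cost if the weight of the topmost component is bounded by the second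
argument, the second component is the minimum cost if the vertex is removed. -/
def table : ℕ → (ℕ → ℕ → ℕ) × (ℕ → ℕ)
  -- A vertex too heavy for its budget pays for its own removal. This avoids infinite entries; the
  -- traceback removes such vertices too.
  | 0 => (fun p k => if k < a p then c p else 0, c)
  | d + 1 =>
    let N := (table d).1
    let G := (table d).2
    let i := n - 1 - d
    (Function.update N (par i) fun k =>
        mergeValue par N G i k (argMin (mergeValue par N G i k) k),
      Function.update G (par i) (G (par i) + min (N i K) (G i)))

/-- The budget that is passed to the subtree of `i` if its parent has budget `k`. -/
def choice (i k : ℕ) : ℕ :=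
  argMin (mergeValue par (table n par a c K (n - 1 - i)).1 (table n par a c K (n - 1 - i)).2 i k) k

/-- The final value of the first table at the vertex `i`. -/
def finalN (i k : ℕ) : ℕ := (table n par a c K (n - 1 - i)).1 i k

/-- The final value of the second table at the vertex `i`. -/
def finalG (i : ℕ) : ℕ := (table n par a c K (n - 1 - i)).2 i

/-! ### Optimality of the dynamic program -/

/-- The costs of the partial subtrees that are caused by a set `S`. -/
def simCost (S : Finset ℕ) : ℕ → ℕ → ℕ
  | 0 => fun p => if p ∈ S then c p else 0
  | d + 1 => Function.update (simCost S d) (par (n - 1 - d))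
      (simCost S d (par (n - 1 - d)) + simCost S d (n - 1 - d))

/-- The weights of the topmost components of the partial subtrees that are caused by a set `S`. -/
def simWeight (S : Finset ℕ) : ℕ → ℕ → ℕ
  | 0 => a
  | d + 1 => Function.update (simWeight S d) (par (n - 1 - d))
      (simWeight S d (par (n - 1 - d)) + if n - 1 - d ∈ S then 0 else simWeight S d (n - 1 - d))

variable {n par a c K} {S : Finset ℕ}

/-- A merge moves the cost of the last vertex to a surviving one. At `d = n - 1` everything has
reached the root. -/
theorem sum_simCost (hpar : ∀ i, 0 < i → par i < i) {d : ℕ} (hd : d < n) :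
    ∑ p ∈ range (n - d), simCost n par c S d p = ∑ p ∈ range n, if p ∈ S then c p else 0 := by
  induction d with
  | zero => rfl
  | succ d ih =>
    rw [← ih (by omega), show n - d = (n - (d + 1)) + 1 by omega, sum_range_succ, simCost,
      show n - 1 - d = n - (d + 1) by omega]
    have hm : par (n - (d + 1)) ∈ range (n - (d + 1)) := mem_range.2 (hpar _ (by omega))
    rw [sum_update_of_mem hm, sum_eq_add_sum_sdiff_singleton_of_mem hm]
    omega

theorem simCost_le (hpar : ∀ i, 0 < i → par i < i) {d : ℕ} (hd : d < n) {p : ℕ} (hp : p < n) :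
    simCost n par c S d p ≤ ∑ p ∈ range n, if p ∈ S then c p else 0 := by
  induction d generalizing p with
  | zero =>
    exact single_le_sum (f := fun p => if p ∈ S then c p else 0) (fun _ _ => Nat.zero_le _)
      (mem_range.2 hp)
  | succ d ih =>
    rw [simCost]
    rcases eq_or_ne p (par (n - 1 - d)) with rfl | h
    · rw [Function.update_self, ← sum_simCost (S := S) (c := c) hpar (d := d) (by omega)]
      have := hpar (n - 1 - d) (by omega)
      rw [← sum_pair (f := simCost n par c S d) this.ne]
      refine sum_le_sum_of_subset fun x hx => ?_
      simp only [mem_insert, mem_singleton] at hx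
      rw [mem_range]; omega
    · rw [Function.update_of_ne h]; exact ih (by omega) hp

/-- If the parent of the last vertex survives, both have the same top and the merge moves weight
within one class. If the parent lies in `S`, the last vertex is its own top, which is not `r` by the
bound on `r`; the weight collected at the parent is then filtered out. -/
theorem sum_simWeight (hpar : ∀ i, 0 < i → par i < i) {d r : ℕ} (hr : r < n - d) :
    ∑ p ∈ range (n - d) with p ∉ S ∧ top par S p = r, simWeight n par a S d p =
      classWeight n par S a r := by
  induction d with
  | zero => rfl
  | succ d ih =>
    have hi : n - 1 - d = n - (d + 1) := by omega
    have hlt := hpar (n - (d + 1)) (by omega)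
    rw [← ih (by omega), show n - d = (n - (d + 1)) + 1 by omega, simWeight, hi]
    generalize hj : n - (d + 1) = j at *
    rw [sum_filter, sum_filter, sum_range_succ]
    have hm : par j ∈ range j := mem_range.2 hlt
    rw [sum_eq_add_sum_sdiff_singleton_of_mem hm, sum_eq_add_sum_sdiff_singleton_of_mem hm, Function.update_self]
    have : ∀ x ∈ range j \ {par j}, (if x ∉ S ∧ top par S x = r then
        Function.update (simWeight n par a S d) (par j)
          (simWeight n par a S d (par j) + if j ∈ S then 0 else simWeight n par a S d j) x else 0) =
        if x ∉ S ∧ top par S x = r then simWeight n par a S d x else 0 := by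
      intro x hx
      simp only [mem_sdiff, mem_singleton] at hx
      rw [Function.update_of_ne hx.2]
    rw [sum_congr rfl this]
    by_cases hp : par j ∈ S
    · have : top par S j = j := top_of_neg (by simp [hp])
      have hne : j ≠ r := by omega
      simp [hp, this, hne]
    · rw [top_of_pos hlt hp]
      by_cases h1 : top par S (par j) = r <;> by_cases h2 : j ∈ S <;> simp [h1, h2, hp]
      omega

theorem simWeight_le_classWeight (hpar : ∀ i, 0 < i → par i < i) {i : ℕ} (hi : i < n) (hS : i ∉ S) :
    simWeight n par a S (n - 1 - i) i ≤ classWeight n par S a (top par S i) := by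
  have hle : top par S i ≤ i := top_le i
  rw [← sum_simWeight hpar (d := n - 1 - i) (by omega)]
  refine single_le_sum (f := simWeight n par a S (n - 1 - i)) (fun _ _ => Nat.zero_le _) ?_
  rw [mem_filter, mem_range]
  exact ⟨by omega, hS, rfl⟩

/-- Tops have smaller or equal indices, so once all vertices after `r` are merged only `r` itself
can still have top `r`. -/
theorem classWeight_le_simWeight (hpar : ∀ i, 0 < i → par i < i) {r : ℕ} (hr : r < n) :
    classWeight n par S a r ≤ if r ∈ S then 0 else simWeight n par a S (n - 1 - r) r := by
  rw [← sum_simWeight hpar (d := n - 1 - r) (by omega)]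
  have : (range (n - (n - 1 - r))).filter (fun p => p ∉ S ∧ top par S p = r) ⊆
      if r ∈ S then ∅ else {r} := by
    intro p hp
    simp only [mem_filter, mem_range] at hp
    have hle : top par S p ≤ p := top_le p
    obtain rfl : p = r := by omega
    simp [hp.2.1]
  refine (sum_le_sum_of_subset this).trans ?_
  split_ifs <;> simp

/-- A feasible set `S` describes one particular choice of budgets, and the tables minimize over all
choices. -/
theorem table_le_simCost (hS : ∀ i < n, i ∉ S → simWeight n par a S (n - 1 - i) i ≤ K) {d : ℕ}
    (hd : d < n) (p : ℕ) :
    (p ∉ S → ∀ k, simWeight n par a S d p ≤ k →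
      (table n par a c K d).1 p k ≤ simCost n par c S d p) ∧
    (p ∈ S → (table n par a c K d).2 p ≤ simCost n par c S d p) := by
  induction d generalizing p with
  | zero =>
    refine ⟨fun h k hk => ?_, fun h => ?_⟩
    · have : ¬ k < a p := by simpa [simWeight] using hk
      simp [table, this]
    · simp [table, simCost, h]
  | succ d ih =>
    obtain ⟨i, hi⟩ : ∃ i, i = n - 1 - d := ⟨_, rfl⟩
    have hdi : d = n - 1 - i := by omega
    have ih := fun p => ih (by omega) p
    simp only [table, simCost, simWeight, ← hi]
    rcases eq_or_ne p (par i) with rfl | h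
    · simp only [Function.update_self]
      refine ⟨fun hp k hk => ?_, fun hp => ?_⟩
      · by_cases hiS : i ∈ S
        · have h1 := (ih (par i)).1 hp k (by simpa [hiS] using hk)
          have h2 := (ih i).2 hiS
          -- A removed child needs no budget.
          refine (apply_argMin_le _ k (Nat.zero_le k)).trans ?_
          rw [mergeValue, Nat.sub_zero]
          omega
        · rw [if_neg hiS] at hk
          have h1 := (ih (par i)).1 hp (k - simWeight n par a S d i) (by omega)
          have h2 := (ih i).1 hiS _ le_rfl
          -- A child that stays receives exactly the weight it contributes.
          refine (apply_argMin_le _ k (b := simWeight n par a S d i) (by omega)).trans ?_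
          rw [mergeValue]
          omega
      · have h1 := (ih (par i)).2 hp
        by_cases hiS : i ∈ S
        · have h2 := (ih i).2 hiS
          omega
        · have h2 := (ih i).1 hiS K (by rw [hdi]; exact hS i (by omega) hiS)
          omega
    · simpa only [Function.update_of_ne h] using ih p

/-- Comparison with the removal of all vertices. No feasibility is required, because an initial
entry never exceeds `c p`. The resulting bound by the total cost is what excludes overflow. -/
theorem table_le_simCost_univ (hpar : ∀ i, 0 < i → par i < i) {d : ℕ} (hd : d < n) {p : ℕ} (hp : p < n) :
    (∀ k, (table n par a c K d).1 p k ≤ simCost n par c (range n) d p) ∧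
      (table n par a c K d).2 p ≤ simCost n par c (range n) d p := by
  induction d generalizing p with
  | zero =>
    simp only [table, simCost, mem_range.2 hp, if_true, le_refl, and_true]
    intro k; split_ifs <;> omega
  | succ d ih =>
    have hi : par (n - 1 - d) < n - 1 - d := hpar _ (by omega)
    simp only [table, simCost]
    rcases eq_or_ne p (par (n - 1 - d)) with rfl | h
    · have h1 := ih (by omega) hp
      have h2 := ih (by omega) (p := n - 1 - d) (by omega)
      simp only [Function.update_self, mergeValue]
      refine ⟨fun k => ?_, by omega⟩
      have := h1.1 (k - argMin (mergeValue par (table n par a c K d).1 (table n par a c K d).2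
        (n - 1 - d) k) k)
      omega
    · simpa only [Function.update_of_ne h] using ih (by omega) hp

theorem table_le_sum (hpar : ∀ i, 0 < i → par i < i) {d : ℕ} (hd : d < n) {p : ℕ} (hp : p < n) :
    (∀ k, (table n par a c K d).1 p k ≤ ∑ v ∈ range n, c v) ∧
      (table n par a c K d).2 p ≤ ∑ v ∈ range n, c v := by
  have h := table_le_simCost_univ (a := a) (c := c) (K := K) hpar hd hp
  have h' := simCost_le (S := range n) (c := c) hpar hd hp
  rw [sum_congr rfl fun v hv => if_pos hv] at h'
  exact ⟨fun k => (h.1 k).trans h', h.2.trans h'⟩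

/-- The vertices merged from then on are at most `i`, so only entries of vertices smaller than `i`
change. Hence the traceback can read final values from tables that were overwritten in place. -/
theorem table_stable (hpar : ∀ i, 0 < i → par i < i) {i d : ℕ} (hi : i < n) (hd : n - 1 - i ≤ d) (hdn : d < n) :
    (table n par a c K d).1 i = finalN n par a c K i ∧
      (table n par a c K d).2 i = finalG n par a c K i := by
  induction d, hd using Nat.le_induction with
  | base => exact ⟨rfl, rfl⟩
  | succ d hd ih =>
    have := hpar (n - 1 - d) (by omega)
    have hne : i ≠ par (n - 1 - d) := by omega
    simpa only [table, Function.update_of_ne hne] using ih (by omega)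

/-! ### Recovering the separator from the tables -/

variable (n par a c K)

/-- The budget of the vertex `i`, given the remaining budgets and the removed ones among the
vertices before `i`. -/
def budget (cur : ℕ → ℕ) (mark : Finset ℕ) (i : ℕ) : ℕ :=
  if i = 0 ∨ par i ∈ mark then K else choice n par a c K i (cur (par i))

/-- The remaining budgets and the removed vertices after the decisions for the first `i`
vertices. -/
def trace : ℕ → (ℕ → ℕ) × Finset ℕ
  | 0 => (fun _ => 0, ∅)
  | i + 1 =>
    let cur := (trace i).1
    let mark := (trace i).2
    let b := budget n par a c K cur mark i
    (Function.update (Function.update cur (par i) (cur (par i) - b)) i b,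
      if finalG n par a c K i ≤ finalN n par a c K i b then insert i mark else mark)

/-- The separator of minimum cost. -/
def separator : Finset ℕ :=
  {p ∈ range n | p ∈ (trace n par a c K n).2 ∨ (trace n par a c K n).1 p < a p}

variable {n par a c K}

theorem trace_mark_subset (i : ℕ) : (trace n par a c K i).2 ⊆ range i := by
  induction i with
  | zero => simp [trace]
  | succ i ih =>
    have : range i ⊆ range (i + 1) := range_subset_range.2 (Nat.le_succ i)
    simp only [trace]
    split
    · exact insert_subset (by simp) (ih.trans this)
    · exact ih.trans this

theorem trace_mark_mono {i j : ℕ} (h : i ≤ j) :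
    (trace n par a c K i).2 ⊆ (trace n par a c K j).2 := by
  induction j, h using Nat.le_induction with
  | base => exact Subset.rfl
  | succ j _ ih =>
    refine ih.trans ?_
    conv_rhs => rw [trace]
    simp only
    split
    · exact subset_insert _ _
    · exact Subset.rfl

theorem trace_cur_le (i p : ℕ) : (trace n par a c K i).1 p ≤ K := by
  induction i generalizing p with
  | zero => simp [trace]
  | succ i ih =>
    simp only [trace]
    rcases eq_or_ne p i with rfl | h
    · rw [Function.update_self, budget]
      split_ifs
      · exact le_rfl
      · exact (argMin_le _ _).trans (ih _)
    · rw [Function.update_of_ne h]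
      rcases eq_or_ne p (par i) with rfl | h
      · rw [Function.update_self]; exact (Nat.sub_le _ _).trans (ih _)
      · rw [Function.update_of_ne h]; exact ih _

/-- The traceback read backwards mirrors the merging: undoing decision `i` returns its budget to the
parent, while the merge adds the weight of the child there. The induction descends from `m = n`,
where the definition of `separator` bounds `a p` by the remaining budget. -/
theorem simWeight_le_trace (hpar : ∀ i, 0 < i → par i < i) {m : ℕ} (h1 : 0 < m) (hm : m ≤ n)
    {p : ℕ} (hp : p < m) (hS : p ∉ separator n par a c K) :
    simWeight n par a (separator n par a c K) (n - m) p ≤ (trace n par a c K m).1 p := by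
  induction hm using Nat.decreasingInduction generalizing p with
  | self =>
    simp only [separator, mem_filter, mem_range, hp, true_and, not_or] at hS
    rw [Nat.sub_self, simWeight]
    omega
  | of_succ i hi ih =>
    have hlt := hpar i h1
    have hni : n - i = (n - (i + 1)) + 1 := by omega
    have hii : n - 1 - (n - (i + 1)) = i := by omega
    have hi0 : i ≠ 0 := by omega
    rw [hni, simWeight, hii]
    rcases eq_or_ne p (par i) with rfl | h
    · rw [Function.update_self]
      -- The parent was never marked, so the child received a budget from `choice`, at most what was
      -- left; the truncated subtraction in `trace` is therefore exact.
      have hmark : par i ∉ (trace n par a c K i).2 := fun h' => hS (by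
        simp only [separator, mem_filter, mem_range]
        exact ⟨by omega, Or.inl (trace_mark_mono hi.le h')⟩)
      have h2 := ih (by omega) (p := par i) (by omega) hS
      have hb : budget n par a c K (trace n par a c K i).1 (trace n par a c K i).2 i ≤
          (trace n par a c K i).1 (par i) := by
        rw [budget, if_neg (by simp [hi0, hmark])]
        exact argMin_le _ _
      simp only [trace, Function.update_of_ne hlt.ne, Function.update_self] at h2
      split_ifs with hiS
      · omega
      · have h3 := ih (by omega) (p := i) (by omega) hiS
        simp only [trace, Function.update_self] at h3
        omega
    · rw [Function.update_of_ne h]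
      have h2 := ih (by omega) (p := p) (by omega) hS
      simpa only [trace, Function.update_of_ne hp.ne, Function.update_of_ne h] using h2

theorem classWeight_separator_le (hpar : ∀ i, 0 < i → par i < i) (r : ℕ) :
    classWeight n par (separator n par a c K) a r ≤ K := by
  rcases Nat.lt_or_ge r n with hr | hr
  · refine (classWeight_le_simWeight hpar hr).trans ?_
    split_ifs with h
    · exact Nat.zero_le _
    · rw [show n - 1 - r = n - (r + 1) by omega]
      exact (simWeight_le_trace hpar (by omega) hr (by omega) h).trans (trace_cur_le _ _)
  · rw [classWeight, sum_eq_zero_iff_of_nonneg (fun _ _ => Nat.zero_le _) |>.2]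
    · exact Nat.zero_le _
    intro j hj
    simp only [mem_filter, mem_range] at hj
    have : top par (separator n par a c K) j ≤ j := top_le j
    omega

/-- The cost that the tables promise for the vertices before `i`. -/
def promised (n : ℕ) (par a c : ℕ → ℕ) (K i p : ℕ) : ℕ :=
  if p ∈ (trace n par a c K i).2 then (table n par a c K (n - i)).2 p
  else (table n par a c K (n - i)).1 p ((trace n par a c K i).1 p)

theorem promised_last (i : ℕ) : promised n par a c K (i + 1) i =
    min (finalN n par a c K i (budget n par a c K (trace n par a c K i).1
      (trace n par a c K i).2 i)) (finalG n par a c K i) := by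
  have hi : i ∉ (trace n par a c K i).2 := fun h => by simpa using trace_mark_subset i h
  rw [promised, show n - (i + 1) = n - 1 - i by omega]
  change _ = min ((table n par a c K (n - 1 - i)).1 i _) ((table n par a c K (n - 1 - i)).2 i)
  by_cases h : finalG n par a c K i ≤ finalN n par a c K i (budget n par a c K
      (trace n par a c K i).1 (trace n par a c K i).2 i)
  · simp only [trace, Function.update_self, if_pos h, mem_insert_self, if_true]
    exact (min_eq_right h).symm
  · simp only [trace, Function.update_self, if_neg h, hi, if_false]
    exact (min_eq_left (not_le.1 h).le).symm

/-- Deciding about `i` unrolls the table entry of its parent at the minimizing budget, which splits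
into an entry of the parent one merge earlier and the entry of `i`. -/
theorem sum_promised_succ (hpar : ∀ i, 0 < i → par i < i) {i : ℕ} (h1 : 0 < i) (hi : i < n) :
    ∑ p ∈ range (i + 1), promised n par a c K (i + 1) p =
      ∑ p ∈ range i, promised n par a c K i p := by
  have hlt := hpar i h1
  have hni : n - i = (n - (i + 1)) + 1 := by omega
  have hii : n - 1 - (n - (i + 1)) = i := by omega
  have hm : par i ∈ range i := mem_range.2 hlt
  have hmem : ∀ p < i, (p ∈ (trace n par a c K (i + 1)).2 ↔ p ∈ (trace n par a c K i).2) := by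
    intro p hp
    simp only [trace]
    split
    · simp [hp.ne]
    · rfl
  rw [sum_range_succ, sum_eq_add_sum_sdiff_singleton_of_mem hm,
    sum_eq_add_sum_sdiff_singleton_of_mem hm]
  have hrest : ∀ p ∈ range i \ {par i},
      promised n par a c K (i + 1) p = promised n par a c K i p := by
    intro p hp
    simp only [mem_sdiff, mem_range, mem_singleton] at hp
    simp only [promised, hmem p hp.1]
    simp only [hni, table, hii, trace, Function.update_of_ne hp.1.ne, Function.update_of_ne hp.2]
  rw [sum_congr rfl hrest, promised_last]
  have hmain : promised n par a c K (i + 1) (par i) +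
      min (finalN n par a c K i (budget n par a c K (trace n par a c K i).1
        (trace n par a c K i).2 i)) (finalG n par a c K i) = promised n par a c K i (par i) := by
    simp only [promised, hmem _ hlt, budget]
    have hi0 : i ≠ 0 := h1.ne'
    simp only [hni, table, hii, trace, Function.update_of_ne hlt.ne, Function.update_self, hi0,
      false_or, finalN, finalG, budget]
    rw [show n - 1 - i = n - (i + 1) by omega]
    split_ifs with h2
    · rfl
    · simp only [choice, mergeValue, show n - 1 - i = n - (i + 1) by omega]
  rw [← hmain]
  ring

/-- The promised total is conserved from the entry of the root to the unmerged tables, where a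
vertex costs `c p` precisely if it is marked or exceeds its budget. -/
theorem sum_separator_eq (hpar : ∀ i, 0 < i → par i < i) (hn : 0 < n) :
    ∑ v ∈ separator n par a c K, c v = min (finalN n par a c K 0 K) (finalG n par a c K 0) := by
  have key : ∀ i, 0 < i → i ≤ n → ∑ p ∈ range i, promised n par a c K i p =
      min (finalN n par a c K 0 K) (finalG n par a c K 0) := by
    intro i h1 hi
    induction i, h1 using Nat.le_induction with
    | base => simp [promised_last, budget]
    | succ i h1 ih => rw [sum_promised_succ hpar h1 hi, ih (by omega)]
  rw [← key n hn le_rfl, separator, sum_filter]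
  refine sum_congr rfl fun p _ => ?_
  simp only [promised, Nat.sub_self, table]
  split_ifs <;> first | rfl | omega | simp_all

theorem sum_separator_le (hpar : ∀ i, 0 < i → par i < i) (hn : 0 < n)
    (hS : S ⊆ range n) (hK : ∀ r, classWeight n par S a r ≤ K) :
    ∑ v ∈ separator n par a c K, c v ≤ ∑ v ∈ S, c v := by
  have hw : ∀ i < n, i ∉ S → simWeight n par a S (n - 1 - i) i ≤ K := fun i hi h =>
    (simWeight_le_classWeight hpar hi h).trans (hK _)
  have hd : n - 1 < n := by omega
  have h1 := table_le_simCost (c := c) hw hd 0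
  have h2 := sum_simCost (S := S) (c := c) hpar hd
  have h3 : n - (n - 1) = 1 := by omega
  rw [h3, sum_range_one, ← sum_filter, filter_mem_eq_inter,
    inter_eq_right.2 hS] at h2
  rw [sum_separator_eq hpar hn, ← h2, finalN, finalG, Nat.sub_zero]
  by_cases h0 : 0 ∈ S
  · exact (min_le_right _ _).trans (h1.2 h0)
  · exact (min_le_left _ _).trans (h1.1 h0 K (hw 0 hn h0))

end Separator

/-! ### Rounding and the potential function -/

section Potential

variable {n : ℕ} {par w c h : ℕ → ℕ} {S : Finset ℕ} {K L M M' r : ℕ}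

/-- Weights in units of `M / (2 * K)`, rounded down. -/
def rounded (w : ℕ → ℕ) (K M v : ℕ) : ℕ := w v * (2 * K) / M

/-- Half of `M` equals `K` units, and rounding down only helps. -/
theorem classWeight_rounded_le (hM : 0 < M) (hr : 2 * classWeight n par S w r ≤ M) :
    classWeight n par S (rounded w K M) r ≤ K := by
  have h1 : classWeight n par S (rounded w K M) r * M ≤ classWeight n par S w r * (2 * K) := by
    simp only [classWeight, sum_mul]
    exact sum_le_sum fun v _ => Nat.div_mul_le_self _ _
  have h2 : classWeight n par S w r * (2 * K) ≤ K * M := by nlinarith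
  exact Nat.le_of_mul_le_mul_right (h1.trans h2) hM

/-- At most `n` vertices lose less than one unit each, so the true weight is at most n * L + n units
of M / (2 * n * L). -/
theorem le_of_classWeight_rounded_le (hn : 0 < n) (hM : 0 < M)
    (hr : classWeight n par S (rounded w (n * L) M) r ≤ n * L) :
    2 * L * classWeight n par S w r ≤ (L + 1) * M := by
  have h1 : classWeight n par S w r * (2 * (n * L)) ≤
      (classWeight n par S (rounded w (n * L) M) r + n) * M := by
    have hcard : #{j ∈ range n | j ∉ S ∧ top par S j = r} ≤ n :=
      (card_filter_le _ _).trans (card_range n).le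
    calc classWeight n par S w r * (2 * (n * L))
        ≤ ∑ j ∈ range n with j ∉ S ∧ top par S j = r, (rounded w (n * L) M j + 1) * M := by
          simp only [classWeight, sum_mul]
          refine sum_le_sum fun v _ => ?_
          have := Nat.lt_div_mul_add (a := w v * (2 * (n * L))) hM
          rw [rounded]
          nlinarith
      _ = (classWeight n par S (rounded w (n * L) M) r +
            #{j ∈ range n | j ∉ S ∧ top par S j = r}) * M := by
          rw [← sum_mul, sum_add_distrib, card_eq_sum_ones, classWeight]
      _ ≤ _ := by gcongr
  have h2 : n * (2 * L * classWeight n par S w r) ≤ n * ((L + 1) * M) := by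
    calc n * (2 * L * classWeight n par S w r) = classWeight n par S w r * (2 * (n * L)) := by ring
      _ ≤ (n * L + n) * M := h1.trans (by gcongr)
      _ = _ := by ring
  exact Nat.le_of_mul_le_mul_left h2 hn

/-- The values `h v` behave like the weights of the candidate sets in which `v` is queried: the
vertices with a large value form a separator. -/
def IsProfile (n : ℕ) (par w h : ℕ → ℕ) : Prop :=
  ∀ k r, 2 * classWeight n par {v ∈ range n | k < 2 * h v} w r ≤ k

theorem potential_step (hpar : ∀ i, 0 < i → par i < i) (hn : 0 < n) (hL : 0 < L) (hM : 0 < M)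
    (hh : IsProfile n par w h) (hM' : 2 * L * M' ≤ (L + 1) * M) :
    (L - 1) * (M * ∑ v ∈ separator n par (rounded w K M) c K, c v) +
        2 * L * ∑ v ∈ range n, c v * min (2 * h v) M' ≤
      2 * L * ∑ v ∈ range n, c v * min (2 * h v) M := by
  -- The vertices with a profile value above M / 2 form an admissible competitor for the
  -- minimization.
  have h1 := sum_separator_le (c := c) (S := {v ∈ range n | M < 2 * h v}) hpar hn
    (filter_subset _ _) fun r => classWeight_rounded_le (K := K) hM (hh M r)
  obtain ⟨l, rfl⟩ : ∃ l, L = l + 1 := ⟨L - 1, by omega⟩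
  simp only [Nat.add_sub_cancel]
  have hle : M' ≤ M := by nlinarith
  calc _ ≤ l * (M * ∑ v ∈ range n with M < 2 * h v, c v) +
        2 * (l + 1) * ∑ v ∈ range n, c v * min (2 * h v) M' := by gcongr
    _ = ∑ v ∈ range n, ((if M < 2 * h v then l * (M * c v) else 0) +
        2 * (l + 1) * (c v * min (2 * h v) M')) := by
      rw [sum_add_distrib, ← sum_filter, mul_sum, mul_sum, mul_sum]
    _ ≤ ∑ v ∈ range n, 2 * (l + 1) * (c v * min (2 * h v) M) := by
      refine sum_le_sum fun v _ => ?_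
      split_ifs with hv
      · rw [min_eq_right hv.le]
        have h3 : min (2 * h v) M' ≤ M' := min_le_right _ _
        have h2 : l * M + 2 * (l + 1) * min (2 * h v) M' ≤ 2 * (l + 1) * M := by nlinarith
        have := Nat.mul_le_mul_left (c v) h2
        nlinarith
      · rw [zero_add]
        gcongr
    _ = _ := by rw [mul_sum]

end Potential

/-! ### Elimination sequences -/

/-- `Elim n par ord w c R res A`: the vertices of `R` can be queried one after another in such a way
that the total weighted cost of these queries is `A`, and `res u` is one plus the index of the last
vertex that was queried while `u` belonged to the same candidate set (`0` if there is none). -/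
inductive Elim (n : ℕ) (par ord w c : ℕ → ℕ) : Finset ℕ → (ℕ → ℕ) → ℕ → Prop
  | init : Elim n par ord w c ∅ (fun _ => 0) 0
  | step {R : Finset ℕ} {res : ℕ → ℕ} {A v : ℕ} (h : Elim n par ord w c R res A) (hv : v < n)
      (hR : v ∉ R) : Elim n par ord w c (insert v R)
        (fun u => if u ∉ insert v R ∧ top par R u = top par R v then ord v + 1 else res u)
        (A + c v * classWeight n par R w (top par R v))

theorem Elim.subset {n : ℕ} {par ord w c : ℕ → ℕ} {R : Finset ℕ} {res : ℕ → ℕ} {A : ℕ}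
    (h : Elim n par ord w c R res A) : R ⊆ range n := by
  induction h with
  | init => simp
  | step _ hv _ ih => exact insert_subset (mem_range.2 hv) ih

/-- Each step writes one value on an entire component, and components only become finer. -/
theorem Elim.res_eq {n : ℕ} {par ord w c : ℕ → ℕ} {R : Finset ℕ} {res : ℕ → ℕ} {A : ℕ}
    (h : Elim n par ord w c R res A) {i j : ℕ} (hi : i ∉ R) (hj : j ∉ R)
    (hij : top par R i = top par R j) : res i = res j := by
  induction h with
  | init => rfl
  | @step R res A v _ hv hR ih =>
    have hij' : top par R i = top par R j := by
      rw [← top_top_of_subset (subset_insert v R), hij, top_top_of_subset (subset_insert v R)]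
    have := ih (fun h => hi (mem_insert_of_mem h)) (fun h => hj (mem_insert_of_mem h)) hij'
    simp only [hi, hj, hij', this]

/-- The climb from `i` could meet `v` only if both had the same top. -/
theorem top_insert {par : ℕ → ℕ} {R : Finset ℕ} {i v : ℕ} (h : top par R i ≠ top par R v) :
    top par (insert v R) i = top par R i := by
  induction i using Nat.strong_induction_on with
  | _ i ih =>
    by_cases hi : par i < i ∧ par i ∉ R
    · rw [top_of_pos hi.1 hi.2] at h ⊢
      have hv : par i ≠ v := fun h' => h (by rw [h'])
      rw [top_of_pos hi.1 (by simp [hv, hi.2]), ih _ hi.1 h]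
    · rw [top_of_neg hi, top_of_neg fun h' => hi ⟨h'.1, fun h'' => h'.2 (mem_insert_of_mem h'')⟩]

end TreeSeparator

namespace GraphSearch

open TreeSeparator

/-! ### Decision trees for rooted trees -/

namespace DecisionTree

variable {V : Type*} {G : SimpleGraph V} {S : Set V}

theorem queries_of_mem {v x : V} {hv : v ∈ S}
    {child : (H : (G.induce (S \ {v})).ConnectedComponent) → DecisionTree G (Subtype.val '' H.supp)}
    (h : x ∈ S \ {v}) : (node v hv child).queries x =
      v :: (child ((G.induce (S \ {v})).connectedComponentMk ⟨x, h⟩)).queries x := by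
  rw [queries, dif_pos h]

theorem queries_of_notMem {v x : V} {hv : v ∈ S}
    {child : (H : (G.induce (S \ {v})).ConnectedComponent) → DecisionTree G (Subtype.val '' H.supp)}
    (h : x ∉ S \ {v}) : (node v hv child).queries x = [v] := by
  rw [queries, dif_neg h]

/-- A decision tree queries some vertex of a connected set while no other vertex of this set has
been queried. -/
theorem exists_mem_queries (D : DecisionTree G S) (C : Set V) (hC : C ⊆ S) (hne : C.Nonempty)
    (hconn : ∀ x y : C, (G.induce C).Reachable x y) :
    ∃ v ∈ C, ∀ x ∈ C, v ∈ D.queries x := by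
  induction D with
  | @node S u hu child ih =>
    by_cases huC : u ∈ C
    · refine ⟨u, huC, fun x _ => ?_⟩
      rw [queries]
      exact List.mem_cons_self
    · have hsub : C ⊆ S \ {u} := fun x hx => ⟨hC hx, fun h => huC (h ▸ hx)⟩
      obtain ⟨x₀, hx₀⟩ := hne
      have hmk : ∀ x (hx : x ∈ C), (G.induce (S \ {u})).connectedComponentMk ⟨x, hsub hx⟩ =
          (G.induce (S \ {u})).connectedComponentMk ⟨x₀, hsub hx₀⟩ := fun x hx =>
        SimpleGraph.ConnectedComponent.eq.2
          ((hconn ⟨x, hx⟩ ⟨x₀, hx₀⟩).map (G.induceHomOfLE hsub).toHom)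
      obtain ⟨v, hv, h⟩ := ih ((G.induce (S \ {u})).connectedComponentMk ⟨x₀, hsub hx₀⟩)
        (fun x hx => ⟨⟨x, hsub hx⟩, hmk x hx, rfl⟩)
      refine ⟨v, hv, fun x hx => ?_⟩
      rw [queries_of_mem (hsub hx), hmk x hx]
      exact List.mem_cons_of_mem _ (h x hx)

end DecisionTree

section Rooted

variable {n : ℕ} {T : SimpleGraph (Fin n)} {par : ℕ → ℕ} {e : Fin n ≃ Fin n} {R : Finset ℕ}

/-- The vertices of the component with topmost vertex `r` after the removal of `R`; here `e` maps
positions to vertices. -/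
def classSet (par : ℕ → ℕ) (e : Fin n ≃ Fin n) (R : Finset ℕ) (r : ℕ) : Set (Fin n) :=
  {x | (e.symm x : ℕ) ∉ R ∧ top par R (e.symm x) = r}

/-- The tree `T` is described by the parent function `par` on positions. -/
structure IsRooted (T : SimpleGraph (Fin n)) (par : ℕ → ℕ) (e : Fin n ≃ Fin n) : Prop where
  lt : ∀ i, 0 < i → par i < i
  adj : ∀ i j : Fin n, T.Adj (e i) (e j) ↔
    (0 < (j : ℕ) ∧ par j = i) ∨ (0 < (i : ℕ) ∧ par i = j)

theorem IsRooted.adj' (hT : IsRooted T par e) (x y : Fin n) : T.Adj x y ↔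
    (0 < (e.symm y : ℕ) ∧ par (e.symm y) = e.symm x) ∨
      (0 < (e.symm x : ℕ) ∧ par (e.symm x) = e.symm y) := by
  rw [← hT.adj, e.apply_symm_apply, e.apply_symm_apply]

/-- Edges join vertices to their parents, and a surviving parent has the same top. Conversely, the
climb from a vertex to its top stays inside `A`, since `A` is a union of classes. -/
theorem IsRooted.reachable_iff (hT : IsRooted T par e) {A : Set (Fin n)}
    (h1 : ∀ x ∈ A, (e.symm x : ℕ) ∉ R)
    (h2 : ∀ x ∈ A, ∀ y, (e.symm y : ℕ) ∉ R → top par R (e.symm y) = top par R (e.symm x) → y ∈ A)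
    (x y : A) : (T.induce A).Reachable x y ↔
      top par R (e.symm x) = top par R (e.symm y) := by
  constructor
  · rintro ⟨p⟩
    induction p with
    | nil => rfl
    | @cons x z y h _ ih =>
      refine Eq.trans ?_ ih
      rcases (hT.adj' _ _).1 (SimpleGraph.induce_adj.1 h) with ⟨h0, h3⟩ | ⟨h0, h3⟩
      · rw [top_of_pos (i := e.symm z) (hT.lt _ h0) (by rw [h3]; exact h1 _ x.2), h3]
      · rw [top_of_pos (i := e.symm x) (hT.lt _ h0) (by rw [h3]; exact h1 _ z.2), h3]
  · have key : ∀ k : ℕ, ∀ x : A, (e.symm x : ℕ) = k →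
        ∃ z : A, (e.symm z : ℕ) = top par R k ∧ (T.induce A).Reachable x z := by
      intro k
      induction k using Nat.strong_induction_on with
      | _ k ih =>
        intro x hx
        by_cases hk : par k < k ∧ par k ∉ R
        · have hlt : par k < n := hk.1.trans (hx ▸ (e.symm x).2)
          have hmem : e ⟨par k, hlt⟩ ∈ A := by
            refine h2 x x.2 _ ?_ ?_
            · simpa using hk.2
            · rw [e.symm_apply_apply, hx, top_of_pos hk.1 hk.2]
          obtain ⟨z, hz, hr⟩ := ih (par k) hk.1 ⟨_, hmem⟩ (by simp)
          refine ⟨z, by rw [hz, top_of_pos hk.1 hk.2], .trans ?_ hr⟩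
          refine SimpleGraph.Adj.reachable (SimpleGraph.induce_adj.2 ((hT.adj' _ _).2 (Or.inr ?_)))
          rw [hx, e.symm_apply_apply]
          exact ⟨by omega, rfl⟩
        · exact ⟨x, by rw [hx, top_of_neg hk], .refl _⟩
    intro h
    obtain ⟨z, hz, hr⟩ := key _ x rfl
    obtain ⟨z', hz', hr'⟩ := key _ y rfl
    have : z = z' := by
      apply Subtype.ext
      apply e.symm.injective
      apply Fin.ext
      rw [hz, hz', h]
    exact hr.trans (this ▸ hr'.symm)

/-- Identifies the index sets of the children of a query with classes of the enlarged set of removed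
vertices, so that elimination steps can become nodes. -/
theorem IsRooted.image_supp (hT : IsRooted T par e) {v : Fin n} {S : Set (Fin n)}
    (hS : S = classSet par e R (top par R v)) (y : Fin n) (hy : y ∈ S \ {e v}) :
    Subtype.val '' ((T.induce (S \ {e v})).connectedComponentMk ⟨y, hy⟩).supp =
      classSet par e (insert (v : ℕ) R) (top par (insert (v : ℕ) R) (e.symm y)) := by
  have hins : ∀ x : Fin n, (e.symm x : ℕ) ∉ insert (v : ℕ) R ↔ x ≠ e v ∧ (e.symm x : ℕ) ∉ R := by
    intro x
    rw [Finset.mem_insert, not_or, ← Fin.ext_iff.not, Equiv.symm_apply_eq]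
  have h1 : ∀ x ∈ S \ {e v}, (e.symm x : ℕ) ∉ insert (v : ℕ) R := by
    rintro x ⟨hx, hne⟩
    rw [hS] at hx
    exact (hins x).2 ⟨hne, hx.1⟩
  have h2 : ∀ x ∈ S \ {e v}, ∀ y, (e.symm y : ℕ) ∉ insert (v : ℕ) R →
      top par (insert (v : ℕ) R) (e.symm y) = top par (insert (v : ℕ) R) (e.symm x) →
      y ∈ S \ {e v} := by
    rintro x ⟨hx, hne⟩ y hy hxy
    rw [hS] at hx ⊢
    refine ⟨⟨((hins y).1 hy).2, ?_⟩, ((hins y).1 hy).1⟩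
    rw [← hx.2, ← top_top_of_subset (Finset.subset_insert (v : ℕ) R), hxy,
      top_top_of_subset (Finset.subset_insert (v : ℕ) R)]
  ext x
  constructor
  · rintro ⟨z, hz, rfl⟩
    have := (hT.reachable_iff h1 h2 z ⟨y, hy⟩).1 (SimpleGraph.ConnectedComponent.eq.1 hz)
    exact ⟨h1 _ z.2, this⟩
  · rintro ⟨hx, hxy⟩
    have hxS := h2 y hy x hx hxy
    exact ⟨⟨x, hxS⟩, SimpleGraph.ConnectedComponent.eq.2 ((hT.reachable_iff h1 h2 _ _).2 hxy), rfl⟩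

variable {w c : ℕ → ℕ} {wV cV : Fin n → ℕ}

open scoped Classical in
theorem classWeight_eq_sum (hw : ∀ i : Fin n, w i = wV (e i)) (r : ℕ) :
    classWeight n par R w r = ∑ x, if x ∈ classSet par e R r then wV x else 0 := by
  rw [classWeight, Finset.sum_filter, Finset.sum_range]
  refine Fintype.sum_equiv e _ _ fun i => ?_
  simp [classSet, hw]

open scoped Classical in
/-- The weight of the candidate set in which a decision tree queries the vertex at position `i`. -/
noncomputable def candidateWeight (e : Fin n ≃ Fin n) (wV : Fin n → ℕ)
    (D : DecisionTree T Set.univ) (i : ℕ) : ℕ :=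
  if hi : i < n then ∑ x, if e ⟨i, hi⟩ ∈ D.queries x then wV x else 0 else 0

/-- Consider a vertex of the component that is queried while the component is still intact: its
candidate weight is at least that of the component, and it was not removed, so twice its candidate
weight is at most `k`. -/
theorem IsRooted.isProfile (hT : IsRooted T par e) (hw : ∀ i : Fin n, w i = wV (e i))
    (D : DecisionTree T Set.univ) : IsProfile n par w (candidateWeight e wV D) := by
  classical
  intro k r
  set S : Finset ℕ := {v ∈ Finset.range n | k < 2 * candidateWeight e wV D v} with hS
  rcases (classSet par e S r).eq_empty_or_nonempty with h0 | h0
  · rw [classWeight_eq_sum hw, h0]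
    simp
  · obtain ⟨v, hv, h⟩ := D.exists_mem_queries _ (Set.subset_univ _) h0 fun x y =>
      (hT.reachable_iff (R := S) (A := classSet par e S r) (fun x hx => hx.1)
        (fun x hx y hy hxy => ⟨hy, hxy.trans hx.2⟩) x y).2 (x.2.2.trans y.2.2.symm)
    have h1 : classWeight n par S w r ≤ candidateWeight e wV D (e.symm v) := by
      rw [classWeight_eq_sum hw, candidateWeight, dif_pos (e.symm v).2]
      refine Finset.sum_le_sum fun x _ => ?_
      split_ifs with h2 h3 h3
      · exact le_rfl
      · exact absurd (by simpa using h x h2) h3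
      · exact Nat.zero_le _
      · exact le_rfl
    have h2 : ¬ k < 2 * candidateWeight e wV D (e.symm v) := fun h' =>
      hv.1 (Finset.mem_filter.2 ⟨Finset.mem_range.2 (e.symm v).2, h'⟩)
    omega

/-- Exchange of summation: `v` is charged for the targets whose query sequence contains it. As only
one inequality is needed, it does not matter whether a vertex could occur twice in a sequence. -/
theorem sum_candidateWeight_le (hc : ∀ i : Fin n, c i = cV (e i)) (D : DecisionTree T Set.univ) :
    ∑ i ∈ Finset.range n, c i * candidateWeight e wV D i ≤ D.avgCost (fun v _ => cV v) wV := by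
  classical
  have hlist : ∀ l : List (Fin n), ∑ v, (if v ∈ l then cV v else 0) ≤ (l.map cV).sum := by
    intro l
    induction l with
    | nil => simp
    | cons a l ih =>
      rw [List.map_cons, List.sum_cons]
      refine le_trans ?_ (Nat.add_le_add_left ih _)
      rw [← Fintype.sum_ite_eq' a cV, ← Finset.sum_add_distrib]
      refine Finset.sum_le_sum fun v _ => ?_
      simp only [List.mem_cons]
      split_ifs <;> simp_all
  calc ∑ i ∈ Finset.range n, c i * candidateWeight e wV D i
      = ∑ v, ∑ x, cV v * (if v ∈ D.queries x then wV x else 0) := by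
        rw [Finset.sum_range]
        refine Fintype.sum_equiv e _ _ fun i => ?_
        rw [hc, candidateWeight, dif_pos i.2, Finset.mul_sum]
    _ = ∑ x, wV x * ∑ v, (if v ∈ D.queries x then cV v else 0) := by
        rw [Finset.sum_comm]
        refine Finset.sum_congr rfl fun x _ => ?_
        rw [Finset.mul_sum]
        refine Finset.sum_congr rfl fun v _ => ?_
        split_ifs <;> ring
    _ ≤ _ := Finset.sum_le_sum fun x _ => Nat.mul_le_mul_left _ (hlist _)

open scoped Classical in
/-- An elimination sequence can be completed to a decision tree for the whole graph if there are
decision trees for all remaining components. -/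
theorem IsRooted.exists_tree_of_elim (hT : IsRooted T par e) (hn : 0 < n) {ord : ℕ → ℕ}
    (hord : ∀ i : Fin n, ord i = e i) (hw : ∀ i : Fin n, w i = wV (e i))
    (hc : ∀ i : Fin n, c i = cV (e i)) {res : ℕ → ℕ} {A : ℕ} (hE : Elim n par ord w c R res A)
    (out : ℕ → ℕ) (hout : ∀ i : Fin n, (i : ℕ) ∈ R → out (e i) = res i) (κ : Fin n → ℕ)
    (htree : ∀ i : Fin n, (i : ℕ) ∉ R → ∃ D : DecisionTree T (classSet par e R (top par R i)),
      D.StoredAs out (res i) ∧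
        ∀ y ∈ classSet par e R (top par R i), D.cost (fun v _ => cV v) y = κ y) :
    ∃ D : DecisionTree T Set.univ, D.StoredAs out 0 ∧ D.avgCost (fun v _ => cV v) wV =
      A + ∑ x, if (e.symm x : ℕ) ∈ R then 0 else wV x * κ x := by
  -- The elimination is undone from its last query: the trees of the components created by `v` are
  -- joined below a node for `v`, giving a tree for the component before that query. The costs `κ`
  -- of the targets change, so they are generalized.
  induction hE generalizing κ with
  | init =>
    have h0 := htree ⟨0, hn⟩ (by simp)
    have huniv : classSet par e ∅ (top par ∅ ((⟨0, hn⟩ : Fin n) : ℕ)) = Set.univ := by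
      ext x
      simp [classSet, top_empty hT.lt]
    rw [huniv] at h0
    obtain ⟨D, h1, h2⟩ := h0
    refine ⟨D, h1, ?_⟩
    simp [DecisionTree.avgCost, h2]
  | @step R res A v hE hv hR ih =>
    set v' : Fin n := ⟨v, hv⟩ with hv'
    set S : Set (Fin n) := classSet par e R (top par R v) with hS
    have hvS : e v' ∈ S := by simp [hS, classSet, hv', hR]
    have hmem : ∀ x : Fin n, (e.symm x : ℕ) ∈ insert v R ↔ x = e v' ∨ (e.symm x : ℕ) ∈ R := by
      intro x
      rw [Finset.mem_insert, ← Equiv.symm_apply_eq, Fin.ext_iff]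
    dsimp only at hout htree
    refine (ih
      (fun i hi => by
        rw [hout i (Finset.mem_insert_of_mem hi), if_neg]
        exact fun h => h.1 (Finset.mem_insert_of_mem hi))
      -- Every target in the component of `v` pays `c v`; for the target `v` itself nothing follows.
      (fun x => (if x ∈ S then c v else 0) + if x = e v' then 0 else κ x) ?_).imp
        fun D hD => ⟨hD.1, hD.2.trans ?_⟩
    rotate_left
    · rw [Nat.add_assoc, classWeight_eq_sum hw, Finset.mul_sum, ← Finset.sum_add_distrib]
      congr 1
      refine Finset.sum_congr rfl fun x _ => ?_
      rw [← hS]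
      simp only [hmem]
      by_cases hx : (e.symm x : ℕ) ∈ R
      · have : x ∉ S := fun h => h.1 hx
        simp [hx, this]
      · by_cases hxv : x = e v'
        · simp [hxv, hv', hR, mul_comm]
        · by_cases hxS : x ∈ S <;> simp [hx, hxv, hxS]
          ring
    · intro i hi
      by_cases hiv : top par R i = top par R v
      · have hsub : ∀ y ∈ S \ {e v'}, (e.symm y : ℕ) ∉ insert v R := fun y hy => by
          rw [hmem]
          rintro (h | h)
          · exact hy.2 h
          · exact hy.1.1 h
        have hchild : ∀ H : (T.induce (S \ {e v'})).ConnectedComponent,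
            ∃ D : DecisionTree T (Subtype.val '' H.supp), D.StoredAs out ((e v' : ℕ) + 1) ∧
              ∀ y ∈ Subtype.val '' H.supp, D.cost (fun v _ => cV v) y = κ y := by
          intro H
          induction H using SimpleGraph.ConnectedComponent.ind with
          | _ y =>
            have hy := htree (e.symm y.1) (hsub y.1 y.2)
            rw [if_pos ⟨hsub y.1 y.2, y.2.1.2⟩, ← hT.image_supp (v := v') hS y.1 y.2] at hy
            have h3 := hord v'
            simp only [hv'] at h3
            rw [h3] at hy
            exact hy
        choose child hc1 hc2 using hchild
        rw [hiv]
        refine ⟨.node (e v') hvS child, ⟨?_, hc1⟩, fun y hy => ?_⟩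
        · rw [hE.res_eq hi hR hiv, hout v' (Finset.mem_insert_self _ _), if_neg]
          exact fun h => h.1 (Finset.mem_insert_self _ _)
        · have hcv : cV (e v') = c v := (hc v').symm
          rw [DecisionTree.cost, if_pos hy]
          by_cases hyv : y = e v'
          · rw [DecisionTree.queries_of_notMem (by simp [hyv]), if_pos hyv]
            simp [hcv]
          · have hy' : y ∈ S \ {e v'} := ⟨hy, hyv⟩
            rw [DecisionTree.queries_of_mem hy', if_neg hyv, List.map_cons, List.sum_cons, hcv]
            congr 1
            exact hc2 _ y ⟨⟨y, hy'⟩, rfl, rfl⟩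
      -- A component not containing `v` keeps its vertices, its top and its stored parent, so its
      -- tree is reused.
      · have hiv' : (i : ℕ) ≠ v := fun h => hiv (by rw [h])
        have hi' : (i : ℕ) ∉ insert v R := by simp [hiv', hi]
        have hclass : classSet par e (insert v R) (top par (insert v R) i) =
            classSet par e R (top par R i) := by
          ext x
          constructor
          · rintro ⟨h3, h4⟩
            refine ⟨fun h => h3 (Finset.mem_insert_of_mem h), ?_⟩
            rw [← top_top_of_subset (Finset.subset_insert v R), h4,
              top_top_of_subset (Finset.subset_insert v R)]
          · rintro ⟨h3, h4⟩
            refine ⟨fun h => ?_, ?_⟩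
            · rcases Finset.mem_insert.1 h with h | h
              · exact hiv (by rw [← h4, h])
              · exact h3 h
            · rw [top_insert (by rwa [h4]), top_insert hiv, h4]
        have h0 := htree i hi'
        rw [hclass, if_neg fun h => hiv h.2] at h0
        obtain ⟨D, h1, h2⟩ := h0
        refine ⟨D, h1, fun y hy => ?_⟩
        have hyS : y ∉ S := fun h => hiv (hy.2.symm.trans h.2)
        have hyv : y ≠ e v' := fun h => hyS (h ▸ hvS)
        rw [if_neg hyS, if_neg hyv, zero_add, h2 y hy]

end Rooted

end GraphSearch

namespace WordRAM

/-! ### Symbolic evaluation -/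

section Eval

variable {B : ℕ} {σ : State}

instance : Add Expr := ⟨Expr.bin .add⟩
instance : Sub Expr := ⟨Expr.bin .sub⟩
instance : Mul Expr := ⟨Expr.bin .mul⟩
instance : Div Expr := ⟨Expr.bin .div⟩

/-- The comparison `x < y`. -/
def Expr.less (x y : Expr) : Expr := .bin .lt x y

/-- The comparison `x = y`. -/
def Expr.equal (x y : Expr) : Expr := .bin .eq x y

/-- The minimum of two expressions. -/
def Expr.minimum (x y : Expr) : Expr := x - (x - y)

theorem Expr.Fits.eval_lt {x : Expr} (h : x.Fits B σ) : x.eval σ < B := by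
  cases x with
  | lit k => exact h
  | reg i => exact h
  | read a x => exact h.2
  | bin op x y => exact h.2.2

@[simp] theorem Expr.eval_lit (k : ℕ) : (Expr.lit k).eval σ = k := rfl
@[simp] theorem Expr.eval_reg (k : ℕ) : (Expr.reg k).eval σ = σ.reg k := rfl
@[simp] theorem Expr.eval_read (a : ℕ) (x : Expr) :
    (Expr.read a x).eval σ = σ.arr a (x.eval σ) := rfl
@[simp] theorem Expr.eval_add (x y : Expr) : (x + y).eval σ = x.eval σ + y.eval σ := rfl
@[simp] theorem Expr.eval_sub (x y : Expr) : (x - y).eval σ = x.eval σ - y.eval σ := rfl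
@[simp] theorem Expr.eval_mul (x y : Expr) : (x * y).eval σ = x.eval σ * y.eval σ := rfl
@[simp] theorem Expr.eval_div (x y : Expr) : (x / y).eval σ = x.eval σ / y.eval σ := rfl
@[simp] theorem Expr.eval_less (x y : Expr) :
    (Expr.less x y).eval σ = if x.eval σ < y.eval σ then 1 else 0 := rfl
@[simp] theorem Expr.eval_equal (x y : Expr) :
    (Expr.equal x y).eval σ = if x.eval σ = y.eval σ then 1 else 0 := rfl
@[simp] theorem Expr.eval_minimum (x y : Expr) :
    (Expr.minimum x y).eval σ = min (x.eval σ) (y.eval σ) := by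
  simp only [Expr.minimum, Expr.eval_sub]
  omega

@[simp] theorem Expr.fits_lit (k : ℕ) : (Expr.lit k).Fits B σ ↔ k < B := Iff.rfl
@[simp] theorem Expr.fits_reg (k : ℕ) : (Expr.reg k).Fits B σ ↔ σ.reg k < B := Iff.rfl
@[simp] theorem Expr.fits_read (a : ℕ) (x : Expr) :
    (Expr.read a x).Fits B σ ↔ x.Fits B σ ∧ σ.arr a (x.eval σ) < B := Iff.rfl
@[simp] theorem Expr.fits_add (x y : Expr) :
    (x + y).Fits B σ ↔ x.Fits B σ ∧ y.Fits B σ ∧ x.eval σ + y.eval σ < B := Iff.rfl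
@[simp] theorem Expr.fits_mul (x y : Expr) :
    (x * y).Fits B σ ↔ x.Fits B σ ∧ y.Fits B σ ∧ x.eval σ * y.eval σ < B := Iff.rfl
@[simp] theorem Expr.fits_sub (x y : Expr) : (x - y).Fits B σ ↔ x.Fits B σ ∧ y.Fits B σ :=
  ⟨fun h => ⟨h.1, h.2.1⟩, fun h => ⟨h.1, h.2, (Nat.sub_le _ _).trans_lt h.1.eval_lt⟩⟩
@[simp] theorem Expr.fits_div (x y : Expr) : (x / y).Fits B σ ↔ x.Fits B σ ∧ y.Fits B σ :=
  ⟨fun h => ⟨h.1, h.2.1⟩, fun h => ⟨h.1, h.2, (Nat.div_le_self _ _).trans_lt h.1.eval_lt⟩⟩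
@[simp] theorem Expr.fits_minimum (x y : Expr) :
    (Expr.minimum x y).Fits B σ ↔ x.Fits B σ ∧ y.Fits B σ := by
  simp only [Expr.minimum, Expr.fits_sub]
  tauto

@[simp] theorem Expr.size_add (x y : Expr) : (x + y).size = x.size + y.size + 1 := rfl
@[simp] theorem Expr.size_sub (x y : Expr) : (x - y).size = x.size + y.size + 1 := rfl
@[simp] theorem Expr.size_mul (x y : Expr) : (x * y).size = x.size + y.size + 1 := rfl
@[simp] theorem Expr.size_div (x y : Expr) : (x / y).size = x.size + y.size + 1 := rfl
@[simp] theorem Expr.size_less (x y : Expr) : (Expr.less x y).size = x.size + y.size + 1 := rfl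
@[simp] theorem Expr.size_equal (x y : Expr) : (Expr.equal x y).size = x.size + y.size + 1 := rfl

theorem Expr.fits_less (hB : 1 < B) (x y : Expr) :
    (Expr.less x y).Fits B σ ↔ x.Fits B σ ∧ y.Fits B σ := by
  refine ⟨fun h => ⟨h.1, h.2.1⟩, fun h => ⟨h.1, h.2, ?_⟩⟩
  simp only [Op.eval]
  split_ifs <;> omega

theorem Expr.fits_equal (hB : 1 < B) (x y : Expr) :
    (Expr.equal x y).Fits B σ ↔ x.Fits B σ ∧ y.Fits B σ := by
  refine ⟨fun h => ⟨h.1, h.2.1⟩, fun h => ⟨h.1, h.2, ?_⟩⟩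
  simp only [Op.eval]
  split_ifs <;> omega

@[simp] theorem State.reg_setReg (i v j : ℕ) :
    (σ.setReg i v).reg j = if j = i then v else σ.reg j := by
  simp [State.setReg, Function.update_apply]
@[simp] theorem State.arr_setReg (i v : ℕ) : (σ.setReg i v).arr = σ.arr := rfl
@[simp] theorem State.reg_setArr (a i v : ℕ) : (σ.setArr a i v).reg = σ.reg := rfl
@[simp] theorem State.arr_setArr (a i v b : ℕ) :
    (σ.setArr a i v).arr b = if b = a then Function.update (σ.arr a) i v else σ.arr b := by
  simp [State.setArr, Function.update_apply]

end Eval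

end WordRAM

namespace TreeSeparator

open WordRAM Finset

/-! ### Programs -/

/-- The persistent data: the rooted tree, costs and weights of the positions, and parameters. -/
structure Data (B n K : ℕ) (par ord c w : ℕ → ℕ) (σ : State) : Prop where
  n_pos : 0 < n
  lt : ∀ i, 0 < i → par i < i
  par_zero : par 0 = 0
  ord_lt : ∀ i < n, ord i < n
  ord_inj : ∀ i < n, ∀ j < n, ord i = ord j → i = j
  reg_n : σ.reg 0 = n
  reg_K : σ.reg 4 = K
  reg_K' : σ.reg 6 = K + 1
  arr_par : σ.arr 6 = par
  arr_ord : σ.arr 4 = ord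
  arr_c : ∀ i < n, σ.arr 1 (ord i) = c i
  arr_w : ∀ i < n, σ.arr 2 (ord i) = w i
  bound : n * (K + 2) + 2 * K + 10 < B
  bound_c : 4 * ∑ v ∈ range n, c v + 4 < B
  bound_w : ∑ v ∈ range n, w v + 4 < B
  bound_wK : ∀ i < n, w i * (2 * K) < B

/-- Does the program preserve the persistent data? -/
def keepsData (P : Program) : Bool :=
  !(P.writesReg 0 || P.writesReg 4 || P.writesReg 6 || P.writesArr 6 || P.writesArr 4 ||
    P.writesArr 1 || P.writesArr 2)

theorem update_prefix {f g : ℕ → ℕ} {j v : ℕ} (h : ∀ i < j, f i = g i) (hv : v = g j) :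
    ∀ i < j + 1, Function.update f j v i = g i := by
  intro i hi
  rcases Nat.lt_succ_iff_lt_or_eq.1 hi with h' | rfl
  · rw [Function.update_of_ne h'.ne, h i h']
  · rw [Function.update_self, hv]

section Data

variable {B n K : ℕ} {par ord c w : ℕ → ℕ} {σ σ' : State}

theorem Data.frame {P : Program} (h : Data B n K par ord c w σ) (hf : Frame P σ σ')
    (hP : keepsData P = true) : Data B n K par ord c w σ' := by
  simp only [keepsData, Bool.not_eq_true', Bool.or_eq_false_iff] at hP
  obtain ⟨⟨⟨⟨⟨⟨h0, h4⟩, h6⟩, h6'⟩, h4'⟩, h1⟩, h2⟩ := hP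
  exact { h with
    reg_n := (hf.reg _ h0).trans h.reg_n
    reg_K := (hf.reg _ h4).trans h.reg_K
    reg_K' := (hf.reg _ h6).trans h.reg_K'
    arr_par := (hf.arr _ h6').trans h.arr_par
    arr_ord := (hf.arr _ h4').trans h.arr_ord
    arr_c := fun i hi => by rw [hf.arr _ h1, h.arr_c i hi]
    arr_w := fun i hi => by rw [hf.arr _ h2, h.arr_w i hi] }

theorem Data.n_lt (h : Data B n K par ord c w σ) : n + K + 10 < B := by
  have := h.bound
  nlinarith [h.n_pos]

theorem Data.c_le (_ : Data B n K par ord c w σ) {i : ℕ} (hi : i < n) :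
    c i ≤ ∑ v ∈ range n, c v :=
  single_le_sum (f := c) (fun _ _ => Nat.zero_le _) (mem_range.2 hi)

theorem Data.w_le (_ : Data B n K par ord c w σ) {i : ℕ} (hi : i < n) :
    w i ≤ ∑ v ∈ range n, w v :=
  single_le_sum (f := w) (fun _ _ => Nat.zero_le _) (mem_range.2 hi)

theorem Data.par_lt (h : Data B n K par ord c w σ) {i : ℕ} (hi : i < n) : par i < n := by
  rcases Nat.eq_zero_or_pos i with rfl | h0
  · rw [h.par_zero]; exact hi
  · exact (h.lt i h0).trans hi

end Data

/-! ### Component weights and queries in memory -/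

/-- Compute the topmost vertices of all components. -/
def computeTop : Program :=
  .forLoop 20 (.lit 0) (.reg 0)
    (.ite (.less (.read 6 (.reg 20)) (.reg 20) * .equal (.read 7 (.read 6 (.reg 20))) (.lit 0))
      (.store 8 (.reg 20) (.read 8 (.read 6 (.reg 20))))
      (.store 8 (.reg 20) (.reg 20)))

/-- Compute the maximum weight of a component. -/
def computeMax : Program :=
  .seq computeTop <|
  .seq (.forLoop 20 (.lit 0) (.reg 0) (.store 9 (.reg 20) (.lit 0))) <|
  .seq (.assign 5 (.lit 0)) <|
  .forLoop 20 (.lit 0) (.reg 0)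
    (.ite (.read 7 (.reg 20)) .skip <|
      .seq (.store 9 (.read 8 (.reg 20))
        (.read 9 (.read 8 (.reg 20)) + .read 2 (.read 4 (.reg 20)))) <|
      .ite (.less (.reg 5) (.read 9 (.read 8 (.reg 20))))
        (.assign 5 (.read 9 (.read 8 (.reg 20)))) .skip)

/-- Query the vertex whose position is in register `10`. -/
def query : Program :=
  .seq computeTop <|
  .seq (.store 7 (.reg 10) (.lit 1)) <|
  .forLoop 20 (.lit 0) (.reg 0)
    (.ite (.equal (.read 7 (.reg 20)) (.lit 0) *
        .equal (.read 8 (.reg 20)) (.read 8 (.reg 10)))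
      (.store 3 (.read 4 (.reg 20)) (.read 4 (.reg 10) + .lit 1)) .skip)

/-- Query all marked vertices. -/
def queryMarked : Program :=
  .forLoop 10 (.lit 0) (.reg 0)
    (.ite (.read 15 (.reg 10) * .equal (.read 7 (.reg 10)) (.lit 0)) query .skip)

/-- The array of removed vertices. -/
def StoresSet (R : Finset ℕ) (σ : State) : Prop := ∀ i, σ.arr 7 i = if i ∈ R then 1 else 0

section Specs

variable {B n K M : ℕ} {par ord c w : ℕ → ℕ} {σ σ' : State} {R S : Finset ℕ}

theorem StoresSet.lt (hR : StoresSet R σ) (hB : 1 < B) (i : ℕ) : σ.arr 7 i < B := by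
  rw [hR]; split_ifs <;> omega

theorem StoresSet.congr (hR : StoresSet R σ) (h : σ'.arr 7 = σ.arr 7) : StoresSet R σ' :=
  fun i => by rw [h, hR]

theorem StoresSet.eq_zero (hR : StoresSet R σ) (i : ℕ) : σ.arr 7 i = 0 ↔ i ∉ R := by
  rw [hR]; split_ifs <;> simp_all

/-- Parents precede their children, so the entry of the parent is already correct in a single
increasing pass. -/
theorem computeTop_spec (hσ : Data B n K par ord c w σ) (hR : StoresSet R σ) :
    Runs B computeTop σ (40 * n + 40) (fun σ' => ∀ i < n, σ'.arr 8 i = top par R i) := by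
  have hB := hσ.n_lt
  refine Runs.forLoop (Tb := 20) 0 n (fun j σ' => ∀ i < j, σ'.arr 8 i = top par R i) rfl
    ⟨by simp; omega, rfl⟩ (Nat.zero_le n) (by omega) (fun σ' hf => ?_) (by simp) ?_ ?_ ?_
  · simp [(hσ.frame hf rfl).reg_n]; omega
  · intro j σ' hf _ hj hr hi
    have hσ' := hσ.frame hf rfl
    have hR' := hR.congr (hf.arr 7 rfl)
    have hp := hσ'.par_lt hj
    have hlt := hR'.lt (B := B) (by omega)
    refine Runs.ite (T₁ := 7) ?_ (fun hc => ?_) (fun hc => ?_) (by decide)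
    · simp only [Expr.fits_mul, Expr.fits_less (show 1 < B by omega), Expr.fits_read, Expr.fits_lit,
        Expr.fits_equal (show 1 < B by omega), Expr.fits_reg, hr, hσ'.arr_par, Expr.eval_read,
        Expr.eval_reg, hlt, Expr.eval_less, Expr.eval_equal]
      refine ⟨⟨⟨?_, ?_⟩, ?_⟩, ⟨⟨⟨?_, ?_⟩, trivial⟩, ?_⟩, ?_⟩ <;> (try split_ifs) <;> omega
    · simp [hr, hσ'.arr_par, hR'.eq_zero] at hc
      have : top par R (par j) ≤ par j := top_le _
      refine Runs.straight rfl (by decide) ?_ ?_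
      · simp [Program.Safe, hr, hσ'.arr_par, hi _ hc.2]
        omega
      · simpa [Program.run, hr, hσ'.arr_par] using
          update_prefix hi (by rw [hi _ hc.2, ← top_of_pos hc.2 hc.1])
    · have hc' : ¬ (par j < j ∧ par j ∉ R) := fun h => by
        simp [hr, hσ'.arr_par, hR'.eq_zero, h.1, h.2] at hc
      refine Runs.straight rfl (by decide) ?_ ?_
      · simp [Program.Safe, hr]
        omega
      · simpa [Program.run, hr] using update_prefix hi (top_of_neg hc').symm
  · exact fun σ' _ hi => hi
  · simp [Expr.size]; omega

theorem sum_filter_range_succ (p : ℕ → Prop) [DecidablePred p] (f : ℕ → ℕ) (j : ℕ) :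
    ∑ v ∈ range (j + 1) with p v, f v = (∑ v ∈ range j with p v, f v) + if p j then f j else 0 := by
  simp only [sum_filter, sum_range_succ]

/-- The two conclusions together say that register 5 is the maximum. It may be updated with partial
sums, because these only grow. -/
theorem computeMax_spec (hσ : Data B n K par ord c w σ) (hR : StoresSet R σ) :
    Runs B computeMax σ (110 * n + 110) (fun σ' => (∀ r, classWeight n par R w r ≤ σ'.reg 5) ∧
      ∃ r, σ'.reg 5 ≤ classWeight n par R w r) := by
  have hB := hσ.n_lt
  have hB1 : 1 < B := by omega
  refine Runs.seq (T₂ := 70 * n + 70) (computeTop_spec hσ hR) (fun σ₁ hf h8 => ?_) (by omega)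
  replace hσ := hσ.frame hf rfl
  replace hR := hR.congr (hf.arr 7 rfl)
  clear hf
  refine Runs.seq (T₁ := 20 * n + 10) (T₂ := 50 * n + 50) (Q' := fun σ' => ∀ i < n, σ'.arr 9 i = 0)
    ?_ (fun σ₂ hf h9 => ?_) (by omega)
  · refine Runs.forLoop (Tb := 4) 0 n (fun j σ' => ∀ i < j, σ'.arr 9 i = 0) rfl
      ⟨by simp; omega, rfl⟩ (Nat.zero_le n) (by omega) (fun σ' hf => ?_) (by simp) ?_ ?_ ?_
    · simp [(hσ.frame hf rfl).reg_n]; omega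
    · intro j σ' hf _ hj hr hi
      refine Runs.straight rfl (by decide) ?_ ?_
      · simp [Program.Safe, hr]; omega
      · simpa [Program.run, hr] using update_prefix (g := fun _ => 0) hi rfl
    · exact fun σ' _ hi => hi
    · simp [Expr.size]; omega
  replace hσ := hσ.frame hf rfl
  replace hR := hR.congr (hf.arr 7 rfl)
  replace h8 : ∀ i < n, σ₂.arr 8 i = top par R i := by rw [hf.arr 8 rfl]; exact h8
  clear hf
  refine Runs.seq (T₁ := 2) (T₂ := 50 * n + 40) (Q' := fun σ' => σ'.reg 5 = 0)
    (Runs.straight rfl (by decide) (by simp [Program.Safe]; omega) (by simp [Program.run]))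
    (fun σ₃ hf h5 => ?_) (by omega)
  replace hσ := hσ.frame hf rfl
  replace hR := hR.congr (hf.arr 7 rfl)
  replace h8 : ∀ i < n, σ₃.arr 8 i = top par R i := by rw [hf.arr 8 rfl]; exact h8
  replace h9 : ∀ i < n, σ₃.arr 9 i = 0 := by rw [hf.arr 9 rfl]; exact h9
  clear hf
  refine Runs.forLoop (Tb := 30) 0 n (fun j σ' =>
    (∀ r < n, σ'.arr 9 r = ∑ v ∈ range j with v ∉ R ∧ top par R v = r, w v) ∧
    (∀ r < n, σ'.arr 9 r ≤ σ'.reg 5) ∧ ∃ r < n, σ'.reg 5 ≤ σ'.arr 9 r) rfl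
    ⟨by simp; omega, rfl⟩ (Nat.zero_le n) (by omega) (fun σ' hf => ?_) ?_ ?_ ?_ ?_
  · simp [(hσ.frame hf rfl).reg_n]; omega
  · simp only [State.arr_setReg, State.reg_setReg, h5]
    refine ⟨fun r hr => by simp [h9 r hr], fun r hr => by simp [h9 r hr], 0, hσ.n_pos, by simp⟩
  · intro j σ' hf _ hj hr ⟨hi1, hi2, r0, hr0, hi3⟩
    have hσ' := hσ.frame hf rfl
    have hR' := hR.congr (hf.arr 7 rfl)
    replace h8 : ∀ i < n, σ'.arr 8 i = top par R i := by rw [hf.arr 8 rfl]; exact h8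
    have hlt := hR'.lt hB1
    have htop : top par R j < n := (top_le _).trans_lt hj
    have hord := hσ'.ord_lt j hj
    refine Runs.ite (T₁ := 27) ?_ (fun hc => ?_) (fun hc => ?_) (by decide)
    · simp [hr, hlt]; omega
    · have hj' : j ∈ R := by simpa [hr, hR'.eq_zero] using hc
      refine Runs.straight rfl (by decide) trivial ?_
      simpa [Program.run, sum_filter_range_succ, hj'] using ⟨hi1, hi2, r0, hr0, hi3⟩
    · have hj' : j ∉ R := by simpa [hr, hR'.eq_zero] using hc
      have hsum : σ'.arr 9 (top par R j) + w j =
          ∑ v ∈ range (j + 1) with v ∉ R ∧ top par R v = top par R j, w v := by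
        rw [hi1 _ htop, sum_filter_range_succ, if_pos ⟨hj', rfl⟩]
      have hle : σ'.arr 9 (top par R j) + w j ≤ ∑ v ∈ range n, w v := by
        rw [hsum]
        refine sum_le_sum_of_subset ((filter_subset _ _).trans ?_)
        exact range_subset_range.2 hj
      have hbw := hσ'.bound_w
      have h5lt : σ'.reg 5 ≤ ∑ v ∈ range n, w v := by
        refine hi3.trans ?_
        rw [hi1 _ hr0]
        refine sum_le_sum_of_subset ((filter_subset _ _).trans ?_)
        exact range_subset_range.2 hj.le
      have h9' : ∀ r < n, Function.update (σ'.arr 9) (top par R j)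
          (σ'.arr 9 (top par R j) + w j) r =
          ∑ v ∈ range (j + 1) with v ∉ R ∧ top par R v = r, w v := by
        intro r hrn
        rcases eq_or_ne r (top par R j) with rfl | hne
        · rw [Function.update_self, hsum]
        · rw [Function.update_of_ne hne, hi1 r hrn, sum_filter_range_succ,
            if_neg fun h => hne h.2.symm, add_zero]
      refine Runs.straight rfl (by decide) ?_ ?_
      · simp [Program.Safe, Program.run, hr, h8 j hj, hσ'.arr_ord, hσ'.arr_w j hj,
          Expr.fits_less hB1]
        refine ⟨?_, ?_, ?_⟩ <;> omega
      · simp only [Program.run, Expr.eval_read, Expr.eval_reg, Expr.eval_add, Expr.eval_less, hr,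
          h8 j hj, hσ'.arr_ord, hσ'.arr_w j hj, State.reg_setArr, State.arr_setArr]
        by_cases hm : σ'.reg 5 < σ'.arr 9 (top par R j) + w j
        · simp [h8 j hj, hm]
          refine ⟨h9', fun r hrn => ?_, top par R j, htop, by simp⟩
          have := hi2 r hrn
          rcases eq_or_ne r (top par R j) with rfl | hne
          · simp
          · rw [Function.update_of_ne hne]; omega
        · simp [h8 j hj, hm]
          refine ⟨h9', fun r hrn => ?_, r0, hr0, ?_⟩
          · have := hi2 r hrn
            rcases eq_or_ne r (top par R j) with rfl | hne
            · simp; omega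
            · rw [Function.update_of_ne hne]; omega
          · rcases eq_or_ne r0 (top par R j) with rfl | hne
            · simp; omega
            · rw [Function.update_of_ne hne]; omega
  · rintro σ' _ ⟨hi1, hi2, r0, hr0, hi3⟩
    refine ⟨fun r => ?_, r0, hi3.trans (hi1 r0 hr0).le⟩
    rcases Nat.lt_or_ge r n with hr | hr
    · exact (hi1 r hr).ge.trans (hi2 r hr)
    · rw [classWeight, filter_false_of_mem, sum_empty]
      · exact Nat.zero_le _
      · rintro j hj ⟨_, rfl⟩
        have : top par R j ≤ j := top_le _
        have := mem_range.1 hj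
        omega
  · simp [Expr.size]; omega

/-- The memory describes the result of an elimination sequence. -/
structure Eliminated (n : ℕ) (par ord w c : ℕ → ℕ) (R : Finset ℕ) (A : ℕ) (σ : State) : Prop where
  set : StoresSet R σ
  elim : ∃ res, Elim n par ord w c R res A ∧ ∀ u < n, σ.arr 3 (ord u) = res u

theorem Eliminated.congr {A : ℕ} (h : Eliminated n par ord w c R A σ) (h7 : σ'.arr 7 = σ.arr 7)
    (h3 : σ'.arr 3 = σ.arr 3) : Eliminated n par ord w c R A σ' :=
  ⟨h.set.congr h7, by rw [h3]; exact h.elim⟩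

theorem query_spec {A v : ℕ} (hσ : Data B n K par ord c w σ)
    (hE : Eliminated n par ord w c R A σ) (hv : v < n) (hvR : v ∉ R) (h10 : σ.reg 10 = v) :
    Runs B query σ (90 * n + 90) (Eliminated n par ord w c (insert v R)
      (A + c v * classWeight n par R w (top par R v))) := by
  have hB := hσ.n_lt
  have hB1 : 1 < B := by omega
  -- The tops are computed before `v` is marked as removed, as the candidate set of this query is a
  -- class of `R`, not of `insert v R`.
  refine Runs.seq (T₂ := 50 * n + 50) (computeTop_spec hσ hE.set) (fun σ₁ hf h8 => ?_) (by omega)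
  replace hσ := hσ.frame hf rfl
  replace hE := hE.congr (hf.arr 7 rfl) (hf.arr 3 rfl)
  replace h10 : σ₁.reg 10 = v := by rw [hf.reg 10 rfl]; exact h10
  clear hf
  obtain ⟨hR, res, hE, hres⟩ := hE
  refine Runs.seq (T₁ := 3) (T₂ := 50 * n + 40)
    (Q' := fun σ' => StoresSet (insert v R) σ') ?_ (fun σ₂ hf hR' => ?_) (by omega)
  · refine Runs.straight rfl (by decide) ?_ ?_
    · simp [Program.Safe, h10]; omega
    · intro i
      simp only [Program.run, Expr.eval_reg, h10, Expr.eval_lit, State.arr_setArr, if_true,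
        Function.update_apply, hR i, mem_insert]
      split_ifs <;> simp_all
  replace hσ := hσ.frame hf rfl
  replace h8 : ∀ i < n, σ₂.arr 8 i = top par R i := by rw [hf.arr 8 rfl]; exact h8
  replace h10 : σ₂.reg 10 = v := by rw [hf.reg 10 rfl]; exact h10
  replace hres : ∀ u < n, σ₂.arr 3 (ord u) = res u := by rw [hf.arr 3 rfl]; exact hres
  clear hf hR
  have hstep := hE.step hv hvR
  set res' : ℕ → ℕ := fun u =>
    if u ∉ insert v R ∧ top par R u = top par R v then ord v + 1 else res u with hres'
  refine Runs.forLoop (Tb := 30) 0 n (fun j σ' =>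
    ∀ u < n, σ'.arr 3 (ord u) = if u < j then res' u else res u) rfl
    ⟨by simp; omega, rfl⟩ (Nat.zero_le n) (by omega) (fun σ' hf => ?_) ?_ ?_ ?_ ?_
  · simp [(hσ.frame hf rfl).reg_n]; omega
  · simpa using hres
  · intro j σ' hf _ hj hr hi
    have hσ' := hσ.frame hf rfl
    replace hR' := hR'.congr (hf.arr 7 rfl)
    replace h8 : ∀ i < n, σ'.arr 8 i = top par R i := by rw [hf.arr 8 rfl]; exact h8
    replace h10 : σ'.reg 10 = v := by rw [hf.reg 10 rfl]; exact h10
    have hlt := hR'.lt hB1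
    have htop : top par R j < n := (top_le _).trans_lt hj
    have htop' : top par R v < n := (top_le _).trans_lt hv
    have hord := hσ'.ord_lt j hj
    have hord' := hσ'.ord_lt v hv
    have hcond : j ∉ insert v R ∧ top par R j = top par R v ↔ Expr.eval σ'
        (.equal (.read 7 (.reg 20)) (.lit 0) * .equal (.read 8 (.reg 20)) (.read 8 (.reg 10))) ≠ 0 := by
      simp [hr, h10, h8 j hj, h8 v hv, hR'.eq_zero]
      tauto
    refine Runs.ite (T₁ := 7) ?_ (fun hc => ?_) (fun hc => ?_) (by decide)
    · simp [hr, h10, h8 j hj, h8 v hv, hlt, Expr.fits_equal hB1]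
      refine ⟨⟨?_, ?_⟩, ⟨?_, ?_⟩, ?_⟩ <;> (try split_ifs) <;> omega
    · rw [← hcond] at hc
      refine Runs.straight rfl (by decide) ?_ ?_
      · simp [Program.Safe, hr, hσ'.arr_ord, h10]
        omega
      · intro u hu
        simp only [Program.run, Expr.eval_read, Expr.eval_reg, Expr.eval_add, Expr.eval_lit, hr,
          hσ'.arr_ord, h10, State.arr_setReg, State.arr_setArr, if_true]
        rcases eq_or_ne u j with rfl | hne
        · rw [Function.update_self, if_pos (Nat.lt_succ_self u), hres']
          exact (if_pos hc).symm
        · rw [Function.update_of_ne fun h => hne (hσ'.ord_inj u hu j hj h), hi u hu]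
          simp only [show u < j + 1 ↔ u < j by omega]
    · rw [not_iff_not.2 hcond |>.trans not_ne_iff |>.symm] at hc
      refine Runs.straight rfl (by decide) trivial fun u hu => ?_
      have := hi u hu
      simp only [Program.run, State.arr_setReg, this]
      rcases eq_or_ne u j with rfl | hne
      · rw [if_neg (lt_irrefl u), if_pos (Nat.lt_succ_self u), hres']
        exact (if_neg hc).symm
      · simp only [show u < j + 1 ↔ u < j by omega]
  · intro σ' hf hi
    exact ⟨hR'.congr (hf.arr 7 rfl), res', hstep, fun u hu => by rw [hi u hu, if_pos hu]⟩
  · simp [Expr.size]; omega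

/-- The array of marked vertices. -/
def StoresMarks (n : ℕ) (S : Finset ℕ) (σ : State) : Prop :=
  ∀ i < n, σ.arr 15 i = if i ∈ S then 1 else 0

/-- Components shrink while `S` is processed, so every query is charged at most `M` times its cost.
`S` may meet `R`; those vertices are skipped. -/
theorem queryMarked_spec {A : ℕ} (hσ : Data B n K par ord c w σ)
    (hE : Eliminated n par ord w c R A σ) (hS : StoresMarks n S σ) (hSn : S ⊆ range n)
    (hM : ∀ r, classWeight n par R w r ≤ M) :
    Runs B queryMarked σ (110 * n * (n + 1) + 30 * n + 10)
      (fun σ' => ∃ A' ≤ A + M * ∑ v ∈ S, c v, Eliminated n par ord w c (R ∪ S) A' σ') := by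
  have hB := hσ.n_lt
  have hB1 : 1 < B := by omega
  refine Runs.forLoop (Tb := 90 * n + 105) 0 n (fun j σ' =>
    ∃ A' ≤ A + M * ∑ v ∈ range j with v ∈ S, c v,
      Eliminated n par ord w c (R ∪ {v ∈ range j | v ∈ S}) A' σ') rfl
    ⟨by simp; omega, rfl⟩ (Nat.zero_le n) (by omega) (fun σ' hf => ?_) ?_ ?_ ?_ ?_
  · simp [(hσ.frame hf rfl).reg_n]; omega
  · exact ⟨A, by simp, by simpa using hE.congr (σ' := σ.setReg 10 0) rfl rfl⟩
  · rintro j σ' hf _ hj hr ⟨A', hA', hE'⟩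
    have hσ' := hσ.frame hf rfl
    have hlt := hE'.set.lt hB1
    have h15 : σ'.arr 15 j = if j ∈ S then 1 else 0 := by rw [hf.arr 15 rfl]; exact hS j hj
    have hcond : j ∈ S ∧ j ∉ R ∪ {v ∈ range j | v ∈ S} ↔ Expr.eval σ'
        (.read 15 (.reg 10) * .equal (.read 7 (.reg 10)) (.lit 0)) ≠ 0 := by
      simp only [Expr.eval_mul, Expr.eval_read, Expr.eval_reg, Expr.eval_equal, Expr.eval_lit, hr,
        h15, hE'.set.eq_zero]
      split_ifs <;> simp_all
    refine Runs.ite (T₁ := 90 * n + 90) ?_ (fun hc => ?_) (fun hc => ?_) (by simp [Expr.size]; omega)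
    · simp [hr, hlt, h15, Expr.fits_equal hB1]
      refine ⟨⟨?_, ?_⟩, ⟨?_, ?_⟩, ?_⟩ <;> (try split_ifs) <;> omega
    · rw [← hcond] at hc
      refine (query_spec hσ' hE' hj hc.2 hr).mono le_rfl fun σ'' _ hE'' => ?_
      refine ⟨_, ?_, by
        have : R ∪ {v ∈ range (j + 1) | v ∈ S} = insert j (R ∪ {v ∈ range j | v ∈ S}) := by
          rw [range_add_one, filter_insert, if_pos hc.1, union_insert]
        rw [this]
        exact hE''.congr rfl rfl⟩
      rw [sum_filter_range_succ, if_pos hc.1, Nat.mul_add, ← Nat.add_assoc]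
      refine Nat.add_le_add hA' ?_
      rw [mul_comm M]
      exact Nat.mul_le_mul_left _ ((classWeight_le_of_subset subset_union_left _).trans (hM _))
    · rw [not_iff_not.2 hcond |>.trans not_ne_iff |>.symm] at hc
      refine Runs.straight rfl (by simp [Program.time]) trivial ⟨A', ?_, ?_⟩
      · rw [sum_filter_range_succ, Nat.mul_add]
        omega
      · have : R ∪ {v ∈ range (j + 1) | v ∈ S} = R ∪ {v ∈ range j | v ∈ S} := by
          rw [range_add_one, filter_insert]
          split_ifs with hjS
          · rw [union_insert, insert_eq_of_mem]
            by_contra h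
            exact hc ⟨hjS, h⟩
          · rfl
        rw [this]
        exact hE'.congr rfl rfl
  · rintro σ' _ ⟨A', hA', hE'⟩
    have : {v ∈ range n | v ∈ S} = S := by rw [filter_mem_eq_inter, inter_eq_right.2 hSn]
    rw [this] at hA' hE'
    exact ⟨A', hA', hE'⟩
  · simp only [Expr.size, Nat.sub_zero]
    nlinarith

end Specs

/-! ### Filling the tables -/

/-- The address of an entry of a two-dimensional array. -/
def cell (p k : Expr) : Expr := p * .reg 6 + k

/-- Compute the rounded weights and the initial tables. -/
def initTables : Program :=
  .seq (.forLoop 11 (.lit 0) (.reg 0) <|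
    .seq (.store 10 (.reg 11) (.read 2 (.read 4 (.reg 11)) * (.lit 2 * .reg 4) / .reg 5))
      (.store 12 (.reg 11) (.read 1 (.read 4 (.reg 11))))) <|
  .forLoop 11 (.lit 0) (.reg 0 * .reg 6) <|
    .ite (.less (.reg 11 - .reg 11 / .reg 6 * .reg 6) (.read 10 (.reg 11 / .reg 6)))
      (.store 11 (.reg 11) (.read 12 (.reg 11 / .reg 6)))
      (.store 11 (.reg 11) (.lit 0))

/-- Find the best budget for the subtree of the vertex in register `14`, if its parent in register
`15` has the budget in register `16`. -/
def searchBest : Program :=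
  .seq (.assign 17 (.read 11 (cell (.reg 15) (.reg 16)) +
    .minimum (.read 11 (cell (.reg 14) (.lit 0))) (.read 12 (.reg 14)))) <|
  .seq (.assign 18 (.lit 0)) <|
  .forLoop 13 (.lit 1) (.reg 16 + .lit 1) <|
    .seq (.assign 19 (.read 11 (cell (.reg 15) (.reg 16 - .reg 13)) +
      .minimum (.read 11 (cell (.reg 14) (.reg 13))) (.read 12 (.reg 14)))) <|
    .ite (.less (.reg 19) (.reg 17)) (.seq (.assign 17 (.reg 19)) (.assign 18 (.reg 13))) .skip

/-- Merge the vertex in register `14` into its parent. -/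
def mergeVertex : Program :=
  .seq (.assign 15 (.read 6 (.reg 14))) <|
  .seq (.forLoop 12 (.lit 0) (.reg 6) <|
    .seq (.assign 16 (.reg 4 - .reg 12)) <|
    .seq searchBest <|
    .seq (.store 11 (cell (.reg 15) (.reg 16)) (.reg 17)) <|
    .store 13 (cell (.reg 14) (.reg 16)) (.reg 18)) <|
  .store 12 (.reg 15) (.read 12 (.reg 15) +
    .minimum (.read 11 (cell (.reg 14) (.reg 4))) (.read 12 (.reg 14)))

/-- Merge all vertices into their parents. -/
def mergeAll : Program :=
  .forLoop 11 (.lit 1) (.reg 0) <| .seq (.assign 14 (.reg 0 - .reg 11)) mergeVertex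

section Specs

variable {B n K M : ℕ} {par ord c w a : ℕ → ℕ} {σ σ' : State}

/-- The memory contains the tables of the dynamic program after `d` merging steps. -/
structure StoresTable (n : ℕ) (par a c : ℕ → ℕ) (K d : ℕ) (σ : State) : Prop where
  fst : ∀ p < n, ∀ k ≤ K, σ.arr 11 (p * (K + 1) + k) = (table n par a c K d).1 p k
  snd : ∀ p < n, σ.arr 12 p = (table n par a c K d).2 p

theorem StoresTable.congr {d : ℕ} (h : StoresTable n par a c K d σ) (h11 : σ'.arr 11 = σ.arr 11)
    (h12 : σ'.arr 12 = σ.arr 12) : StoresTable n par a c K d σ' :=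
  ⟨fun p hp k hk => by rw [h11, h.fst p hp k hk], fun p hp => by rw [h12, h.snd p hp]⟩

theorem cell_inj {p q k l : ℕ} (hk : k ≤ K) (hl : l ≤ K)
    (h : p * (K + 1) + k = q * (K + 1) + l) : p = q ∧ k = l := by
  have h1 : (p * (K + 1) + k) / (K + 1) = p := by
    rw [Nat.mul_comm, Nat.mul_add_div (Nat.succ_pos K), Nat.div_eq_of_lt (by omega), add_zero]
  have h2 : (q * (K + 1) + l) / (K + 1) = q := by
    rw [Nat.mul_comm, Nat.mul_add_div (Nat.succ_pos K), Nat.div_eq_of_lt (by omega), add_zero]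
  have : p = q := by rw [← h1, h, h2]
  subst this
  exact ⟨rfl, by omega⟩

theorem Data.cell_lt (hσ : Data B n K par ord c w σ) {p k : ℕ} (hp : p < n) (hk : k ≤ K) :
    p * (K + 1) < B ∧ p * (K + 1) + k < B := by
  have := hσ.bound
  have : (p + 1) * (K + 1) ≤ n * (K + 1) := Nat.mul_le_mul_right _ hp
  have : n * (K + 2) = n * (K + 1) + n := by ring
  have : (p + 1) * (K + 1) = p * (K + 1) + (K + 1) := by ring
  omega

theorem initTables_spec (hσ : Data B n K par ord c w σ) (hM : σ.reg 5 = M) (hMB : M < B) :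
    Runs B initTables σ (100 * n * (K + 1) + 20) (fun σ' =>
      (∀ i < n, σ'.arr 10 i = rounded w K M i) ∧
      StoresTable n par (rounded w K M) c K 0 σ') := by
  have hB := hσ.n_lt
  have hB1 : 1 < B := by omega
  have hnK : n * (K + 1) < B := by have := hσ.bound; nlinarith
  refine Runs.seq (T₁ := 40 * n + 10) (T₂ := 50 * (n * (K + 1)) + 10) (Q' := fun σ' =>
      (∀ i < n, σ'.arr 10 i = rounded w K M i) ∧ ∀ i < n, σ'.arr 12 i = c i) ?_ ?_ (by nlinarith)
  · refine Runs.forLoop (Tb := 25) 0 n (fun j σ' =>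
        (∀ i < j, σ'.arr 10 i = rounded w K M i) ∧ ∀ i < j, σ'.arr 12 i = c i) rfl
      ⟨by simp; omega, rfl⟩ (Nat.zero_le n) (by omega) (fun σ' hf => ?_) (by simp) ?_ ?_ ?_
    · simp [(hσ.frame hf rfl).reg_n]; omega
    · intro j σ' hf _ hj hr ⟨hi1, hi2⟩
      have hσ' := hσ.frame hf rfl
      have h5 : σ'.reg 5 = M := by rw [hf.reg 5 rfl]; exact hM
      have hord := hσ'.ord_lt j hj
      have hbw := hσ'.bound_wK j hj
      have hbc := hσ'.bound_c
      have hcj := hσ'.c_le hj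
      have hwj := hσ'.w_le hj
      have hbw' := hσ'.bound_w
      have hbK := hσ'.bound
      refine Runs.straight rfl (by decide) ?_ ?_
      · simp [Program.Safe, Program.run, hr, hσ'.arr_ord, hσ'.arr_w j hj, hσ'.arr_c j hj,
          hσ'.reg_K, h5]
        omega
      · simp only [Program.run, Expr.eval_read, Expr.eval_reg, Expr.eval_mul, Expr.eval_div,
          Expr.eval_lit, hr, hσ'.arr_ord, hσ'.arr_w j hj, hσ'.reg_K, h5, State.arr_setReg,
          State.arr_setArr, State.reg_setArr]
        simp only [show (10 : ℕ) ≠ 12 by decide, show (12 : ℕ) ≠ 10 by decide,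
          show (1 : ℕ) ≠ 10 by decide, show (4 : ℕ) ≠ 10 by decide, if_true, if_false,
          hσ'.arr_c j hj]
        exact ⟨update_prefix hi1 rfl, update_prefix hi2 rfl⟩
    · exact fun σ' _ hi => hi
    · simp [Expr.size]; omega
  intro σ₁ hf ⟨h10, h12⟩
  replace hσ := hσ.frame hf rfl
  clear hf
  -- One loop runs over the flattened table; quotient and remainder modulo K + 1 recover vertex and
  -- budget.
  refine Runs.forLoop (Tb := 28) 0 (n * (K + 1)) (fun j σ' => ∀ x < j, σ'.arr 11 x =
      if x % (K + 1) < rounded w K M (x / (K + 1)) then c (x / (K + 1)) else 0) rfl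
    ⟨by simp; omega, rfl⟩ (Nat.zero_le _) hnK (fun σ' hf => ?_) (by simp) ?_ ?_ ?_
  · simp [(hσ.frame hf rfl).reg_n, (hσ.frame hf rfl).reg_K']; omega
  · intro x σ' hf _ hx hr hi
    have hσ' := hσ.frame hf rfl
    have hj : x / (K + 1) < n := (Nat.div_lt_iff_lt_mul (Nat.succ_pos K)).2 hx
    have h10' : σ'.arr 10 (x / (K + 1)) = rounded w K M (x / (K + 1)) := by
      rw [hf.arr 10 rfl, h10 _ hj]
    have h12' : σ'.arr 12 (x / (K + 1)) = c (x / (K + 1)) := by rw [hf.arr 12 rfl, h12 _ hj]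
    have hmod : x - x / (K + 1) * (K + 1) = x % (K + 1) := by
      have := Nat.div_add_mod' x (K + 1); omega
    have hle := Nat.div_mul_le_self x (K + 1)
    have hbc := hσ'.bound_c
    have hcj := hσ'.c_le hj
    have hround : rounded w K M (x / (K + 1)) < B :=
      (Nat.div_le_self _ _).trans_lt (hσ'.bound_wK _ hj)
    refine Runs.straight rfl (by decide) ?_ ?_
    · simp [Program.Safe, hr, hσ'.reg_K', h10', h12', hmod, Expr.fits_less hB1]
      omega
    · simp only [Program.run, Expr.eval_read, Expr.eval_reg, Expr.eval_less, Expr.eval_sub,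
        Expr.eval_mul, Expr.eval_div, Expr.eval_lit, hr, hσ'.reg_K', h10', h12', hmod]
      by_cases h : x % (K + 1) < rounded w K M (x / (K + 1))
      · simpa [h] using update_prefix hi (by simp [h])
      · simpa [h] using update_prefix hi (by simp [h])
  · intro σ' hf hi
    refine ⟨fun i hin => by rw [hf.arr 10 rfl, h10 i hin], ⟨fun p hp k hk => ?_, fun p hp => ?_⟩⟩
    · have hlt : p * (K + 1) + k < n * (K + 1) := by
        have : (p + 1) * (K + 1) ≤ n * (K + 1) := Nat.mul_le_mul_right _ hp
        nlinarith
      rw [hi _ hlt, Nat.mul_comm p, Nat.mul_add_mod, Nat.mod_eq_of_lt (by omega),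
        Nat.mul_add_div (Nat.succ_pos K), Nat.div_eq_of_lt (by omega), add_zero]
      rfl
    · rw [hf.arr 12 rfl, h12 p hp]
      rfl
  · simp only [Expr.size]
    omega

/-- The values are described by an arbitrary `f`, since the caller's table is partly overwritten and
agrees with `mergeValue` only on the entries read here. -/
theorem searchBest_spec (hσ : Data B n K par ord c w σ) {i p k : ℕ} (hi : i < n) (hp : p < n)
    (hk : k ≤ K) (h14 : σ.reg 14 = i) (h15 : σ.reg 15 = p) (h16 : σ.reg 16 = k)
    (h11 : ∀ p < n, ∀ k ≤ K, σ.arr 11 (p * (K + 1) + k) ≤ ∑ v ∈ range n, c v)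
    (h12 : σ.arr 12 i ≤ ∑ v ∈ range n, c v) (f : ℕ → ℕ)
    (hf : ∀ b ≤ k, f b = σ.arr 11 (p * (K + 1) + (k - b)) +
      min (σ.arr 11 (i * (K + 1) + b)) (σ.arr 12 i)) :
    Runs B searchBest σ (80 * (K + 1)) (fun σ' => σ'.reg 18 = argMin f k ∧
      σ'.reg 17 = f (argMin f k)) := by
  have hB := hσ.n_lt
  have hB1 : 1 < B := by omega
  have hbc := hσ.bound_c
  have hi0 := hσ.cell_lt hi (Nat.zero_le K)
  have hpk := hσ.cell_lt hp hk
  have hv1 := h11 p hp k hk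
  have hv2 := h11 i hi 0 (Nat.zero_le K)
  refine Runs.seq (T₁ := 25) (T₂ := 50 * K + 40) (Q' := fun σ' => σ'.reg 17 = f 0) ?_ ?_ (by omega)
  · refine Runs.straight rfl (by decide) ?_ ?_
    · simp only [add_zero] at hv2
      simp [Program.Safe, cell, h14, h15, h16, hσ.reg_K']
      omega
    · simp [Program.run, cell, h14, h15, h16, hσ.reg_K', hf]
  intro σ₁ hfr h17
  refine Runs.seq (T₁ := 2) (T₂ := 50 * K + 30) (Q' := fun σ' => σ'.reg 18 = argMin f 0)
    (Runs.straight rfl (by decide) (by simp [Program.Safe]; omega) (by simp [Program.run, argMin]))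
    ?_ (by omega)
  intro σ₂ hfr' h18
  replace h17 : σ₂.reg 17 = f 0 := by rw [hfr'.reg 17 rfl]; exact h17
  have hfr2 : Frame searchBest σ σ₂ := by
    refine (hfr.mono ?_ ?_).trans (hfr'.mono ?_ ?_) <;>
      simp +contextual [searchBest, Program.writesReg, Program.writesArr]
  clear hfr hfr'
  -- Budget 0 was evaluated before the loop, so at counter `b` the best among 0, …, b - 1 is known.
  refine Runs.forLoop (Tb := 36) 1 (k + 1) (fun b σ' => σ'.reg 18 = argMin f (b - 1) ∧
      σ'.reg 17 = f (argMin f (b - 1))) rfl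
    ⟨by simp; omega, rfl⟩ (by omega) (by omega) (fun σ' hf' => ?_) ?_ ?_ ?_ ?_
  · have : σ'.reg 16 = k := by rw [hf'.reg 16 rfl, hfr2.reg 16 rfl, h16]
    simp [this]; omega
  · simpa [h18, h17] using by rw [argMin]
  · intro b σ' hf' hb1 hbk hr ⟨h18', h17'⟩
    have hσ' := (hσ.frame hfr2 rfl).frame hf' rfl
    have g14 : σ'.reg 14 = i := by rw [hf'.reg 14 rfl, hfr2.reg 14 rfl, h14]
    have g15 : σ'.reg 15 = p := by rw [hf'.reg 15 rfl, hfr2.reg 15 rfl, h15]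
    have g16 : σ'.reg 16 = k := by rw [hf'.reg 16 rfl, hfr2.reg 16 rfl, h16]
    have g11 : σ'.arr 11 = σ.arr 11 := by rw [hf'.arr 11 rfl, hfr2.arr 11 rfl]
    have g12 : σ'.arr 12 = σ.arr 12 := by rw [hf'.arr 12 rfl, hfr2.arr 12 rfl]
    have hib := hσ.cell_lt hi (k := b) (by omega)
    have hpb := hσ.cell_lt hp (k := k - b) (by omega)
    have hv1 := h11 p hp (k - b) (by omega)
    have hv2 := h11 i hi b (by omega)
    have hfb := hf b (by omega)
    have hf0 := hf (argMin f (b - 1)) ((argMin_le _ _).trans (by omega))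
    have hv3 := h11 p hp (k - argMin f (b - 1)) (by omega)
    have hv4 := min_le_right (σ.arr 11 (i * (K + 1) + argMin f (b - 1))) (σ.arr 12 i)
    have hval : Expr.eval σ' (.read 11 (cell (.reg 15) (.reg 16 - .reg 13)) +
        .minimum (.read 11 (cell (.reg 14) (.reg 13))) (.read 12 (.reg 14))) = f b := by
      simp [cell, g14, g15, g16, g11, g12, hr, hσ'.reg_K', hfb]
    have hsucc : argMin f b = if f b < f (argMin f (b - 1)) then b else argMin f (b - 1) := by
      obtain ⟨b', rfl⟩ : ∃ b', b = b' + 1 := ⟨b - 1, by omega⟩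
      rw [argMin, Nat.add_sub_cancel]
    refine Runs.straight rfl (by decide) ?_ ?_
    · simp only [Program.Safe, Program.run, hval]
      simp [cell, g14, g15, g16, g11, g12, hr, hσ'.reg_K', Expr.fits_less hB1, h17']
      omega
    · simp only [Program.run, hval]
      simp only [Expr.eval_less, Expr.eval_reg, State.reg_setReg, if_true, Nat.add_sub_cancel, hsucc]
      by_cases h : f b < f (argMin f (b - 1))
      · simp [h, h17', hr]
      · simp [h, h17', h18']
  · exact fun σ' _ h => h
  · simp only [Expr.size]
    omega

theorem mergeVertex_spec {d i : ℕ} (hσ : Data B n K par ord c w σ)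
    (hT : StoresTable n par a c K d σ) (hd : d + 1 < n) (hi : i = n - 1 - d) (h14 : σ.reg 14 = i) :
    Runs B mergeVertex σ (170 * (K + 1) * (K + 1)) (fun σ' =>
      StoresTable n par a c K (d + 1) σ' ∧
      (∀ k ≤ K, σ'.arr 13 (i * (K + 1) + k) = choice n par a c K i k) ∧
      ∀ j ≠ i, ∀ k ≤ K, σ'.arr 13 (j * (K + 1) + k) = σ.arr 13 (j * (K + 1) + k)) := by
  have hB := hσ.n_lt
  have hB1 : 1 < B := by omega
  have hbc := hσ.bound_c
  have hin : i < n := by omega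
  have hpi : par i < i := hσ.lt i (by omega)
  have hp : par i < n := by omega
  have htab := fun p (hp : p < n) => table_le_sum (a := a) (c := c) (K := K) hσ.lt
    (show d < n by omega) hp
  set N := (table n par a c K d).1 with hN
  set G := (table n par a c K d).2 with hG
  have hchoice : ∀ k, choice n par a c K i k = argMin (mergeValue par N G i k) k := by
    intro k; rw [choice, show n - 1 - i = d by omega]
  refine Runs.seq (T₁ := 3) (T₂ := 130 * (K + 1) * (K + 1) + 35)
    (Q' := fun σ' => σ'.reg 15 = par i)
    (Runs.straight rfl (by decide) (by simp [Program.Safe, h14, hσ.arr_par]; omega)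
      (by simp [Program.run, h14, hσ.arr_par])) ?_ (by nlinarith)
  intro σ₁ hf h15
  replace hσ := hσ.frame hf rfl
  replace hT := hT.congr (hf.arr 11 rfl) (hf.arr 12 rfl)
  replace h14 : σ₁.reg 14 = i := by rw [hf.reg 14 rfl, h14]
  have h13 : σ₁.arr 13 = σ.arr 13 := hf.arr 13 rfl
  clear hf
  refine Runs.seq (T₁ := 130 * (K + 1) * (K + 1) + 6) (T₂ := 25) (Q' := fun σ' =>
    (∀ q < n, ∀ k ≤ K, σ'.arr 11 (q * (K + 1) + k) = (table n par a c K (d + 1)).1 q k) ∧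
    (∀ k ≤ K, σ'.arr 13 (i * (K + 1) + k) = choice n par a c K i k) ∧
    ∀ j ≠ i, ∀ k ≤ K, σ'.arr 13 (j * (K + 1) + k) = σ.arr 13 (j * (K + 1) + k)) ?_ ?_ (by omega)
  -- The row of the parent is overwritten in place, with budgets K - x in decreasing order: the
  -- entry for `k` uses only entries k - b ≤ k, which are still old.
  · refine Runs.forLoop (Tb := 80 * (K + 1) + 30) 0 (K + 1) (fun x σ' =>
      (∀ q < n, ∀ k ≤ K, σ'.arr 11 (q * (K + 1) + k) =
        if q = par i ∧ K < k + x then mergeValue par N G i k (argMin (mergeValue par N G i k) k)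
        else N q k) ∧
      (∀ k ≤ K, K < k + x → σ'.arr 13 (i * (K + 1) + k) = choice n par a c K i k) ∧
      ∀ j ≠ i, ∀ k ≤ K, σ'.arr 13 (j * (K + 1) + k) = σ.arr 13 (j * (K + 1) + k)) rfl
      ⟨by simp; omega, rfl⟩ (Nat.zero_le _) (by omega) (fun σ' hf => ?_) ?_ ?_ ?_ ?_
    · simp [(hσ.frame hf rfl).reg_K']; omega
    · refine ⟨fun q hq k hk => ?_, fun k hk hk' => by omega, fun j _ k _ => by simp [h13]⟩
      rw [if_neg (by omega)]
      exact hT.fst q hq k hk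
    · intro x σ' hf _ hx hr ⟨hi1, hi2, hi3⟩
      have hσ' := hσ.frame hf rfl
      have g14 : σ'.reg 14 = i := by rw [hf.reg 14 rfl, h14]
      have g15 : σ'.reg 15 = par i := by rw [hf.reg 15 rfl, h15]
      have g12 : ∀ q < n, σ'.arr 12 q = G q := by rw [hf.arr 12 rfl]; exact hT.snd
      clear hf
      obtain ⟨k, hk⟩ : ∃ k, k = K - x := ⟨_, rfl⟩
      refine Runs.seq (T₁ := 4) (T₂ := 80 * (K + 1) + 26) (Q' := fun σ' => σ'.reg 16 = k)
        (Runs.straight rfl (by decide) (by simp [Program.Safe, hσ'.reg_K, hr]; omega)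
          (by simp [Program.run, hσ'.reg_K, hr, hk])) ?_ (by omega)
      intro σ₂ hf g16
      replace hσ' := hσ'.frame hf rfl
      replace hr : σ₂.reg 12 = x := by rw [hf.reg 12 rfl, hr]
      replace g14 : σ₂.reg 14 = i := by rw [hf.reg 14 rfl, g14]
      replace g15 : σ₂.reg 15 = par i := by rw [hf.reg 15 rfl, g15]
      replace g12 : ∀ q < n, σ₂.arr 12 q = G q := by rw [hf.arr 12 rfl]; exact g12
      rw [← hf.arr 11 rfl, ← hf.arr 13 rfl] at *
      clear hf
      have hnew : ∀ k, mergeValue par N G i k (argMin (mergeValue par N G i k) k) ≤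
          ∑ v ∈ range n, c v := by
        intro k
        have := (table_le_sum (a := a) (c := c) (K := K) hσ.lt hd hp).1 k
        simpa only [table, ← hi, Function.update_self] using this
      have hle : ∀ q < n, ∀ k ≤ K, σ₂.arr 11 (q * (K + 1) + k) ≤ ∑ v ∈ range n, c v := by
        intro q hq l hl
        rw [hi1 q hq l hl]
        split_ifs
        · exact hnew l
        · exact (htab q hq).1 l
      refine Runs.seq (T₁ := 80 * (K + 1)) (T₂ := 26) (searchBest_spec hσ' hin hp (by omega) g14 g15
        g16 hle (by rw [g12 i hin]; exact (htab i hin).2) (mergeValue par N G i k) ?_) ?_ (by omega)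
      · intro b hb
        rw [hi1 _ hp _ (by omega), if_neg (by omega), hi1 _ hin _ (by omega),
          if_neg (by omega), g12 i hin, mergeValue]
      intro σ₃ hf ⟨g18, g17⟩
      replace hσ' := hσ'.frame hf rfl
      replace hr : σ₃.reg 12 = x := by rw [hf.reg 12 rfl, hr]
      replace g14 : σ₃.reg 14 = i := by rw [hf.reg 14 rfl, g14]
      replace g15 : σ₃.reg 15 = par i := by rw [hf.reg 15 rfl, g15]
      replace g16 : σ₃.reg 16 = k := by rw [hf.reg 16 rfl, g16]
      rw [← hf.arr 11 rfl, ← hf.arr 13 rfl] at *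
      clear hf
      have hc1 := hσ'.cell_lt hp (k := k) (by omega)
      have hc2 := hσ'.cell_lt hin (k := k) (by omega)
      have hnk := hnew k
      have harg : argMin (mergeValue par N G i k) k ≤ k := argMin_le _ _
      refine Runs.straight rfl (by decide) ?_ ?_
      · simp [Program.Safe, Program.run, cell, g14, g15, g16, g17, g18, hσ'.reg_K']
        omega
      · simp only [Program.run, cell, g14, g15, g16, g17, g18, hσ'.reg_K', Expr.eval_add,
          Expr.eval_mul, Expr.eval_reg, State.arr_setReg, State.arr_setArr, State.reg_setArr]
        simp only [show (11 : ℕ) ≠ 13 by decide, show (13 : ℕ) ≠ 11 by decide, if_true, if_false]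
        refine ⟨fun q hq l hl => ?_, fun l hl hl' => ?_, fun j hj l hl => ?_⟩
        · by_cases h : q = par i ∧ l = k
          · rw [h.1, h.2, Function.update_self, if_pos ⟨rfl, by omega⟩]
          · rw [Function.update_of_ne fun h' => h (cell_inj hl (by omega) h'), hi1 q hq l hl]
            congr 1
            simp only [eq_iff_iff]
            constructor
            · exact fun h' => ⟨h'.1, by omega⟩
            · intro h'
              have : l ≠ k := fun hlk => h ⟨h'.1, hlk⟩
              exact ⟨h'.1, by omega⟩
        · by_cases h : l = k
          · rw [h, Function.update_self, hchoice]
          · rw [Function.update_of_ne fun h' => h (cell_inj hl (by omega) h').2]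
            exact hi2 l hl (by omega)
        · rw [Function.update_of_ne fun h' => hj (cell_inj hl (by omega) h').1]
          exact hi3 j hj l hl
    · rintro σ' _ ⟨hi1, hi2, hi3⟩
      refine ⟨fun q hq k hk => ?_, fun k hk => hi2 k hk (by omega), hi3⟩
      rw [hi1 q hq k hk]
      simp only [table, ← hi]
      by_cases h : q = par i
      · rw [h, if_pos ⟨rfl, by omega⟩, Function.update_self]
      · rw [if_neg fun h' => h h'.1, Function.update_of_ne h]
    · simp only [Expr.size, Nat.sub_zero]
      nlinarith
  intro σ₂ hf ⟨hi1, hi2, hi3⟩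
  have hσ' := hσ.frame hf rfl
  replace h14 : σ₂.reg 14 = i := by rw [hf.reg 14 rfl, h14]
  replace h15 : σ₂.reg 15 = par i := by rw [hf.reg 15 rfl, h15]
  have g12 : ∀ q < n, σ₂.arr 12 q = G q := by rw [hf.arr 12 rfl]; exact hT.snd
  have hc := hσ'.cell_lt hin (le_refl K)
  have hNi : σ₂.arr 11 (i * (K + 1) + K) = N i K := by
    rw [hi1 i hin K le_rfl]
    simp only [table, ← hi]
    rw [Function.update_of_ne hpi.ne']
  have hb1 := (htab i hin).1 K
  have hb2 := (htab i hin).2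
  have hb3 := (htab _ hp).2
  refine Runs.straight rfl (by decide) ?_ ?_
  · simp [Program.Safe, cell, h14, h15, hσ'.reg_K', hσ'.reg_K, g12 i hin, g12 _ hp, hNi]
    omega
  · refine ⟨⟨fun q hq k hk => ?_, fun q hq => ?_⟩, ?_, ?_⟩
    · simpa [Program.run] using hi1 q hq k hk
    · simp only [Program.run, cell, h14, h15, hσ'.reg_K', hσ'.reg_K, Expr.eval_add, Expr.eval_read,
        Expr.eval_mul, Expr.eval_reg, Expr.eval_minimum, State.arr_setArr, g12 i hin, g12 _ hp, hNi,
        if_true, table, ← hi]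
      by_cases h : q = par i
      · rw [h, Function.update_self, Function.update_self]
      · rw [Function.update_of_ne h, Function.update_of_ne h, g12 q hq]
    · simpa [Program.run] using hi2
    · simpa [Program.run] using hi3

theorem mergeAll_spec (hσ : Data B n K par ord c w σ) (hT : StoresTable n par a c K 0 σ) :
    Runs B mergeAll σ (190 * n * (K + 1) * (K + 1) + 10) (fun σ' =>
      StoresTable n par a c K (n - 1) σ' ∧ ∀ i, 0 < i → i < n → ∀ k ≤ K,
        σ'.arr 13 (i * (K + 1) + k) = choice n par a c K i k) := by
  have hB := hσ.n_lt
  have hn := hσ.n_pos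
  refine Runs.forLoop (Tb := 170 * (K + 1) * (K + 1) + 4) 1 n (fun j σ' =>
      StoresTable n par a c K (j - 1) σ' ∧ ∀ i, n - j < i → i < n → ∀ k ≤ K,
        σ'.arr 13 (i * (K + 1) + k) = choice n par a c K i k) rfl
      ⟨by simp; omega, rfl⟩ hn (by omega) (fun σ' hf => ?_) ?_ ?_ ?_ ?_
  · simp [(hσ.frame hf rfl).reg_n]; omega
  · exact ⟨hT.congr rfl rfl, fun i hi hi' => by omega⟩
  · intro j σ' hf hj1 hj hr ⟨hi1, hi2⟩
    have hσ' := hσ.frame hf rfl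
    -- Round `j` is merging step j - 1 and therefore treats vertex n - j.
    refine Runs.seq (T₁ := 4) (T₂ := 170 * (K + 1) * (K + 1)) (Q' := fun σ' => σ'.reg 14 = n - j)
      (Runs.straight rfl (by decide) (by simp [Program.Safe, hσ'.reg_n, hr]; omega)
        (by simp [Program.run, hσ'.reg_n, hr])) ?_ (by omega)
    intro σ₁ hf' h14
    have hT' := hi1.congr (hf'.arr 11 rfl) (hf'.arr 12 rfl)
    refine (mergeVertex_spec (hσ'.frame hf' rfl) hT' (by omega) (by omega) h14).mono le_rfl ?_
    intro σ₂ _ ⟨h1, h2, h3⟩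
    rw [show j - 1 + 1 = j + 1 - 1 by omega] at h1
    refine ⟨h1.congr rfl rfl, fun i hi hin k hk => ?_⟩
    rw [State.arr_setReg]
    by_cases h : i = n - j
    · rw [h]; exact h2 k hk
    · rw [h3 i h k hk, hf'.arr 13 rfl]
      exact hi2 i (by omega) hin k hk
  · rintro σ' _ ⟨hi1, hi2⟩
    exact ⟨hi1, fun i h0 hin => hi2 i (by omega) hin⟩
  · simp only [Expr.size]
    have h1 : (n - 1) * (1 + (170 * (K + 1) * (K + 1) + 4) + 7) ≤
        n * (1 + (170 * (K + 1) * (K + 1) + 4) + 7) := Nat.mul_le_mul_right _ (Nat.sub_le _ _)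
    have h2 : n * 1 ≤ n * ((K + 1) * (K + 1)) := Nat.mul_le_mul_left _ (by nlinarith)
    nlinarith

end Specs

/-! ### The traceback in memory and one phase -/

/-- Mark the vertices of the separator that the tables describe. -/
def traceback : Program :=
  .seq (.store 14 (.lit 0) (.lit 0)) <|
  .seq (.store 15 (.lit 0) (.lit 0)) <|
  .seq (.forLoop 11 (.lit 0) (.reg 0) <|
    .seq (.assign 15 (.read 6 (.reg 11))) <|
    .seq (.ite (.equal (.reg 11) (.lit 0) + .read 15 (.reg 15)) (.assign 16 (.reg 4))
      (.assign 16 (.read 13 (cell (.reg 11) (.read 14 (.reg 15)))))) <|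
    .seq (.store 14 (.reg 15) (.read 14 (.reg 15) - .reg 16)) <|
    .seq (.store 14 (.reg 11) (.reg 16)) <|
    .store 15 (.reg 11)
      (.lit 1 - .less (.read 11 (cell (.reg 11) (.reg 16))) (.read 12 (.reg 11)))) <|
  .forLoop 11 (.lit 0) (.reg 0) <|
    .store 15 (.reg 11) (.less (.lit 0)
      (.read 15 (.reg 11) + .less (.read 14 (.reg 11)) (.read 10 (.reg 11))))

/-- Remove a separator and compute the maximum weight of the remaining components. -/
def phase : Program :=
  .seq initTables <| .seq mergeAll <| .seq traceback <| .seq queryMarked computeMax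

section Specs

variable {B n K L M : ℕ} {par ord c w a : ℕ → ℕ} {σ σ' : State}

theorem budget_le (cur : ℕ → ℕ) (mark : Finset ℕ) (i : ℕ) (hcur : cur (par i) ≤ K) :
    budget n par a c K cur mark i ≤ K := by
  rw [budget]
  split_ifs
  · exact le_rfl
  · exact (argMin_le _ _).trans hcur

theorem traceback_spec (hσ : Data B n K par ord c w σ) (hT : StoresTable n par a c K (n - 1) σ)
    (hch : ∀ i, 0 < i → i < n → ∀ k ≤ K, σ.arr 13 (i * (K + 1) + k) = choice n par a c K i k)
    (ha : ∀ i < n, σ.arr 10 i = a i) (haB : ∀ i < n, a i < B) :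
    Runs B traceback σ (120 * n + 120) (StoresMarks n (separator n par a c K)) := by
  have hB := hσ.n_lt
  have hB1 : 1 < B := by omega
  have hbc := hσ.bound_c
  have hn := hσ.n_pos
  -- Only position 0 must be cleared: since `par 0 = 0`, the first round reads it before writing it.
  -- All other entries left over from earlier phases are overwritten before use.
  refine Runs.seq (T₁ := 3) (T₂ := 120 * n + 110) (Q' := fun σ' => σ'.arr 14 0 = 0)
    (Runs.straight rfl (by decide) (by simp [Program.Safe]; omega) (by simp [Program.run])) ?_
    (by omega)
  intro σ₁ hf h14
  refine Runs.seq (T₁ := 3) (T₂ := 120 * n + 100) (Q' := fun σ' => σ'.arr 15 0 = 0)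
    (Runs.straight rfl (by decide) (by simp [Program.Safe]; omega) (by simp [Program.run])) ?_
    (by omega)
  intro σ₂ hf' h15
  replace h14 : σ₂.arr 14 0 = 0 := by rw [hf'.arr 14 rfl, h14]
  replace hσ := (hσ.frame hf rfl).frame hf' rfl
  replace hT := (hT.congr (hf.arr 11 rfl) (hf.arr 12 rfl)).congr (hf'.arr 11 rfl) (hf'.arr 12 rfl)
  replace hch : ∀ i, 0 < i → i < n → ∀ k ≤ K,
      σ₂.arr 13 (i * (K + 1) + k) = choice n par a c K i k := by
    rw [hf'.arr 13 rfl, hf.arr 13 rfl]; exact hch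
  replace ha : ∀ i < n, σ₂.arr 10 i = a i := by rw [hf'.arr 10 rfl, hf.arr 10 rfl]; exact ha
  clear hf hf' σ₁
  refine Runs.seq (T₁ := 80 * n + 10) (T₂ := 40 * n + 40) (Q' := fun σ' => ∀ p < n,
    σ'.arr 14 p = (trace n par a c K n).1 p ∧
    σ'.arr 15 p = if p ∈ (trace n par a c K n).2 then 1 else 0) ?_ ?_ (by omega)
  · refine Runs.forLoop (Tb := 60) 0 n (fun j σ' => ∀ p, p < j ∨ p = 0 →
      σ'.arr 14 p = (trace n par a c K j).1 p ∧
      σ'.arr 15 p = if p ∈ (trace n par a c K j).2 then 1 else 0) rfl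
      ⟨by simp; omega, rfl⟩ (Nat.zero_le n) (by omega) (fun σ' hf => ?_) ?_ ?_ ?_ ?_
    · simp [(hσ.frame hf rfl).reg_n]; omega
    · intro p hp
      obtain rfl : p = 0 := by omega
      simp [h14, h15, trace]
    · intro j σ' hf _ hj hr hi
      have hσ' := hσ.frame hf rfl
      have hpn := hσ'.par_lt hj
      have hpj : par j < j ∨ par j = 0 := by
        rcases Nat.eq_zero_or_pos j with rfl | h
        · exact Or.inr hσ'.par_zero
        · exact Or.inl (hσ'.lt j h)
      have g13 : ∀ i, 0 < i → i < n → ∀ k ≤ K,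
          σ'.arr 13 (i * (K + 1) + k) = choice n par a c K i k := by rw [hf.arr 13 rfl]; exact hch
      have hT' := hT.congr (hf.arr 11 rfl) (hf.arr 12 rfl)
      have hcur := trace_cur_le (n := n) (par := par) (a := a) (c := c) (K := K) j
      obtain ⟨hi1, hi2⟩ := hi _ hpj
      set cur := (trace n par a c K j).1 with hcurdef
      set mark := (trace n par a c K j).2 with hmark
      set b := budget n par a c K cur mark j with hb
      have hbK : b ≤ K := budget_le _ _ _ (hcur _)
      refine Runs.seq (T₁ := 3) (T₂ := 57) (Q' := fun σ' => σ'.reg 15 = par j)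
        (Runs.straight rfl (by decide) (by simp [Program.Safe, hr, hσ'.arr_par]; omega)
          (by simp [Program.run, hr, hσ'.arr_par])) ?_ (by omega)
      intro σ₃ hf' g15
      have hσ₃ := hσ'.frame hf' rfl
      have hr₃ : σ₃.reg 11 = j := by rw [hf'.reg 11 rfl, hr]
      rw [← hf'.arr 13 rfl] at g13
      rw [← hf'.arr 14 rfl] at hi1 hi
      rw [← hf'.arr 15 rfl] at hi2 hi
      have hT₃ := hT'.congr (hf'.arr 11 rfl) (hf'.arr 12 rfl)
      clear hf'
      refine Runs.seq (T₁ := 20) (T₂ := 37) (Q' := fun σ' => σ'.reg 16 = b) ?_ ?_ (by omega)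
      · refine Runs.ite (T₁ := 10) ?_ (fun hc => ?_) (fun hc => ?_) (by decide)
        · simp [hr₃, g15, hi2, Expr.fits_equal hB1]
          refine ⟨?_, ⟨?_, ?_⟩, ?_⟩ <;> (try split_ifs) <;> omega
        · have hc' : j = 0 ∨ par j ∈ mark := by
            by_contra h
            rw [not_or] at h
            simp [hr₃, g15, hi2, h.1, h.2] at hc
          refine Runs.straight rfl (by decide) (by simp [Program.Safe, hσ₃.reg_K]; omega) ?_
          simp [Program.run, hσ₃.reg_K, hb, budget, hc']
        · have hc' : ¬ (j = 0 ∨ par j ∈ mark) := by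
            rintro (h | h)
            · simp [hr₃, h] at hc
            · simp [g15, hi2, h] at hc
          have hj0 : 0 < j := Nat.pos_of_ne_zero fun h => hc' (Or.inl h)
          have hcp := hcur (par j)
          have hcell := hσ₃.cell_lt hj hcp
          have hg := g13 j hj0 hj _ hcp
          have hble : choice n par a c K j (cur (par j)) ≤ K := (argMin_le _ _).trans hcp
          refine Runs.straight rfl (by decide) ?_ ?_
          · simp [Program.Safe, cell, hr₃, g15, hi1, hσ₃.reg_K', hg]
            omega
          · simp [Program.run, cell, hr₃, g15, hi1, hσ₃.reg_K', hg, hb, budget, hc']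
      intro σ₄ hf' g16
      have hσ₄ := hσ₃.frame hf' rfl
      have hr₄ : σ₄.reg 11 = j := by rw [hf'.reg 11 rfl, hr₃]
      replace g15 : σ₄.reg 15 = par j := by rw [hf'.reg 15 rfl, g15]
      rw [← hf'.arr 14 rfl] at hi1 hi
      rw [← hf'.arr 15 rfl] at hi2 hi
      have hT₄ := hT₃.congr (hf'.arr 11 rfl) (hf'.arr 12 rfl)
      clear hf'
      -- Memory holds the tables after all merges; the row of `j` has been final since all later
      -- vertices were merged.
      have hNb : σ₄.arr 11 (j * (K + 1) + b) = finalN n par a c K j b := by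
        rw [hT₄.fst j hj b hbK, (table_stable hσ.lt hj (by omega) (by omega)).1]
      have hGj : σ₄.arr 12 j = finalG n par a c K j := by
        rw [hT₄.snd j hj, (table_stable hσ.lt hj (by omega) (by omega)).2]
      have hb1 := (table_le_sum (a := a) (c := c) (K := K) hσ.lt
        (show n - 1 - j < n by omega) hj).1 b
      have hb2 := (table_le_sum (a := a) (c := c) (K := K) hσ.lt
        (show n - 1 - j < n by omega) hj).2
      rw [← finalN] at hb1
      rw [← finalG] at hb2
      have hcell := hσ₄.cell_lt hj hbK
      have hcp := hcur (par j)
      refine Runs.straight rfl (by decide) ?_ ?_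
      · simp [Program.Safe, Program.run, cell, hr₄, g15, g16, hi1, hσ₄.reg_K', hNb, hGj,
          Expr.fits_less hB1]
        omega
      · intro p hp
        simp only [Program.run, cell, hr₄, g15, g16, hi1, hσ₄.reg_K', Expr.eval_add,
          Expr.eval_mul, Expr.eval_reg, Expr.eval_read, Expr.eval_sub, Expr.eval_lit,
          Expr.eval_less, State.arr_setReg, State.arr_setArr, State.reg_setArr, trace]
        simp only [← hcurdef, ← hmark, ← hb, show (14 : ℕ) ≠ 15 by decide,
          show (15 : ℕ) ≠ 14 by decide, show (11 : ℕ) ≠ 14 by decide,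
          show (12 : ℕ) ≠ 14 by decide, if_true, if_false, hNb, hGj]
        have hjm : j ∉ mark := fun h => by simpa using trace_mark_subset j h
        by_cases hpj' : p = j
        · rw [hpj', Function.update_self, Function.update_self, Function.update_self]
          refine ⟨rfl, ?_⟩
          by_cases h : finalG n par a c K j ≤ finalN n par a c K j b
          · simp [h, not_lt.2 h]
          · simp [h, hjm, not_le.1 h]
        · rw [Function.update_of_ne hpj', Function.update_of_ne hpj', Function.update_of_ne hpj']
          obtain ⟨h1, h2⟩ := hi p (by omega)
          refine ⟨?_, ?_⟩
          · by_cases h : p = par j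
            · rw [h, Function.update_self, Function.update_self]
            · rw [Function.update_of_ne h, Function.update_of_ne h, h1]
          · rw [h2]
            split_ifs <;> simp_all
    · exact fun σ' _ hi p hp => hi p (Or.inl hp)
    · simp only [Expr.size]; omega
  intro σ₃ hf hi
  replace hσ := hσ.frame hf rfl
  replace ha : ∀ i < n, σ₃.arr 10 i = a i := by rw [hf.arr 10 rfl]; exact ha
  clear hf
  -- The second pass also marks, in place, the vertices heavier than their remaining budget.
  refine Runs.forLoop (Tb := 15) 0 n (fun j σ' => ∀ p < n, σ'.arr 15 p =
      if p < j then (if p ∈ separator n par a c K then 1 else 0)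
      else if p ∈ (trace n par a c K n).2 then 1 else 0) rfl
    ⟨by simp; omega, rfl⟩ (Nat.zero_le n) (by omega) (fun σ' hf => ?_) ?_ ?_ ?_ ?_
  · simp [(hσ.frame hf rfl).reg_n]; omega
  · exact fun p hp => by simpa using (hi p hp).2
  · intro j σ' hf _ hj hr hi'
    have g14 : σ'.arr 14 j = (trace n par a c K n).1 j := by rw [hf.arr 14 rfl, (hi j hj).1]
    have g10 : σ'.arr 10 j = a j := by rw [hf.arr 10 rfl, ha j hj]
    have g15 := hi' j hj
    rw [if_neg (lt_irrefl j)] at g15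
    have hcur := trace_cur_le (n := n) (par := par) (a := a) (c := c) (K := K) n j
    have haj := haB j hj
    refine Runs.straight rfl (by decide) ?_ ?_
    · simp [Program.Safe, hr, g14, g10, g15, Expr.fits_less hB1]
      refine ⟨?_, ?_, ⟨?_, ?_⟩, ?_, ?_⟩ <;> (try split_ifs) <;> omega
    · intro p hp
      simp only [Program.run, hr, g14, g10, g15, Expr.eval_add, Expr.eval_reg, Expr.eval_read,
        Expr.eval_lit, Expr.eval_less, State.arr_setReg, State.arr_setArr, if_true]
      by_cases h : p = j
      · rw [h, Function.update_self, if_pos (Nat.lt_succ_self j)]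
        simp only [separator, mem_filter, mem_range, hj, true_and]
        by_cases h1 : j ∈ (trace n par a c K n).2 <;>
          by_cases h2 : (trace n par a c K n).1 j < a j <;> simp [h1, h2]
      · rw [Function.update_of_ne h, hi' p hp]
        simp only [show p < j + 1 ↔ p < j by omega]
  · exact fun σ' _ hi' p hp => by rw [hi' p hp, if_pos hp]
  · simp only [Expr.size]; omega

/-- The state of the main loop: the vertices of `R` have been queried at total cost `A`, and `M` is
the maximum weight of a remaining component. -/
structure Progress (n : ℕ) (par ord w c : ℕ → ℕ) (L : ℕ) (R : Finset ℕ) (A : ℕ) (σ : State) :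
    Prop where
  eliminated : Eliminated n par ord w c R A σ
  le_max : ∀ r, classWeight n par R w r ≤ σ.reg 5
  max_le : ∃ r, σ.reg 5 ≤ classWeight n par R w r
  -- The bound is kept for all profiles at once, because the algorithm does not know an optimal
  -- decision tree.
  potential : ∀ h, IsProfile n par w h →
    (L - 1) * A + 2 * L * ∑ v ∈ range n, c v * min (2 * h v) (σ.reg 5) ≤
      2 * L * ∑ v ∈ range n, c v * (2 * h v)

theorem classWeight_le_sum (R : Finset ℕ) (r : ℕ) :
    classWeight n par R w r ≤ ∑ v ∈ range n, w v :=
  sum_le_sum_of_subset (filter_subset _ _)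

theorem phase_spec {R : Finset ℕ} {A : ℕ} (hσ : Data B n (n * L) par ord c w σ) (hL : 2 ≤ L)
    (hP : Progress n par ord w c L R A σ) (hM : σ.reg 5 ≠ 0) :
    Runs B phase σ (1000 * n * (n * L + 1) * (n * L + 1)) (fun σ' => ∃ R' A',
      n - #R' < n - #R ∧ Progress n par ord w c L R' A' σ') := by
  obtain ⟨hE, hle, ⟨r₀, hr₀⟩, hpot⟩ := hP
  obtain ⟨M, hM'⟩ : ∃ M, σ.reg 5 = M := ⟨_, rfl⟩
  rw [hM'] at hle hr₀ hpot hM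
  have hMpos : 0 < M := Nat.pos_of_ne_zero hM
  have hn := hσ.n_pos
  have hMB : M < B := by
    have := hσ.bound_w
    have := hr₀.trans (classWeight_le_sum R r₀)
    omega
  obtain ⟨K, hK⟩ : ∃ K, n * L = K := ⟨_, rfl⟩
  have hnK : n * 2 ≤ K := by rw [← hK]; exact Nat.mul_le_mul_left _ hL
  have hsq : n * (K + 1) ≤ n * (K + 1) * (K + 1) := Nat.le_mul_of_pos_right _ (Nat.succ_pos K)
  have hsq' : n * (n + 1) ≤ n * (K + 1) := Nat.mul_le_mul_left _ (by omega)
  have hsq'' : n * 1 ≤ n * (K + 1) := Nat.mul_le_mul_left _ (by omega)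
  rw [hK] at hσ ⊢
  set a := rounded w K M with ha
  set S := separator n par a c K with hS
  have hSn : S ⊆ range n := filter_subset _ _
  refine Runs.seq (T₁ := 100 * n * (K + 1) + 20) (T₂ := 860 * (n * (K + 1) * (K + 1)))
    (initTables_spec hσ hM' hMB) ?_ (by nlinarith)
  rintro σ₁ hf ⟨h10, hT⟩
  replace hσ := hσ.frame hf rfl
  replace hE := hE.congr (hf.arr 7 rfl) (hf.arr 3 rfl)
  clear hf
  refine Runs.seq (T₁ := 190 * n * (K + 1) * (K + 1) + 10) (T₂ := 660 * (n * (K + 1) * (K + 1)))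
    (mergeAll_spec hσ hT) ?_ (by nlinarith)
  rintro σ₂ hf ⟨hT, hch⟩
  replace hσ := hσ.frame hf rfl
  replace hE := hE.congr (hf.arr 7 rfl) (hf.arr 3 rfl)
  replace h10 : ∀ i < n, σ₂.arr 10 i = a i := by rw [hf.arr 10 rfl]; exact h10
  clear hf
  refine Runs.seq (T₁ := 120 * n + 120) (T₂ := 420 * (n * (K + 1) * (K + 1)))
    (traceback_spec hσ hT hch h10 fun i hi =>
      (Nat.div_le_self _ _).trans_lt (hσ.bound_wK i hi)) ?_ (by nlinarith)
  intro σ₃ hf hmark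
  replace hσ := hσ.frame hf rfl
  replace hE := hE.congr (hf.arr 7 rfl) (hf.arr 3 rfl)
  clear hf
  refine Runs.seq (T₁ := 110 * n * (n + 1) + 30 * n + 10) (T₂ := 110 * n + 110)
    (queryMarked_spec hσ hE hmark hSn hle) ?_ (by nlinarith)
  rintro σ₄ hf ⟨A', hA', hE'⟩
  replace hσ := hσ.frame hf rfl
  clear hf
  refine (computeMax_spec hσ hE'.set).mono le_rfl ?_
  rintro σ₅ hf ⟨hmax, r₁, hr₁⟩
  replace hE' := hE'.congr (hf.arr 7 rfl) (hf.arr 3 rfl)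
  -- A component left by R ∪ S lies inside a component left by S alone, so the whole-tree separator
  -- bound applies.
  have hstep : 2 * L * σ₅.reg 5 ≤ (L + 1) * M := by
    have h1 : σ₅.reg 5 ≤ classWeight n par S w (top par S r₁) :=
      hr₁.trans (classWeight_le_of_subset subset_union_right _)
    refine (Nat.mul_le_mul_left _ h1).trans ?_
    refine le_of_classWeight_rounded_le hn hMpos ?_
    rw [hK]
    exact classWeight_separator_le hσ.lt _
  -- Since L ≥ 2, the maximum drops to at most 3M / 4. Hence `R` has grown, which limits the number
  -- of phases to `n`.
  have hlt : σ₅.reg 5 < M := by nlinarith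
  refine ⟨R ∪ S, A', ?_, hE', hmax, ⟨r₁, hr₁⟩, fun h hh => ?_⟩
  · have hne : R ⊂ R ∪ S := by
      refine Finset.ssubset_iff_subset_ne.2 ⟨subset_union_left, fun h => ?_⟩
      rw [← h] at hmax
      have := hmax r₀
      omega
    have h1 := card_lt_card hne
    have h2 : #(R ∪ S) ≤ n := by
      have : R ∪ S ⊆ range n := by
        obtain ⟨res, he, _⟩ := hE'.elim
        exact he.subset
      simpa using card_le_card this
    omega
  · have h1 := potential_step (K := K) (c := c) hσ.lt hn (by omega) hMpos hh hstep
    have h2 := hpot h hh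
    have h3 := Nat.mul_le_mul_left (L - 1) hA'
    rw [Nat.mul_add] at h3
    omega

end Specs

/-! ### Rooting the tree -/

/-- Find an edge from a visited vertex (register `14`) to an unvisited vertex (register `15`). -/
def findEdge : Program :=
  .forLoop 11 (.lit 0) (.reg 0 * .reg 0) <|
    .seq (.assign 12 (.reg 11 / .reg 0)) <|
    .seq (.assign 13 (.reg 11 - .reg 12 * .reg 0)) <|
    .ite (.equal (.read 5 (.reg 13)) (.lit 0) * .read 0 (.reg 11) * .read 5 (.reg 12))
      (.seq (.assign 14 (.reg 12)) (.assign 15 (.reg 13))) .skip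

/-- Enumerate the vertices such that every vertex except for the first one has a neighbour, its
parent, among the earlier vertices. -/
def rooting : Program :=
  .seq (.store 5 (.lit 0) (.lit 1)) <|
  .forLoop 10 (.lit 1) (.reg 0) <|
    .seq findEdge <|
    .seq (.store 4 (.reg 10) (.reg 15)) <|
    .seq (.store 6 (.reg 10) (.read 5 (.reg 14) - .lit 1)) <|
    .store 5 (.reg 15) (.reg 10 + .lit 1)

section Rooting

variable {B n : ℕ} {T : SimpleGraph (Fin n)} {σ σ' : State}

/-- Adjacency of the vertices with the indices `u` and `v`. -/
def AdjIdx (T : SimpleGraph (Fin n)) (u v : ℕ) : Prop :=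
  ∃ (hu : u < n) (hv : v < n), T.Adj ⟨u, hu⟩ ⟨v, hv⟩

open scoped Classical in
/-- The array `0` contains the adjacency matrix. -/
def StoresGraph (T : SimpleGraph (Fin n)) (σ : State) : Prop :=
  σ.reg 0 = n ∧ ∀ x < n * n, σ.arr 0 x = if AdjIdx T (x / n) (x % n) then 1 else 0

/-- The first `i` vertices have been enumerated. -/
structure Enumerated (T : SimpleGraph (Fin n)) (i : ℕ) (σ : State) : Prop where
  ord_lt : ∀ j < i, σ.arr 4 j < n
  -- Array 5 inverts array 4 with a shift by one, so that 0 can mean unvisited.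
  pos_ord : ∀ j < i, σ.arr 5 (σ.arr 4 j) = j + 1
  ord_pos : ∀ v < n, σ.arr 5 v ≠ 0 → σ.arr 5 v ≤ i ∧ σ.arr 4 (σ.arr 5 v - 1) = v
  par : ∀ j, 0 < j → j < i → σ.arr 6 j < j ∧ AdjIdx T (σ.arr 4 (σ.arr 6 j)) (σ.arr 4 j)
  par_zero : ∀ j, j = 0 ∨ i ≤ j → σ.arr 6 j = 0

theorem Enumerated.congr {i : ℕ} (h : Enumerated T i σ) (h4 : σ'.arr 4 = σ.arr 4)
    (h5 : σ'.arr 5 = σ.arr 5) (h6 : σ'.arr 6 = σ.arr 6) : Enumerated T i σ' := by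
  constructor
  · rw [h4]; exact h.ord_lt
  · rw [h4, h5]; exact h.pos_ord
  · rw [h4, h5]; exact h.ord_pos
  · rw [h4, h6]; exact h.par
  · rw [h6]; exact h.par_zero

theorem Enumerated.exists_edge {i : ℕ} (h : Enumerated T i σ) (hT : T.Connected) (h0 : 0 < i)
    (hi : i < n) : ∃ u < n, ∃ v < n, σ.arr 5 u ≠ 0 ∧ σ.arr 5 v = 0 ∧ AdjIdx T u v := by
  -- If all vertices were visited, their positions would inject `n` vertices into `i < n` places. A
  -- walk to an unvisited vertex then has an edge leaving the visited set.
  obtain ⟨v₀, hv₀, h5⟩ : ∃ v < n, σ.arr 5 v = 0 := by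
    by_contra! hcon
    have := card_le_card_of_injOn (s := range n) (t := range i) (fun v => σ.arr 5 v - 1)
      (fun v hv => by
        have hv := mem_range.1 hv
        have := hcon v hv
        have := (h.ord_pos v hv this).1
        simp only [coe_range, Set.mem_Iio]
        omega)
      (fun v hv u hu huv => by
        have hv := mem_range.1 hv
        have hu := mem_range.1 hu
        rw [← (h.ord_pos v hv (hcon v hv)).2, ← (h.ord_pos u hu (hcon u hu)).2]
        exact congrArg (σ.arr 4) huv)
    simp only [card_range] at this
    omega
  obtain ⟨p⟩ := hT.preconnected ⟨σ.arr 4 0, h.ord_lt 0 h0⟩ ⟨v₀, hv₀⟩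
  obtain ⟨d, _, hd1, hd2⟩ := p.exists_boundary_dart {x | σ.arr 5 x ≠ 0}
    (by simp [h.pos_ord 0 h0]) (by simpa using h5)
  exact ⟨d.fst, d.fst.2, d.snd, d.snd.2, hd1, by simpa using hd2, d.fst.2, d.snd.2, d.adj⟩

theorem findEdge_spec {i : ℕ} (hn : 0 < n) (hB : n * n + 2 * n + 10 < B) (hG : StoresGraph T σ)
    (hE : Enumerated T i σ) (hT : T.Connected) (h0 : 0 < i) (hi : i < n) :
    Runs B findEdge σ (50 * (n * n) + 10) (fun σ' => σ'.reg 14 < n ∧ σ'.reg 15 < n ∧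
      σ.arr 5 (σ'.reg 14) ≠ 0 ∧ σ.arr 5 (σ'.reg 15) = 0 ∧ AdjIdx T (σ'.reg 14) (σ'.reg 15)) := by
  classical
  have hB1 : 1 < B := by omega
  have hval : ∀ v < n, σ.arr 5 v ≤ n := fun v hv => by
    by_cases h : σ.arr 5 v = 0
    · omega
    · exact (hE.ord_pos v hv h).1.trans hi.le
  -- The invariant is an implication and starts vacuously; the registers keep the last suitable pair
  -- scanned.
  refine Runs.forLoop (Tb := 34) 0 (n * n) (fun j σ' => (∃ x < j, σ.arr 5 (x / n) ≠ 0 ∧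
      σ.arr 5 (x % n) = 0 ∧ AdjIdx T (x / n) (x % n)) → σ'.reg 14 < n ∧ σ'.reg 15 < n ∧
      σ.arr 5 (σ'.reg 14) ≠ 0 ∧ σ.arr 5 (σ'.reg 15) = 0 ∧ AdjIdx T (σ'.reg 14) (σ'.reg 15)) rfl
    ⟨by simp; omega, rfl⟩ (Nat.zero_le _) (by omega) (fun σ' hf => ?_) (by simp) ?_ ?_ ?_
  · have h0 : σ'.reg 0 = n := by rw [hf.reg 0 rfl, hG.1]
    simp [h0]; omega
  · intro x σ' hf _ hx hr hinv
    have g0 : σ'.reg 0 = n := by rw [hf.reg 0 rfl, hG.1]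
    have g5 : σ'.arr 5 = σ.arr 5 := hf.arr 5 rfl
    have ga : σ'.arr 0 x = if AdjIdx T (x / n) (x % n) then 1 else 0 := by
      rw [hf.arr 0 rfl, hG.2 x hx]
    have hu : x / n < n := (Nat.div_lt_iff_lt_mul hn).2 hx
    have hv : x % n < n := Nat.mod_lt _ hn
    have hmod : x - x / n * n = x % n := by have := Nat.div_add_mod' x n; omega
    have hle := Nat.div_mul_le_self x n
    have hvu := hval _ hu
    have hvv := hval _ hv
    refine Runs.seq (T₁ := 4) (T₂ := 30) (Q' := fun σ'' => σ''.reg 12 = x / n)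
      (Runs.straight rfl (by decide) (by simp [Program.Safe, hr, g0]; omega)
        (by simp [Program.run, hr, g0])) ?_ (by omega)
    intro σ₁ hf₁ g12
    replace g0 : σ₁.reg 0 = n := by rw [hf₁.reg 0 rfl, g0]
    replace hr : σ₁.reg 11 = x := by rw [hf₁.reg 11 rfl, hr]
    rw [← hf₁.arr 5 rfl] at g5
    rw [← hf₁.arr 0 rfl] at ga
    rw [← hf₁.reg 14 rfl, ← hf₁.reg 15 rfl] at hinv
    clear hf₁
    refine Runs.seq (T₁ := 6) (T₂ := 24) (Q' := fun σ'' => σ''.reg 13 = x % n)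
      (Runs.straight rfl (by decide) (by simp [Program.Safe, hr, g0, g12]; omega)
        (by simp [Program.run, hr, g0, g12, hmod])) ?_ (by omega)
    intro σ₂ hf₂ g13
    replace g0 : σ₂.reg 0 = n := by rw [hf₂.reg 0 rfl, g0]
    replace hr : σ₂.reg 11 = x := by rw [hf₂.reg 11 rfl, hr]
    replace g12 : σ₂.reg 12 = x / n := by rw [hf₂.reg 12 rfl, g12]
    rw [← hf₂.arr 5 rfl] at g5
    rw [← hf₂.arr 0 rfl] at ga
    rw [← hf₂.reg 14 rfl, ← hf₂.reg 15 rfl] at hinv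
    clear hf₂
    have hcond : (σ.arr 5 (x / n) ≠ 0 ∧ σ.arr 5 (x % n) = 0 ∧ AdjIdx T (x / n) (x % n)) ↔
        Expr.eval σ₂ (.equal (.read 5 (.reg 13)) (.lit 0) * .read 0 (.reg 11) *
          .read 5 (.reg 12)) ≠ 0 := by
      simp [hr, g12, g13, g5, ga]
      tauto
    refine Runs.ite (T₁ := 5) ?_ (fun hc => ?_) (fun hc => ?_) (by decide)
    · simp only [Expr.fits_mul, Expr.fits_equal hB1, Expr.fits_read, Expr.fits_reg, Expr.fits_lit,
        Expr.eval_mul, Expr.eval_equal, Expr.eval_read, Expr.eval_reg, Expr.eval_lit, hr, g12, g13,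
        g5, ga]
      refine ⟨⟨⟨⟨?_, ?_⟩, ?_⟩, ⟨?_, ?_⟩, ?_⟩, ⟨?_, ?_⟩, ?_⟩ <;> (try split_ifs) <;> (try simp) <;> omega
    · rw [← hcond] at hc
      refine Runs.straight rfl (by decide) ?_ ?_
      · simp [Program.Safe, Program.run, g12, g13]
        omega
      · intro _
        simp [Program.run, g12, g13]
        exact ⟨hu, hv, hc⟩
    · rw [not_iff_not.2 hcond |>.trans not_ne_iff |>.symm] at hc
      refine Runs.straight rfl (by decide) trivial ?_
      rintro ⟨y, hy, h⟩
      have hyx : y ≠ x := fun h' => hc (h' ▸ h)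
      simpa [Program.run] using hinv ⟨y, by omega, h⟩
  · intro σ' _ hinv
    obtain ⟨u, hu, v, hv, h1, h2, h3⟩ := hE.exists_edge hT h0 hi
    have hdiv : (u * n + v) / n = u := by
      rw [Nat.mul_comm, Nat.mul_add_div hn, Nat.div_eq_of_lt hv, add_zero]
    have hmod : (u * n + v) % n = v := by rw [Nat.mul_comm, Nat.mul_add_mod, Nat.mod_eq_of_lt hv]
    refine hinv ⟨u * n + v, ?_, by rwa [hdiv], by rwa [hmod], by rwa [hdiv, hmod]⟩
    have : (u + 1) * n ≤ n * n := Nat.mul_le_mul_right _ hu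
    nlinarith
  · simp only [Expr.size]; omega

theorem rooting_spec (hn : 0 < n) (hB : n * n + 2 * n + 10 < B) (hG : StoresGraph T σ)
    (hT : T.Connected) (h4 : ∀ i, σ.arr 4 i = 0) (h5 : ∀ i, σ.arr 5 i = 0)
    (h6 : ∀ i, σ.arr 6 i = 0) :
    Runs B rooting σ (100 * (n * n * n) + 20) (Enumerated T n) := by
  have hB1 : 1 < B := by omega
  refine Runs.seq (T₁ := 3) (T₂ := 100 * (n * n * n) + 10) (Q' := fun σ' => Enumerated T 1 σ') ?_ ?_
    (by omega)
  · refine Runs.straight rfl (by decide) (by simp [Program.Safe]; omega) ?_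
    constructor
    · intro j _; simp [Program.run, h4, hn]
    · intro j hj
      obtain rfl : j = 0 := by omega
      simp [Program.run, h4]
    · intro v hv hne
      by_cases h : v = 0
      · simp [Program.run, h, h4]
      · simp [Program.run, h5, Function.update_of_ne h] at hne
    · intro j hj hj'; omega
    · intro j _; simp [Program.run, h6]
  intro σ₁ hf hE
  have hG₁ : StoresGraph T σ₁ := ⟨by rw [hf.reg 0 rfl, hG.1], by rw [hf.arr 0 rfl]; exact hG.2⟩
  clear hf
  refine Runs.forLoop (Tb := 50 * (n * n) + 30) 1 n (fun i σ' => Enumerated T i σ') rfl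
    ⟨by simp; omega, rfl⟩ hn (by omega) (fun σ' hf => ?_) (hE.congr rfl rfl rfl) ?_
    (fun σ' _ h => h) ?_
  · have h0 : σ'.reg 0 = n := by rw [hf.reg 0 rfl, hG₁.1]
    simp [h0]; omega
  · intro i σ' hf h0 hi hr hE'
    have hG' : StoresGraph T σ' := ⟨by rw [hf.reg 0 rfl, hG₁.1], by rw [hf.arr 0 rfl]; exact hG₁.2⟩
    refine Runs.seq (T₁ := 50 * (n * n) + 10) (T₂ := 20) (findEdge_spec hn hB hG' hE' hT h0 hi) ?_
      (by omega)
    rintro σ₂ hf₂ ⟨hu, hv, h1, h2, h3⟩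
    rw [← hf₂.arr 5 rfl] at h1 h2
    replace hr : σ₂.reg 10 = i := by rw [hf₂.reg 10 rfl, hr]
    replace hE' := hE'.congr (hf₂.arr 4 rfl) (hf₂.arr 5 rfl) (hf₂.arr 6 rfl)
    generalize gu : σ₂.reg 14 = u at *
    generalize gv : σ₂.reg 15 = v at *
    obtain ⟨h6, h7⟩ := hE'.ord_pos u hu h1
    refine Runs.straight rfl (by decide) ?_ ?_
    · simp [Program.Safe, Program.run, hr, gu, gv]
      omega
    · have hpos_ne : ∀ j < i, σ₂.arr 4 j ≠ v := fun j hj h => by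
        have := hE'.pos_ord j hj
        rw [h] at this
        omega
      have e4 : ((Program.run (.seq (.store 4 (.reg 10) (.reg 15)) <|
          .seq (.store 6 (.reg 10) (.read 5 (.reg 14) - .lit 1)) <|
          .store 5 (.reg 15) (.reg 10 + .lit 1)) σ₂).setReg 10 (i + 1)).arr 4 =
          Function.update (σ₂.arr 4) i v := by simp [Program.run, hr, gv]
      have e6 : ((Program.run (.seq (.store 4 (.reg 10) (.reg 15)) <|
          .seq (.store 6 (.reg 10) (.read 5 (.reg 14) - .lit 1)) <|
          .store 5 (.reg 15) (.reg 10 + .lit 1)) σ₂).setReg 10 (i + 1)).arr 6 =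
          Function.update (σ₂.arr 6) i (σ₂.arr 5 u - 1) := by simp [Program.run, hr, gu]
      have e5 : ((Program.run (.seq (.store 4 (.reg 10) (.reg 15)) <|
          .seq (.store 6 (.reg 10) (.read 5 (.reg 14) - .lit 1)) <|
          .store 5 (.reg 15) (.reg 10 + .lit 1)) σ₂).setReg 10 (i + 1)).arr 5 =
          Function.update (σ₂.arr 5) v (i + 1) := by simp [Program.run, hr, gv]
      constructor
      · rw [e4]
        intro j hj
        rcases Nat.lt_succ_iff_lt_or_eq.1 hj with hj | rfl
        · rw [Function.update_of_ne hj.ne]; exact hE'.ord_lt j hj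
        · rwa [Function.update_self]
      · rw [e4, e5]
        intro j hj
        rcases Nat.lt_succ_iff_lt_or_eq.1 hj with hj | rfl
        · rw [Function.update_of_ne hj.ne, Function.update_of_ne (hpos_ne j hj)]
          exact hE'.pos_ord j hj
        · rw [Function.update_self, Function.update_self]
      · rw [e4, e5]
        intro x hx hne
        by_cases hxv : x = v
        · rw [hxv, Function.update_self]
          simp
        · rw [Function.update_of_ne hxv] at hne ⊢
          obtain ⟨h8, h9⟩ := hE'.ord_pos x hx hne
          exact ⟨by omega, by rw [Function.update_of_ne (by omega), h9]⟩
      · rw [e4, e6]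
        intro j hj0 hj
        rcases Nat.lt_succ_iff_lt_or_eq.1 hj with hj | rfl
        · obtain ⟨h8, h9⟩ := hE'.par j hj0 hj
          rw [Function.update_of_ne hj.ne, Function.update_of_ne hj.ne,
            Function.update_of_ne (by omega)]
          exact ⟨h8, h9⟩
        · rw [Function.update_self, Function.update_self, Function.update_of_ne (by omega), h7]
          exact ⟨by omega, h3⟩
      · rw [e6]
        intro j hj
        rw [Function.update_of_ne (by omega)]
        exact hE'.par_zero j (by omega)
  · simp only [Expr.size]
    have h1 : (n - 1) * (1 + (50 * (n * n) + 30) + 7) ≤ n * (1 + (50 * (n * n) + 30) + 7) :=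
      Nat.mul_le_mul_right _ (Nat.sub_le _ _)
    have h2 : n * 1 ≤ n * (n * n) := Nat.mul_le_mul_left _ (by nlinarith)
    nlinarith

/-- The n - 1 edges to parents are distinct edges of a tree with n - 1 edges, so there are no
others. -/
theorem isRooted_of_parent (hT : T.IsTree) (par : ℕ → ℕ) (e : Fin n ≃ Fin n)
    (hlt : ∀ i, 0 < i → par i < i)
    (hadj : ∀ i j : Fin n, 0 < (j : ℕ) → par j = i → T.Adj (e i) (e j)) :
    GraphSearch.IsRooted T par e := by
  classical
  refine ⟨hlt, fun i j => ⟨fun h => ?_, ?_⟩⟩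
  · have hp : ∀ j : {j : Fin n // 0 < (j : ℕ)}, par j < n := fun j => (hlt j j.2).trans j.1.2
    let f : {j : Fin n // 0 < (j : ℕ)} → Sym2 (Fin n) := fun j => s(e ⟨par j, hp j⟩, e j)
    have hf : Function.Injective f := by
      intro j k hjk
      rcases Sym2.eq_iff.1 hjk with ⟨_, h⟩ | ⟨h1, h2⟩
      · exact Subtype.ext (e.injective h)
      -- Equality with swapped ends is impossible: it would give j = par k < k = par j < j.
      · have h1 := congrArg Fin.val (e.injective h1)
        have h2 := congrArg Fin.val (e.injective h2)
        have h3 := hlt j j.2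
        have h4 := hlt k k.2
        simp only at h1 h2
        omega
    have hsub : univ.image f ⊆ T.edgeFinset := by
      intro x hx
      obtain ⟨j, _, rfl⟩ := mem_image.1 hx
      exact SimpleGraph.mem_edgeFinset.2 (hadj ⟨par j, hp j⟩ j j.2 rfl)
    have hcard : #T.edgeFinset ≤ #(univ.image f) := by
      rw [card_image_of_injective _ hf, card_univ, Fintype.card_subtype]
      have h1 := hT.card_edgeFinset
      rw [Fintype.card_fin] at h1
      have h2 : #{j : Fin n | ¬ 0 < (j : ℕ)} ≤ 1 := by
        refine card_le_one.2 fun a ha b hb => Fin.ext ?_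
        simp only [mem_filter, mem_univ, true_and] at ha hb
        omega
      have h3 := card_filter_add_card_filter_not (s := (univ : Finset (Fin n)))
        (fun j : Fin n => 0 < (j : ℕ))
      rw [card_univ, Fintype.card_fin] at h3
      omega
    have hmem : s(e i, e j) ∈ univ.image f := by
      rw [eq_of_subset_of_card_le hsub hcard]
      exact SimpleGraph.mem_edgeFinset.2 h
    obtain ⟨k, _, hk⟩ := mem_image.1 hmem
    rcases Sym2.eq_iff.1 hk with ⟨h1, h2⟩ | ⟨h1, h2⟩
    · have h1 := congrArg Fin.val (e.injective h1)
      have h2 := congrArg Fin.val (e.injective h2)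
      left
      rw [← h1, ← h2]
      exact ⟨k.2, rfl⟩
    · have h1 := congrArg Fin.val (e.injective h1)
      have h2 := congrArg Fin.val (e.injective h2)
      right
      rw [← h1, ← h2]
      exact ⟨k.2, rfl⟩
  · rintro (⟨h0, h⟩ | ⟨h0, h⟩)
    · exact hadj i j h0 h
    · exact (hadj j i h0 h).symm

end Rooting

open GraphSearch

/-! ### The approximation algorithm -/

/-- Compute the parameters `L`, `K = n * L` and `K + 1`. -/
def parameters : Program :=
  .seq (.assign 3 (.lit 2 + .lit 4 * .reg 2 / .reg 1)) <|
  .seq (.assign 4 (.reg 0 * .reg 3)) (.assign 6 (.reg 4 + .lit 1))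

/-- Mark all vertices. -/
def markAll : Program := .forLoop 11 (.lit 0) (.reg 0) (.store 15 (.reg 11) (.lit 1))

/-- The approximation algorithm for the tree search problem. -/
def treeSearch : Program :=
  .seq rooting <| .seq parameters <| .seq computeMax <| .seq (.while (.reg 5) phase) <|
  .seq markAll queryMarked

/-! ### Correctness and running time of the whole program -/

section Main

variable {B n K L : ℕ} {par ord c w : ℕ → ℕ} {σ : State}

/-- The part of the algorithm after the preparation of the data. -/
theorem main_loop_spec (hσ : Data B n (n * L) par ord c w σ) (hL : 2 ≤ L)
    (h3 : ∀ i, σ.arr 3 i = 0) (h7 : ∀ i, σ.arr 7 i = 0) :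
    Runs B (.seq computeMax <| .seq (.while (.reg 5) phase) <| .seq markAll queryMarked) σ
      (2000 * (n * n * (n * L + 1) * (n * L + 1)))
      (fun σ' => ∃ A, Eliminated n par ord w c (range n) A σ' ∧
        ∀ h, IsProfile n par w h → (L - 1) * A ≤ 2 * L * ∑ v ∈ range n, c v * (2 * h v)) := by
  have hB := hσ.n_lt
  have hn := hσ.n_pos
  obtain ⟨K, hK⟩ : ∃ K, n * L = K := ⟨_, rfl⟩
  have hnK : n * 2 ≤ K := by rw [← hK]; exact Nat.mul_le_mul_left _ hL
  have h1 : n * 1 ≤ n * n := Nat.mul_le_mul_left _ hn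
  have h2 : n * n * 9 ≤ n * n * ((K + 1) * (K + 1)) := Nat.mul_le_mul_left _ (by nlinarith)
  have h2' : n * n * (K + 1) * (K + 1) = n * n * ((K + 1) * (K + 1)) := by ring
  have hE : Eliminated n par ord w c ∅ 0 σ :=
    ⟨fun i => by simp [h7], fun _ => 0, .init, fun u _ => by simp [h3]⟩
  rw [hK]
  refine Runs.seq (T₁ := 110 * n + 110) (T₂ := 1900 * (n * n * (K + 1) * (K + 1)))
    (computeMax_spec hσ hE.set) ?_ (by nlinarith)
  rintro σ₁ hf ⟨hmax, hmax'⟩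
  replace hσ := hσ.frame hf rfl
  replace hE := hE.congr (hf.arr 7 rfl) (hf.arr 3 rfl)
  clear hf
  have hP : Progress n par ord w c L ∅ 0 σ₁ := by
    refine ⟨hE, hmax, hmax', fun h _ => ?_⟩
    rw [mul_zero, zero_add]
    gcongr
    exact min_le_left _ _
  -- At most `n` phases; the excess of 1002 over 1000 absorbs the 2 steps of each guard.
  refine Runs.seq (T₁ := n * (1002 * n * (K + 1) * (K + 1)) + 2)
    (T₂ := 800 * (n * n * (K + 1) * (K + 1)))
    (Q' := fun σ' => ∃ R A, Progress n par ord w c L R A σ' ∧ σ'.reg 5 = 0) ?_ ?_ (by nlinarith)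
  · refine Runs.whileLoop (Tb := 1000 * n * (n * L + 1) * (n * L + 1)) (fun m σ' => ∃ R A,
      m = n - #R ∧ Progress n par ord w c L R A σ') ?_ ?_ ?_ n ⟨∅, 0, by simp, hP⟩ ?_
    · rintro m σ' hf ⟨R, A, -, hP⟩
      have := (hσ.frame hf rfl).bound_w
      obtain ⟨r, hr⟩ := hP.max_le
      have := hr.trans (classWeight_le_sum R r)
      simp only [Expr.fits_reg]
      omega
    · rintro m σ' hf ⟨R, A, rfl, hP⟩ h5
      refine (phase_spec (hσ.frame hf rfl) hL hP h5).mono le_rfl ?_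
      rintro σ'' _ ⟨R', A', hlt, hP'⟩
      exact ⟨n - #R', hlt, R', A', rfl, hP'⟩
    · rintro m σ' hf ⟨R, A, -, hP⟩ h5
      exact ⟨R, A, hP, h5⟩
    · rw [hK]
      simp only [Expr.size]
      have : n * 2 ≤ n * (2 * (n * ((K + 1) * (K + 1)))) :=
        Nat.mul_le_mul_left _ (by nlinarith)
      nlinarith
  rintro σ₂ hf ⟨R, A, ⟨hE, hmax, -, hpot⟩, h5⟩
  -- All remaining components have weight 0, so the final queries add nothing to the cost.
  rw [h5] at hmax hpot
  replace hσ := hσ.frame hf rfl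
  clear hf
  refine Runs.seq (T₁ := 20 * n + 10) (T₂ := 110 * n * (n + 1) + 30 * n + 10)
    (Q' := StoresMarks n (range n)) ?_ ?_ (by nlinarith)
  · refine Runs.forLoop (Tb := 4) 0 n (fun j σ' => ∀ i < j, σ'.arr 15 i = 1) rfl
      ⟨by simp; omega, rfl⟩ (Nat.zero_le n) (by omega) (fun σ' hf => ?_) (by simp) ?_ ?_ ?_
    · simp [(hσ.frame hf rfl).reg_n]; omega
    · intro j σ' hf _ hj hr hi
      refine Runs.straight rfl (by decide) ?_ ?_
      · simp [Program.Safe, hr]; omega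
      · simpa [Program.run, hr] using update_prefix (g := fun _ => 1) hi rfl
    · exact fun σ' _ hi i hin => by simp [hi i hin, hin]
    · simp only [Expr.size]; omega
  intro σ₃ hf hmark
  refine (queryMarked_spec (hσ.frame hf rfl) (hE.congr (hf.arr 7 rfl) (hf.arr 3 rfl)) hmark
    Subset.rfl hmax).mono le_rfl ?_
  rintro σ₄ _ ⟨A', hA', hE'⟩
  obtain ⟨res, he, _⟩ := hE.elim
  rw [union_eq_right.2 he.subset] at hE'
  refine ⟨A', hE', fun h hh => ?_⟩
  have h3 := hpot h hh
  rw [zero_mul, add_zero] at hA'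
  exact (Nat.mul_le_mul_left _ hA').trans ((Nat.le_add_right _ _).trans h3)

theorem storesGraph_input {T : SimpleGraph (Fin n)} (hn : 0 < n) (cV wV : Fin n → ℕ) (p q : ℕ) :
    StoresGraph T (input T cV wV p q) := by
  refine ⟨rfl, fun x hx => ?_⟩
  have hx' : x / n < n := (Nat.div_lt_iff_lt_mul hn).2 hx
  have hm : x % n < n := Nat.mod_lt _ hn
  have hiff : (∃ u v : Fin n, x = (u : ℕ) * n + v ∧ T.Adj u v) ↔ AdjIdx T (x / n) (x % n) := by
    constructor
    · rintro ⟨u, v, rfl, h⟩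
      have h1 : ((u : ℕ) * n + v) / n = u := by
        rw [Nat.mul_comm, Nat.mul_add_div hn, Nat.div_eq_of_lt v.2, add_zero]
      have h2 : ((u : ℕ) * n + v) % n = v := by
        rw [Nat.mul_comm, Nat.mul_add_mod, Nat.mod_eq_of_lt v.2]
      rw [h1, h2]
      exact ⟨u.2, v.2, h⟩
    · rintro ⟨h1, h2, h⟩
      exact ⟨_, _, (Nat.div_add_mod' x n).symm, h⟩
  simp only [input, if_true]
  by_cases h : AdjIdx T (x / n) (x % n)
  · rw [if_pos h, if_pos (hiff.2 h)]
  · rw [if_neg h, if_neg (hiff.not.2 h)]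

/-- All intermediate results fit into a machine word. -/
theorem wordBound_spec {n : ℕ} (hn : 0 < n) (cV wV : Fin n → ℕ) {p q : ℕ} (hp : 0 < p)
    (hq : 0 < q) {K : ℕ} (hK : K ≤ n * (2 + 4 * q)) :
    n * n + 2 * n + 10 < wordBound 10 cV wV p q ∧ 4 * q + 10 < wordBound 10 cV wV p q ∧
    p < wordBound 10 cV wV p q ∧
    n * (K + 2) + 2 * K + 10 < wordBound 10 cV wV p q ∧
    4 * ∑ v, cV v + 4 < wordBound 10 cV wV p q ∧ ∑ v, wV v + 4 < wordBound 10 cV wV p q ∧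
    (∑ v, wV v) * (2 * K) < wordBound 10 cV wV p q := by
  unfold wordBound
  obtain ⟨X, hX⟩ : ∃ X, n + ∑ v, cV v + ∑ v, wV v + p + q + 2 = X := ⟨_, rfl⟩
  rw [hX]
  generalize ∑ v, cV v = C at *
  generalize ∑ v, wV v = W at *
  -- As n, p, q ≥ 1. Each further power gains a factor 5, which absorbs the coefficients: the
  -- largest products, n * K and W * K, are at most X ^ 4.
  have h5 : 5 ≤ X := by omega
  have e2 : 5 * X ≤ X ^ 2 := by nlinarith
  have e3 : 5 * X ^ 2 ≤ X ^ 3 := by nlinarith [Nat.zero_le (X ^ 2), pow_succ X 2]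
  have e4 : 5 * X ^ 3 ≤ X ^ 4 := by nlinarith [Nat.zero_le (X ^ 3), pow_succ X 3]
  have e5 : 5 * X ^ 4 ≤ X ^ 5 := by nlinarith [Nat.zero_le (X ^ 4), pow_succ X 4]
  have e6 : X ^ 5 < X ^ 10 := Nat.pow_lt_pow_right (by omega) (by norm_num)
  have hn2 : n * n ≤ X ^ 2 := by rw [pow_two]; exact Nat.mul_le_mul (by omega) (by omega)
  have hK3 : K ≤ X ^ 3 := by
    calc K ≤ n * (2 + 4 * q) := hK
      _ ≤ X * X ^ 2 := Nat.mul_le_mul (by omega) (by omega)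
      _ = X ^ 3 := by ring
  have hnK : n * K ≤ X ^ 4 := by
    calc n * K ≤ X * X ^ 3 := Nat.mul_le_mul (by omega) hK3
      _ = X ^ 4 := by ring
  have hWK : W * K ≤ X ^ 4 := by
    calc W * K ≤ X * X ^ 3 := Nat.mul_le_mul (by omega) hK3
      _ = X ^ 4 := by ring
  have : n * (K + 2) = n * K + 2 * n := by ring
  have : W * (2 * K) = 2 * (W * K) := by ring
  refine ⟨?_, ?_, ?_, ?_, ?_, ?_, ?_⟩ <;> omega

/-- The correctness and the running time of the algorithm, with the accuracy parameter `L`. -/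
theorem treeSearch_spec {n : ℕ} {T : SimpleGraph (Fin n)} (hT : T.IsTree) (cV wV : Fin n → ℕ)
    {p q : ℕ} (hp : 0 < p) (hq : 0 < q) :
    ∃ (final : State) (t : ℕ) (D : DecisionTree T Set.univ),
      Exec (wordBound 10 cV wV p q) treeSearch (input T cV wV p q) final t ∧
      t ≤ 3000 * (n * n * (n * (2 + 4 * q / p) + 1) * (n * (2 + 4 * q / p) + 1)) ∧
      D.StoredAs (final.arr 3) 0 ∧
      (1 + 4 * q / p) * D.avgCost (fun v _ => cV v) wV ≤
        4 * (2 + 4 * q / p) * OPT T (fun v _ => cV v) wV := by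
  have hn : 0 < n := by
    obtain ⟨v⟩ := hT.1.nonempty
    exact v.pos
  obtain ⟨L, hL⟩ : ∃ L, 2 + 4 * q / p = L := ⟨_, rfl⟩
  have hLq : L ≤ 2 + 4 * q := by
    rw [← hL]; exact Nat.add_le_add_left (Nat.div_le_self _ _) _
  obtain ⟨hB1, hB2, hB3, hB4, hB5, hB6, hB7⟩ := wordBound_spec hn cV wV hp hq
    (K := n * L) (Nat.mul_le_mul_left _ hLq)
  have hL1 : 1 + 4 * q / p = L - 1 := by
    rw [← hL, Nat.add_comm 2, Nat.add_comm 1]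
    rfl
  have hL2 : 2 ≤ L := by
    rw [← hL]
    exact Nat.le_add_right _ _
  rw [hL, hL1]
  generalize wordBound 10 cV wV p q = B at *
  set σ := input T cV wV p q with hσ
  obtain ⟨X, hX⟩ : ∃ X, n * n * (n * L + 1) * (n * L + 1) = X := ⟨_, rfl⟩
  have hX9 : 9 ≤ X := by
    have h1 : 1 * 2 ≤ n * L := Nat.mul_le_mul hn hL2
    calc 9 = 1 * 1 * (2 + 1) * (2 + 1) := rfl
      _ ≤ n * n * (n * L + 1) * (n * L + 1) := by gcongr <;> omega
      _ = X := hX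
  have hcube : n * n * n ≤ X := by
    have h1 : n * 1 ≤ n * L := Nat.mul_le_mul_left _ (by omega)
    calc n * n * n = n * n * n * 1 := (mul_one _).symm
      _ ≤ n * n * (n * L + 1) * (n * L + 1) := by gcongr <;> omega
      _ = X := hX
  rw [hX]
  have key : Runs B treeSearch σ (3000 * X) (fun σ' =>
      ∃ D : DecisionTree T Set.univ, D.StoredAs (σ'.arr 3) 0 ∧
        ∀ D' : DecisionTree T Set.univ, (L - 1) * D.avgCost (fun v _ => cV v) wV ≤
          4 * L * D'.avgCost (fun v _ => cV v) wV) := by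
    refine Runs.seq (T₁ := 100 * (n * n * n) + 20)
      (T₂ := 2500 * X)
      (rooting_spec hn hB1 (storesGraph_input hn cV wV p q) hT.1 (fun _ => rfl) (fun _ => rfl)
        fun _ => rfl) ?_ (by linarith)
    intro σ₁ hf hE
    have g0 : σ₁.reg 0 = n := hf.reg 0 rfl
    have g1 : σ₁.reg 1 = p := hf.reg 1 rfl
    have g2 : σ₁.reg 2 = q := hf.reg 2 rfl
    have ga1 : σ₁.arr 1 = σ.arr 1 := hf.arr 1 rfl
    have ga2 : σ₁.arr 2 = σ.arr 2 := hf.arr 2 rfl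
    have ga3 : ∀ i, σ₁.arr 3 i = 0 := by rw [hf.arr 3 rfl]; exact fun _ => rfl
    have ga7 : ∀ i, σ₁.arr 7 i = 0 := by rw [hf.arr 7 rfl]; exact fun _ => rfl
    clear hf
    have hnL : n * L < B := by
      have : n * (n * L + 2) = n * (n * L) + 2 * n := by ring
      omega
    refine Runs.seq (T₁ := 20) (T₂ := 2100 * X)
      (Q' := fun σ' => σ'.reg 4 = n * L ∧ σ'.reg 6 = n * L + 1) ?_ ?_ (by omega)
    · refine Runs.straight rfl (by decide) ?_ ?_
      · simp [parameters, Program.Safe, Program.run, g0, g1, g2, hL]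
        have : L ≤ 4 * q + 2 := by omega
        omega
      · simp [parameters, Program.run, g0, g1, g2, hL]
    rintro σ₂ hf ⟨g4, g6⟩
    rw [← hf.reg 0 rfl] at g0
    rw [← hf.arr 1 rfl] at ga1
    rw [← hf.arr 2 rfl] at ga2
    rw [← hf.arr 3 rfl] at ga3
    rw [← hf.arr 7 rfl] at ga7
    replace hE := hE.congr (hf.arr 4 rfl) (hf.arr 5 rfl) (hf.arr 6 rfl)
    clear hf
    obtain ⟨ord, hord⟩ : ∃ ord, σ₂.arr 4 = ord := ⟨_, rfl⟩
    obtain ⟨par, hpar⟩ : ∃ par, σ₂.arr 6 = par := ⟨_, rfl⟩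
    obtain ⟨ho1, ho2, -, ho3, ho4⟩ := hE
    rw [hord] at ho1 ho2 ho3
    rw [hpar] at ho3 ho4
    have hlt : ∀ i, 0 < i → par i < i := by
      intro i hi
      rcases Nat.lt_or_ge i n with h | h
      · exact (ho3 i hi h).1
      · rw [ho4 i (Or.inr h)]; exact hi
    have hinj : ∀ i < n, ∀ j < n, ord i = ord j → i = j := by
      intro i hi j hj hij
      have h1 := ho2 i hi
      have h2 := ho2 j hj
      rw [hij] at h1
      omega
    let e : Fin n ≃ Fin n := Equiv.ofBijective (fun i => ⟨ord i, ho1 i i.2⟩)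
      (Finite.injective_iff_bijective.1 fun i j hij =>
        Fin.ext (hinj i i.2 j j.2 (congrArg Fin.val hij)))
    have heord : ∀ i : Fin n, ord i = e i := fun i => rfl
    have hR : IsRooted T par e := by
      refine isRooted_of_parent hT par e hlt fun i j h0 hij => ?_
      obtain ⟨_, h1, h2, h3⟩ := ho3 j h0 j.2
      have h4 : e i = ⟨ord (par j), h1⟩ := Fin.ext (congrArg ord hij.symm)
      rw [h4]
      exact h3
    set w : ℕ → ℕ := fun i => σ.arr 2 (ord i) with hw
    set c : ℕ → ℕ := fun i => σ.arr 1 (ord i) with hc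
    have hwV : ∀ i : Fin n, w i = wV (e i) := fun i => by
      have h1 := ho1 i i.2
      simp only [hw, hσ, input]
      simp [h1]
      rfl
    have hcV : ∀ i : Fin n, c i = cV (e i) := fun i => by
      have h1 := ho1 i i.2
      simp only [hc, hσ, input]
      simp [h1]
      rfl
    have hsumw : ∑ v ∈ range n, w v = ∑ v, wV v := by
      rw [sum_range]
      exact Fintype.sum_equiv e _ _ hwV
    have hsumc : ∑ v ∈ range n, c v = ∑ v, cV v := by
      rw [sum_range]
      exact Fintype.sum_equiv e _ _ hcV
    have hdata : Data B n (n * L) par ord c w σ₂ :=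
      { n_pos := hn
        lt := hlt
        par_zero := ho4 0 (Or.inl rfl)
        ord_lt := ho1
        ord_inj := hinj
        reg_n := g0
        reg_K := g4
        reg_K' := g6
        arr_par := hpar
        arr_ord := hord
        arr_c := fun i _ => by rw [ga1]
        arr_w := fun i _ => by rw [ga2]
        bound := hB4
        bound_c := by rw [hsumc]; exact hB5
        bound_w := by rw [hsumw]; exact hB6
        bound_wK := fun i hi => by
          refine lt_of_le_of_lt (Nat.mul_le_mul_right _ ?_) hB7
          rw [← hsumw]
          exact single_le_sum (f := w) (fun _ _ => Nat.zero_le _) (mem_range.2 hi) }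
    refine (main_loop_spec hdata hL2 ga3 ga7).mono (by rw [hX]; omega) ?_
    rintro σ₃ _ ⟨A, ⟨hset, res, hel, hres⟩, hopt⟩
    -- All vertices have been eliminated, so the requirement on trees for remaining components is
    -- vacuous.
    obtain ⟨D, hD1, hD2⟩ := hR.exists_tree_of_elim hn heord hwV hcV hel (σ₃.arr 3)
      (fun i _ => hres i i.2) (fun _ => 0) (fun i hi => absurd (mem_range.2 i.2) hi)
    refine ⟨D, hD1, fun D' => ?_⟩
    have h1 := hopt _ (hR.isProfile hwV D')
    have h2 := sum_candidateWeight_le (e := e) (wV := wV) hcV D'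
    have h3 : D.avgCost (fun v _ => cV v) wV = A := by simpa using hD2
    rw [h3]
    refine h1.trans ?_
    calc 2 * L * ∑ v ∈ range n, c v * (2 * candidateWeight e wV D' v)
        = 4 * L * ∑ v ∈ range n, c v * candidateWeight e wV D' v := by
          rw [mul_sum, mul_sum]
          exact sum_congr rfl fun v _ => by ring
      _ ≤ _ := Nat.mul_le_mul_left _ h2
  obtain ⟨final, t, hexec, ht, D, hD, hopt⟩ := key
  refine ⟨final, t, D, hexec, ht, hD, ?_⟩
  -- The infimum of a nonempty set of natural numbers is attained; the tree just built shows
  -- nonemptiness.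
  have : Nonempty (DecisionTree T Set.univ) := ⟨D⟩
  obtain ⟨D', hD'⟩ := Nat.sInf_mem (Set.range_nonempty
    fun D : DecisionTree T Set.univ => D.avgCost (fun v _ => cV v) wV)
  have h := hopt D'
  rwa [show D'.avgCost (fun v _ => cV v) wV = OPT T (fun v _ => cV v) wV from hD'] at h

end Main

end TreeSeparator

/-! ### Translation into real constants -/

theorem mainTheorem2 :
    ∃ (P : WordRAM.Program) (κ : ℕ) (C : ℝ),
      ∀ (ε : ℝ), 0 < ε →
      ∀ (p q : ℕ), 0 < q → ε / 2 ≤ (p : ℝ) / q → (p : ℝ) / q ≤ ε →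
      ∀ (n : ℕ) (T : SimpleGraph (Fin n)), T.IsTree →
      ∀ (c w : Fin n → ℕ),
        ∃ (final : WordRAM.State) (t : ℕ) (D : GraphSearch.DecisionTree T Set.univ),
          WordRAM.Exec (GraphSearch.wordBound κ c w p q) P (GraphSearch.input T c w p q) final t ∧
          (t : ℝ) ≤ C * (n : ℝ) ^ 4 * max 1 (1 / ε ^ 2) ∧
          D.StoredAs (final.arr 3) 0 ∧
          (D.avgCost (fun v _ => c v) w : ℝ) ≤
            (4 + ε) * (GraphSearch.OPT T (fun v _ => c v) w : ℝ) := by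
  -- The factor 121 is 11 ^ 2, from l + 3 ≤ 11 * max(1, 1 / ε) with l = ⌊4q / p⌋.
  refine ⟨TreeSeparator.treeSearch, 10, 3000 * 121, ?_⟩
  intro ε hε p q hq h1 h2 n T hT c w
  have hq' : (0 : ℝ) < q := by exact_mod_cast hq
  have hpq : (0 : ℝ) < (p : ℝ) / q := lt_of_lt_of_le (by positivity) h1
  have hp' : (0 : ℝ) < p := by
    rcases (Nat.cast_nonneg (α := ℝ) p).eq_or_lt with h | h
    · rw [← h, zero_div] at hpq
      exact absurd hpq (lt_irrefl _)
    · exact h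
  have hp : 0 < p := by exact_mod_cast hp'
  have hn : 1 ≤ n := by
    obtain ⟨v⟩ := hT.1.nonempty
    exact v.pos
  obtain ⟨final, t, D, hexec, ht, hD, hopt⟩ := TreeSeparator.treeSearch_spec hT c w hp hq
  obtain ⟨l, hl⟩ : ∃ l, 4 * q / p = l := ⟨_, rfl⟩
  rw [hl] at ht hopt
  refine ⟨final, t, D, hexec, ?_, hD, ?_⟩
  -- The lower bound p / q ≥ ε / 2 enters only in the running time: l ≤ 4q / p ≤ 8 / ε.
  · have hlε : (l : ℝ) * ε ≤ 8 := by
      have h3 : l * p ≤ 4 * q := by rw [← hl]; exact Nat.div_mul_le_self _ _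
      have h4 : (l : ℝ) * p ≤ 4 * q := by exact_mod_cast h3
      have h5 : ε * q ≤ 2 * p := by
        rw [le_div_iff₀ hq'] at h1
        linarith
      have h6 : (l : ℝ) * ε * q ≤ 8 * q := by
        nlinarith [Nat.cast_nonneg (α := ℝ) l]
      exact le_of_mul_le_mul_right h6 hq'
    have hm : ((l : ℝ) + 3) ^ 2 ≤ 121 * max 1 (1 / ε ^ 2) := by
      rcases le_or_gt 1 ε with hε1 | hε1
      · have : (l : ℝ) ≤ 8 := by nlinarith [Nat.cast_nonneg (α := ℝ) l]
        have h0 := Nat.cast_nonneg (α := ℝ) l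
        calc ((l : ℝ) + 3) ^ 2 ≤ 121 * 1 := by nlinarith
          _ ≤ _ := by gcongr; exact le_max_left _ _
      · have h3 : ((l : ℝ) + 3) * ε ≤ 11 := by nlinarith
        have h0 : 0 ≤ ((l : ℝ) + 3) * ε := by positivity
        calc ((l : ℝ) + 3) ^ 2 = (((l : ℝ) + 3) * ε) ^ 2 * (1 / ε ^ 2) := by field_simp
          _ ≤ 121 * (1 / ε ^ 2) := by gcongr; nlinarith
          _ ≤ _ := by gcongr; exact le_max_right _ _
    have ht' : t ≤ 3000 * (n ^ 4 * (l + 3) ^ 2) := by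
      refine ht.trans (Nat.mul_le_mul_left _ ?_)
      have h3 : n * (2 + l) + 1 ≤ n * (l + 3) := by nlinarith
      calc n * n * (n * (2 + l) + 1) * (n * (2 + l) + 1)
          ≤ n * n * (n * (l + 3)) * (n * (l + 3)) := by gcongr
        _ = _ := by ring
    calc (t : ℝ) ≤ 3000 * ((n : ℝ) ^ 4 * ((l : ℝ) + 3) ^ 2) := by exact_mod_cast ht'
      _ ≤ 3000 * ((n : ℝ) ^ 4 * (121 * max 1 (1 / ε ^ 2))) := by gcongr
      _ = _ := by ring
  -- The upper bound p / q ≤ ε gives the ratio: with L - 1 = l + 1 ≥ 4 / ε, the factor 4L / (L - 1)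
  -- = 4 + 4 / (l + 1) is at most 4 + ε.
  · have hlε : 4 ≤ ((l : ℝ) + 1) * ε := by
      have h3 : 4 * q < (l + 1) * p := by
        rw [← hl, Nat.add_mul, one_mul]
        exact Nat.lt_div_mul_add hp
      have h4 : 4 * (q : ℝ) ≤ ((l : ℝ) + 1) * p := by exact_mod_cast h3.le
      have h5 : (p : ℝ) ≤ ε * q := by rwa [div_le_iff₀ hq'] at h2
      have h6 : 4 * (q : ℝ) ≤ ((l : ℝ) + 1) * ε * q := by
        nlinarith [Nat.cast_nonneg (α := ℝ) l]
      exact le_of_mul_le_mul_right h6 hq'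
    have hopt' : (1 + (l : ℝ)) * (D.avgCost (fun v _ => c v) w : ℝ) ≤
        4 * (2 + l) * (GraphSearch.OPT T (fun v _ => c v) w : ℝ) := by exact_mod_cast hopt
    have h0 := Nat.cast_nonneg (α := ℝ) (GraphSearch.OPT T (fun v _ => c v) w)
    have hl0 : (0 : ℝ) < 1 + l := by positivity
    refine le_of_mul_le_mul_left (hopt'.trans ?_) hl0
    rw [← mul_assoc]
    exact mul_le_mul_of_nonneg_right (by nlinarith) h0
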